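/- Let $k$ be an algebraically closed field of characteristic $0$, let $Y$ be a locally Noetherian scheme over $k$, and let $\varphi\colon X\to Y$ be a covering map of degree $d\ge 1$, i.e. a finite flat morphism such that $\varphi_*\mathcal O_X$ is a locally free $\mathcal O_Y$-module of rank $d$. Definitions. For a locally free $\mathcal O_Y$-module $\mathcal F$ of finite rank put $\mathcal R(\mathcal F)=\bigoplus_{n\ge 0}\operatorname{Sym}^n\mathcal F$. A cover datum $(\mathcal F,\mathcal Q,\sigma)$ consists of such an $\mathcal F$, a graded direct summand $\mathcal Q$ of $\mathcal R(\mathcal F)$ of finite type with $\mathcal Q\cap(\mathcal O_Y\oplus\mathcal F)=0$ such that $\mathcal R(\mathcal F)/\langle\mathcal Q\rangle$ is a finite $\mathcal O_Y$-module ($\langle\mathcal Q\rangle$ is the ideal generated by $\mathcal Q$), and a graded $\mathcal O_Y$-linear section $\sigma$ of $\mathcal R(\mathcal F)\to\mathcal R(\mathcal F)/\langle\mathcal Q\rangle$. A cover homomorphism for it is an $\mathcal O_Y$-linear map $\Phi\colon\mathcal Q\to\mathcal R(\mathcal F)/\langle\mathcal Q\rangle$ which sends homogeneous sections of degree $n$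 to classes of polynomials of degree $<n$, and such that over each affine open $U\subset Y$ the ideal $I_\Phi(U)$ of $\mathcal R(\mathcal F)(U)$ generated by the polynomials $q-\sigma(\Phi(q))$, $q\in\mathcal Q(U)$, is an extension of $\langle\mathcal Q\rangle(U)$: in $\mathcal R(\mathcal F)(U)[t]$, the variable $t$ is a nonzerodivisor modulo the ideal generated by the degree-$n$ homogenizations with respect to $t$ of the polynomials $q-\sigma(\Phi(q))$, for all $n$ and all $q\in\mathcal Q(U)$ homogeneous of degree $n$. Given an isomorphism of $\mathcal O_Y$-modules $\theta\colon\mathcal R(\mathcal F)/\langle\mathcal Q\rangle\to\varphi_*\mathcal O_X$ (so that $\varphi_*\mathcal O_X$ is a direct summand of $\mathcal R(\mathcal F)$), we say that $\Phi$ determines a commutative and associative unital $\mathcal O_Y$-algebra structure $m$ on the $\mathcal O_Y$-module $\varphi_*\mathcal O_X$ if over each affine open $U$ there is a homomorphism of algebras $\pi\colon\mathcal R(\mathcal F)(U)\to(\varphi_*\mathcal O_X(U),m)$ with kernel $I_\Phi(U)$ and $\pi\circ\sigma=\theta$. Theorem. 1. For every cover datum, every $\theta$ and every cover homomorphism $\Phi$,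 there is exactly one commutative and associative unital $\mathcal O_Y$-algebra structure on $\varphi_*\mathcal O_X$ that is determined by $\Phi$. 2. Conversely, every commutative and associative unital $\mathcal O_Y$-algebra structure $m$ on the $\mathcal O_Y$-module $\varphi_*\mathcal O_X$ is determined by a cover homomorphism $\Phi$ for some cover datum $(\mathcal F,\mathcal Q,\sigma)$ and some $\theta$; one may take $\mathcal Q=\operatorname{Sym}^2\mathcal F$ with $\theta(\mathcal F)$ consisting of sections of trace zero for $m$. For fixed $(\mathcal F,\mathcal Q,\sigma)$ and $\theta$, the cover homomorphism $\Phi$ is determined by $m$. 3. For every cover datum, $\theta$ and cover homomorphism $\Phi$ that determine the given algebra structure of $\varphi_*\mathcal O_X$, the map $\varphi$ factors as $\varphi=p\circ i$, where $p\colon\mathbb A=\operatorname{Spec}_Y\bigl(\bigoplus_{n\ge0}\operatorname{Sym}^n\mathcal F\bigr)\to Y$ is the projection and $i\colon X\to\mathbb A$ is a closed embedding, with ideal $I_\Phi$ and with $i^\#\circ\sigma=\theta$; these properties determine $i$ uniquely. 4. Let $(\mathcal F,\mathcal Q,\sigma)$ be a cover datum with $\operatorname{rank}\mathcal F\ge 2$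 and $\mathcal Q\subset\operatorname{Sym}^2\mathcal F$ such that, locally on $Y$, the syzygies over $\mathcal R(\mathcal F)$ of a basis $q_1,\dots,q_m$ of $\mathcal Q$ are generated by syzygies whose entries are linear forms. Then every cover homomorphism $\Phi$ takes values in $\mathcal O_Y\oplus\mathcal F$ and has a well-defined component in $\operatorname{Hom}(\mathcal Q,\mathcal F)$, and this component determines the embedding: two cover homomorphisms with the same component in $\operatorname{Hom}(\mathcal Q,\mathcal F)$ are equal, and if $i_1\colon X_1\to\mathbb A$ and $i_2\colon X_2\to\mathbb A$ are closed embeddings over $Y$ of covers of degree $d$ with the ideals that they define, there is an isomorphism $e\colon X_1\to X_2$ with $i_2\circ e=i_1$. -/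

import Mathlib

open CategoryTheory AlgebraicGeometry TopologicalSpace Opposite

universe u

namespace AlgCover

variable {Y : Scheme.{u}}

/-- Restriction of sections of an `O_Y`-module. -/
noncomputable abbrev secRes (F : Y.Modules) {U V : Y.Opens} (h : V ≤ U) (x : Γ(F, U)) : Γ(F, V) :=
  F.presheaf.map (homOfLE h).op x

/-- Restriction of sections of `O_Y`. -/
abbrev ringRes (Y : Scheme.{u}) {U V : Y.Opens} (h : V ≤ U) : Γ(Y, U) →+* Γ(Y, V) :=
  (Y.presheaf.map (homOfLE h).op).hom

theorem secRes_secRes (F : Y.Modules) {U V W : Y.Opens} (h : V ≤ U) (h' : W ≤ V) (x : Γ(F, U)) :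
    secRes F h' (secRes F h x) = secRes F (h'.trans h) x := by
  simp only [secRes]
  rw [← ConcreteCategory.comp_apply, ← Functor.map_comp]
  rfl

theorem ringRes_ringRes {U V W : Y.Opens} (h : V ≤ U) (h' : W ≤ V) (a : Γ(Y, U)) :
    ringRes Y h' (ringRes Y h a) = ringRes Y (h'.trans h) a := by
  simp only [ringRes]
  rw [← ConcreteCategory.comp_apply, ← Functor.map_comp]
  rfl

theorem secRes_smul (F : Y.Modules) {U V : Y.Opens} (h : V ≤ U) (a : Γ(Y, U)) (x : Γ(F, U)) :
    secRes F h (a • x) = ringRes Y h a • secRes F h x :=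
  F.map_smul _ _ _

/-- `M` is locally free of rank `r`: each point has an open neighbourhood `U` with sections
`b₁, …, b_r` of `M` that define an isomorphism from the restriction of `O_Y ^ r` to `U` to the
restriction of `M`. -/
def IsLocallyFreeOfRank (M : Y.Modules) (r : ℕ) : Prop :=
  ∀ y : Y, ∃ U : Y.Opens, y ∈ U ∧ ∃ b : Fin r → Γ(M, U), ∀ (V : Y.Opens) (h : V ≤ U),
    Function.Bijective fun c : Fin r → Γ(Y, V) => ∑ i, c i • secRes M h (b i)

noncomputable section

/-- `Sym_{O(U)} F(U)`. For `F` quasi-coherent and `U` affine, this is the module of sections over `U`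
of `R(F) = ⨁ Symⁿ F`. -/
abbrev symAlg (F : Y.Modules) (U : Y.Opens) : Type u := SymmetricAlgebra Γ(Y, U) Γ(F, U)

/-- The inclusion of `F(U)` in `Sym_{O(U)} F(U)`. -/
abbrev symι (F : Y.Modules) (U : Y.Opens) : Γ(F, U) →ₗ[Γ(Y, U)] symAlg F U :=
  SymmetricAlgebra.ι Γ(Y, U) Γ(F, U)

theorem symAlg_ringHom_ext {F : Y.Modules} {U : Y.Opens} {S : Type*} [CommRing S]
    {f g : symAlg F U →+* S}
    (h₁ : ∀ a : Γ(Y, U), f (algebraMap _ _ a) = g (algebraMap _ _ a))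
    (h₂ : ∀ v : Γ(F, U), f (symι F U v) = g (symι F U v)) : f = g := by
  refine RingHom.ext fun x => ?_
  induction x using SymmetricAlgebra.induction with
  | algebraMap r => exact h₁ r
  | ι x => exact h₂ x
  | mul a b ha hb => rw [map_mul, map_mul, ha, hb]
  | add a b ha hb => rw [map_add, map_add, ha, hb]

/-- Restriction of sections of `R(F)`. -/
def symRes (F : Y.Modules) {U V : Y.Opens} (h : V ≤ U) : symAlg F U →+* symAlg F V :=
  letI : Algebra Γ(Y, U) (symAlg F V) :=
    ((algebraMap Γ(Y, V) (symAlg F V)).comp (ringRes Y h)).toAlgebra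
  (SymmetricAlgebra.lift
    { toFun := fun x => symι F V (secRes F h x)
      map_add' := fun x y => by simp
      map_smul' := fun a x => by
        rw [RingHom.id_apply, Algebra.smul_def, RingHom.algebraMap_toAlgebra, RingHom.comp_apply,
          ← Algebra.smul_def, ← map_smul]
        congr 1
        exact F.map_smul _ _ _ } : symAlg F U →ₐ[Γ(Y, U)] symAlg F V).toRingHom

@[simp] theorem symRes_algebraMap (F : Y.Modules) {U V : Y.Opens} (h : V ≤ U) (a : Γ(Y, U)) :
    symRes F h (algebraMap _ _ a) = algebraMap _ _ (ringRes Y h a) := by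
  let : Algebra Γ(Y, U) (symAlg F V) :=
    ((algebraMap Γ(Y, V) (symAlg F V)).comp (ringRes Y h)).toAlgebra
  exact AlgHom.commutes (SymmetricAlgebra.lift _ : symAlg F U →ₐ[Γ(Y, U)] symAlg F V) a

@[simp] theorem symRes_ι (F : Y.Modules) {U V : Y.Opens} (h : V ≤ U) (x : Γ(F, U)) :
    symRes F h (symι F U x) = symι F V (secRes F h x) := by
  let : Algebra Γ(Y, U) (symAlg F V) :=
    ((algebraMap Γ(Y, V) (symAlg F V)).comp (ringRes Y h)).toAlgebra
  exact SymmetricAlgebra.lift_ι_apply _ _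

theorem symRes_id (F : Y.Modules) (U : Y.Opens) : symRes F (le_refl U) = RingHom.id _ := by
  apply symAlg_ringHom_ext
  · intro a
    simp [ringRes]
  · intro v
    simp [secRes]

theorem symRes_comp (F : Y.Modules) {U V W : Y.Opens} (h : V ≤ U) (h' : W ≤ V) :
    (symRes F h').comp (symRes F h) = symRes F (h'.trans h) := by
  apply symAlg_ringHom_ext
  · intro a
    simp only [RingHom.comp_apply, symRes_algebraMap, ringRes_ringRes]
  · intro v
    simp only [RingHom.comp_apply, symRes_ι, secRes_secRes]

/-- `R(F)` as a presheaf of rings on the affine open sets. -/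
def symFunctor (F : Y.Modules) : Y.AffineZariskiSiteᵒᵖ ⥤ CommRingCat.{u} where
  obj U := .of (symAlg F U.unop.toOpens)
  map i := CommRingCat.ofHom
    (symRes F (Scheme.AffineZariskiSite.toOpens_mono i.unop.le))
  map_id U := by
    rw [symRes_id]; rfl
  map_comp i j := by
    rw [← CommRingCat.ofHom_comp, symRes_comp]

/-- The structure of `O_Y`-algebra of `R(F)`. -/
def symStructure (F : Y.Modules) :
    (Scheme.AffineZariskiSite.toOpensFunctor Y).op ⋙ Y.presheaf ⟶ symFunctor F where
  app U := CommRingCat.ofHom (algebraMap Γ(Y, U.unop.toOpens) (symAlg F U.unop.toOpens))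
  naturality U V i := by
    ext a
    exact (symRes_algebraMap F _ a).symm

/-- Sections of `M` over `W` restrict to `D(f)` as a localization. -/
def Localizes (M : Y.Modules) (W : Y.Opens) : Prop :=
  ∀ (f : Γ(Y, W)) (Z : Y.Opens) (hZ : Z ≤ W), Z = Y.basicOpen f →
    (∀ s : Γ(M, W), secRes M hZ s = 0 → ∃ n : ℕ, f ^ n • s = 0) ∧
    (∀ s : Γ(M, Z), ∃ (n : ℕ) (t : Γ(M, W)), secRes M hZ t = ringRes Y hZ f ^ n • s)

theorem localizes_of_basis (M : Y.Modules) {r : ℕ} {W : Y.Opens} (hW : IsAffineOpen W)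
    (b : Fin r → Γ(M, W))
    (hb : ∀ (V : Y.Opens) (h : V ≤ W),
      Function.Bijective fun c : Fin r → Γ(Y, V) => ∑ i, c i • secRes M h (b i)) :
    Localizes M W := by
  classical
  rintro f Z hZ rfl
  have hloc : IsLocalization.Away f Γ(Y, Y.basicOpen f) := hW.isLocalization_basicOpen f
  have halg : algebraMap Γ(Y, W) Γ(Y, Y.basicOpen f) = ringRes Y hZ := rfl
  constructor
  · intro s hs
    obtain ⟨c, rfl⟩ := (hb W le_rfl).2 s
    have h0 : (fun i => ringRes Y hZ (c i)) = 0 := by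
      apply (hb _ hZ).1
      simp only [Pi.zero_apply, zero_smul, Finset.sum_const_zero]
      rw [← hs]
      simp only [map_sum, secRes, Scheme.Modules.map_smul]
      refine Finset.sum_congr rfl fun i _ => ?_
      congr 1
      exact (secRes_secRes M le_rfl hZ (b i)).symm
    have h1 : ∀ i, ∃ n : ℕ, f ^ n * c i = 0 := by
      intro i
      have := congr_fun h0 i
      simp only [Pi.zero_apply] at this
      rw [← halg, IsLocalization.map_eq_zero_iff (Submonoid.powers f)] at this
      obtain ⟨⟨_, n, rfl⟩, hn⟩ := this
      exact ⟨n, hn⟩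
    choose n hn using h1
    refine ⟨∑ i, n i, ?_⟩
    rw [Finset.smul_sum]
    refine Finset.sum_eq_zero fun i _ => ?_
    rw [← mul_smul, ← Finset.sum_erase_add _ _ (Finset.mem_univ i), pow_add, mul_assoc, hn,
      mul_zero, zero_smul]
  · intro s
    obtain ⟨c, rfl⟩ := (hb _ hZ).2 s
    obtain ⟨⟨_, n, rfl⟩, hn⟩ := IsLocalization.exist_integer_multiples_of_finset
      (Submonoid.powers f) (Finset.univ.image c)
    have h1 : ∀ i, ∃ a : Γ(Y, W), ringRes Y hZ a = ringRes Y hZ f ^ n * c i := by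
      intro i
      obtain ⟨a, ha⟩ := hn (c i) (Finset.mem_image_of_mem _ (Finset.mem_univ i))
      refine ⟨a, ?_⟩
      rw [← halg, ha, Algebra.smul_def, halg, map_pow]
    choose a ha using h1
    refine ⟨n, ∑ i, a i • b i, ?_⟩
    simp only [map_sum, secRes, Scheme.Modules.map_smul]
    rw [Finset.smul_sum]
    refine Finset.sum_congr rfl fun i _ => ?_
    rw [← mul_smul, ← ha]

theorem localizes_of_cover (M : Y.Modules) {ι : Type u} [Finite ι] {W : Y.Opens} (V : ι → Y.Opens)
    (hVW : ∀ i, V i ≤ W) (hW : W ≤ iSup V) (h₁ : ∀ i, Localizes M (V i))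
    (h₂ : ∀ i j, Localizes M (V i ⊓ V j)) : Localizes M W := by
  classical
  rintro f Z hZ rfl
  have := Fintype.ofFinite ι
  have hbo : ∀ U (h : U ≤ W), U ⊓ Y.basicOpen f = Y.basicOpen (ringRes Y h f) := fun U h =>
    (Y.basicOpen_res f (homOfLE h).op).symm
  have inj : ∀ s : Γ(M, W), secRes M hZ s = 0 → ∃ n : ℕ, f ^ n • s = 0 := by
    intro s hs
    have : ∀ i, ∃ n : ℕ, (ringRes Y (hVW i) f) ^ n • secRes M (hVW i) s = 0 := by
      intro i
      refine ((h₁ i) (ringRes Y (hVW i) f) (V i ⊓ Y.basicOpen f) inf_le_left (hbo _ _)).1 _ ?_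
      rw [secRes_secRes, ← secRes_secRes M hZ inf_le_right, hs, secRes, map_zero]
    choose n hn using this
    refine ⟨∑ i, n i, ?_⟩
    apply TopCat.Sheaf.eq_of_locally_eq' ⟨_, M.isSheaf⟩ V W (fun i => homOfLE (hVW i)) hW
    intro i
    change secRes M (hVW i) _ = secRes M (hVW i) 0
    rw [secRes_smul, map_pow, ← Finset.sum_erase_add _ _ (Finset.mem_univ i), pow_add, mul_smul,
      hn, smul_zero, secRes, map_zero]
  refine ⟨inj, fun s => ?_⟩
  have : ∀ i, ∃ (n : ℕ) (t : Γ(M, V i)),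
      secRes M (inf_le_left : V i ⊓ Y.basicOpen f ≤ V i) t =
        ringRes Y (inf_le_left : V i ⊓ Y.basicOpen f ≤ V i) (ringRes Y (hVW i) f) ^ n •
          secRes M (inf_le_right : V i ⊓ Y.basicOpen f ≤ Y.basicOpen f) s :=
    fun i => ((h₁ i) _ _ inf_le_left (hbo _ _)).2 _
  choose n t ht using this
  -- a common exponent
  have : ∀ i, ∃ (t : Γ(M, V i)), secRes M (inf_le_left : V i ⊓ Y.basicOpen f ≤ V i) t =
      ringRes Y ((inf_le_left : V i ⊓ Y.basicOpen f ≤ V i).trans (hVW i)) f ^ (∑ j, n j) •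
        secRes M (inf_le_right : V i ⊓ Y.basicOpen f ≤ Y.basicOpen f) s := by
    intro i
    refine ⟨ringRes Y (hVW i) f ^ (∑ j ∈ Finset.univ.erase i, n j) • t i, ?_⟩
    rw [secRes_smul, ht, ← mul_smul, map_pow, ← pow_add, Finset.sum_erase_add _ _ (Finset.mem_univ i),
      ringRes_ringRes]
  choose t' ht' using this
  have : ∀ p : ι × ι, ∃ m : ℕ, ringRes Y ((inf_le_left : V p.1 ⊓ V p.2 ≤ _).trans (hVW p.1)) f ^ m •
      (secRes M (inf_le_left : V p.1 ⊓ V p.2 ≤ _) (t' p.1) -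
        secRes M (inf_le_right : V p.1 ⊓ V p.2 ≤ _) (t' p.2)) = 0 := by
    rintro ⟨i, j⟩
    refine ((h₂ i j) _ ((V i ⊓ V j) ⊓ Y.basicOpen f) inf_le_left (hbo _ _)).1 _ ?_
    simp only [secRes, map_sub, sub_eq_zero]
    change secRes M _ (secRes M _ _) = secRes M _ (secRes M _ _)
    rw [secRes_secRes, secRes_secRes,
      ← secRes_secRes M (inf_le_left : V i ⊓ Y.basicOpen f ≤ V i)
        (le_inf (inf_le_left.trans inf_le_left) inf_le_right),
      ← secRes_secRes M (inf_le_left : V j ⊓ Y.basicOpen f ≤ V j)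
        (le_inf (inf_le_left.trans inf_le_right) inf_le_right), ht', ht', secRes_smul, secRes_smul,
      secRes_secRes, secRes_secRes, map_pow, map_pow, ringRes_ringRes, ringRes_ringRes]
  choose m hm using this
  obtain ⟨T, hT, -⟩ := TopCat.Sheaf.existsUnique_gluing' ⟨_, M.isSheaf⟩ V W
    (fun i => homOfLE (hVW i)) hW (fun i => ringRes Y (hVW i) f ^ (∑ p, m p) • t' i) (by
      intro i j
      change secRes M inf_le_left _ = secRes M inf_le_right _
      rw [← sub_eq_zero, secRes_smul, secRes_smul, map_pow, map_pow, ringRes_ringRes,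
        ringRes_ringRes, ← smul_sub, ← Finset.sum_erase_add _ _ (Finset.mem_univ (i, j)), pow_add,
        mul_smul, hm (i, j), smul_zero])
  refine ⟨∑ p, m p + ∑ j, n j, T, ?_⟩
  apply TopCat.Sheaf.eq_of_locally_eq' ⟨_, M.isSheaf⟩ (fun i => V i ⊓ Y.basicOpen f) _
    (fun i => homOfLE inf_le_right)
  · rw [← iSup_inf_eq]
    exact le_inf (hZ.trans hW) le_rfl
  · intro i
    change secRes M inf_le_right _ = secRes M inf_le_right _
    have hTi : secRes M (hVW i) T = ringRes Y (hVW i) f ^ (∑ p, m p) • t' i := hT i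
    rw [secRes_secRes, secRes_smul, map_pow, ringRes_ringRes,
      ← secRes_secRes M (hVW i) (inf_le_left : V i ⊓ Y.basicOpen f ≤ V i), hTi, secRes_smul, ht',
      map_pow, ringRes_ringRes, ← mul_smul, ← pow_add]

theorem IsLocallyFreeOfRank.localizes {M : Y.Modules} {r : ℕ} (hM : IsLocallyFreeOfRank M r)
    {W : Y.Opens} (hW : IsAffineOpen W) : Localizes M W := by
  have h : ∀ w : W, ∃ g : Γ(Y, W), w.1 ∈ Y.basicOpen g ∧
      ∃ b : Fin r → Γ(M, Y.basicOpen g), ∀ (V : Y.Opens) (h : V ≤ Y.basicOpen g),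
        Function.Bijective fun c : Fin r → Γ(Y, V) => ∑ i, c i • secRes M h (b i) := by
    intro w
    obtain ⟨U, hwU, b, hb⟩ := hM w.1
    obtain ⟨g, hg, hwg⟩ := hW.exists_basicOpen_le ⟨w.1, hwU⟩ w.2
    refine ⟨g, hwg, fun i => secRes M hg (b i), fun V hV => ?_⟩
    have := hb V (hV.trans hg)
    simpa only [secRes_secRes] using this
  choose g hwg b hb using h
  obtain ⟨s, hs⟩ := hW.isCompact.elim_finite_subcover (fun w : W => (Y.basicOpen (g w) : Set Y))
    (fun w => (Y.basicOpen (g w)).2) (fun w hw => Set.mem_iUnion.2 ⟨⟨w, hw⟩, hwg ⟨w, hw⟩⟩)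
  refine localizes_of_cover M (ι := s) (fun i => Y.basicOpen (g i.1)) (fun i => Y.basicOpen_le _)
    (fun w hw => ?_) (fun i => localizes_of_basis M (hW.basicOpen _) (b i) (hb i)) (fun i j => ?_)
  · obtain ⟨i, hi, hwi⟩ := Set.mem_iUnion₂.1 (hs hw)
    exact Opens.mem_iSup.2 ⟨⟨i, hi⟩, hwi⟩
  · have hij : IsAffineOpen (Y.basicOpen (g i.1) ⊓ Y.basicOpen (g j.1)) := by
      rw [← Y.basicOpen_mul]
      exact hW.basicOpen _
    refine localizes_of_basis M hij (fun l => secRes M inf_le_left (b i.1 l)) fun V hV => ?_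
    have := hb i.1 V (hV.trans inf_le_left)
    simpa only [secRes_secRes] using this

theorem sym_desc {R Rf M N T : Type*} [CommRing R] [CommRing Rf] [Algebra R Rf] (f : R)
    [IsLocalization.Away f Rf] [AddCommGroup M] [Module R M] [AddCommGroup N] [Module R N]
    [Module Rf N] [IsScalarTower R Rf N] (g : M →ₗ[R] N) [IsLocalizedModule.Away f g]
    [CommRing T] (a : Rf →+* T) (b : SymmetricAlgebra R M →+* T)
    (hab : ∀ r : R, b (algebraMap R _ r) = a (algebraMap R Rf r)) :
    ∃ c : SymmetricAlgebra Rf N →+* T, (∀ x : Rf, c (algebraMap Rf _ x) = a x) ∧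
      ∀ m, c (SymmetricAlgebra.ι Rf N (g m)) = b (SymmetricAlgebra.ι R M m) := by
  let _ : Algebra Rf T := a.toAlgebra
  let _ : Algebra R T := (a.comp (algebraMap R Rf)).toAlgebra
  have : IsScalarTower R Rf T := IsScalarTower.of_algebraMap_eq' rfl
  let L₀ : M →ₗ[R] T :=
    { toFun := fun m => b (SymmetricAlgebra.ι R M m)
      map_add' := fun x y => by simp
      map_smul' := fun r x => by
        rw [RingHom.id_apply, map_smul, Algebra.smul_def, map_mul, hab, Algebra.smul_def]
        rfl }
  have hu : ∀ x : Submonoid.powers f, IsUnit (algebraMap R (Module.End R T) x) := by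
    intro x
    have h1 : IsUnit (algebraMap R T x) := by
      rw [IsScalarTower.algebraMap_apply R Rf T]
      exact (IsLocalization.map_units Rf x).map _
    have h2 : algebraMap R (Module.End R T) x = Algebra.lmul R T (algebraMap R T x) := by
      ext y
      simp [Algebra.smul_def]
    rw [h2]
    exact h1.map _
  let L : N →ₗ[R] T := IsLocalizedModule.lift (Submonoid.powers f) g L₀ hu
  let L' : N →ₗ[Rf] T := L.extendScalarsOfIsLocalization (Submonoid.powers f) Rf
  refine ⟨(SymmetricAlgebra.lift L').toRingHom, fun x => (SymmetricAlgebra.lift L').commutes x,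
    fun m => ?_⟩
  exact (SymmetricAlgebra.lift_ι_apply L' (g m)).trans
    (IsLocalizedModule.lift_apply (Submonoid.powers f) g L₀ hu m)

theorem IsLocallyFreeOfRank.isPushout {F : Y.Modules} {r : ℕ} (hF : IsLocallyFreeOfRank F r)
    (U : Y.AffineZariskiSite) (f : Γ(Y, U.toOpens)) :
    IsPushout (Y.presheaf.map (homOfLE (Y.basicOpen_le f)).op)
      (CommRingCat.ofHom (algebraMap Γ(Y, U.toOpens) (symAlg F U.toOpens)))
      (CommRingCat.ofHom (algebraMap Γ(Y, Y.basicOpen f) (symAlg F (Y.basicOpen f))))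
      (CommRingCat.ofHom (symRes F (Y.basicOpen_le f))) := by
  have hU : IsAffineOpen U.toOpens := U.2
  have hle : Y.basicOpen f ≤ U.toOpens := Y.basicOpen_le f
  have hloc : IsLocalization.Away f Γ(Y, Y.basicOpen f) := hU.isLocalization_basicOpen f
  let _ : Module Γ(Y, U.toOpens) Γ(F, Y.basicOpen f) := Module.compHom _ (ringRes Y hle)
  have : IsScalarTower Γ(Y, U.toOpens) Γ(Y, Y.basicOpen f) Γ(F, Y.basicOpen f) :=
    ⟨fun a b x => by
      rw [Algebra.smul_def, mul_smul]; rfl⟩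
  let g : Γ(F, U.toOpens) →ₗ[Γ(Y, U.toOpens)] Γ(F, Y.basicOpen f) :=
    { toFun := secRes F hle
      map_add' := fun x y => by simp
      map_smul' := fun a x => secRes_smul F hle a x }
  have hunit : IsUnit (ringRes Y hle f) := IsLocalization.Away.algebraMap_isUnit f
  have hg : IsLocalizedModule.Away f g := by
    refine IsLocalizedModule.Away.mk_of_addCommGroup ?_ ?_ ?_
    · have h2 : IsUnit (algebraMap Γ(Y, Y.basicOpen f)
          (Module.End Γ(Y, Y.basicOpen f) Γ(F, Y.basicOpen f)) (ringRes Y hle f)) := hunit.map _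
      rw [Module.End.isUnit_iff] at h2 ⊢
      exact h2
    · intro x
      obtain ⟨n, t, ht⟩ := ((hF.localizes hU) f _ hle rfl).2 x
      refine ⟨n, t, ?_⟩
      rw [← map_pow] at ht
      exact ht.symm
    · exact ((hF.localizes hU) f _ hle rfl).1
  have key : ∀ {S : CommRingCat.{u}} (c c' : CommRingCat.of (symAlg F (Y.basicOpen f)) ⟶ S),
      CommRingCat.ofHom (algebraMap Γ(Y, Y.basicOpen f) (symAlg F (Y.basicOpen f))) ≫ c =
        CommRingCat.ofHom (algebraMap Γ(Y, Y.basicOpen f) (symAlg F (Y.basicOpen f))) ≫ c' →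
      CommRingCat.ofHom (symRes F hle) ≫ c = CommRingCat.ofHom (symRes F hle) ≫ c' → c = c' := by
    intro S c c' h1 h2
    have e1 : ∀ x, c.hom (algebraMap _ _ x) = c'.hom (algebraMap _ _ x) := fun x =>
      congr($h1 x)
    apply CommRingCat.hom_ext
    refine symAlg_ringHom_ext e1 fun v => ?_
    obtain ⟨n, t, ht⟩ := ((hF.localizes hU) f _ hle rfl).2 v
    have e2 : c.hom (symι F _ (secRes F hle t)) = c'.hom (symι F _ (secRes F hle t)) := by
      have := congr($h2 (symι F _ t))
      simpa using this
    rw [ht, map_smul, Algebra.smul_def, map_mul, map_mul, e1] at e2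
    exact (((hunit.pow n).map (algebraMap _ (symAlg F (Y.basicOpen f)))).map c'.hom).mul_left_cancel
      e2
  have ex : ∀ s : Limits.PushoutCocone (Y.presheaf.map (homOfLE (Y.basicOpen_le f)).op)
      (CommRingCat.ofHom (algebraMap Γ(Y, U.toOpens) (symAlg F U.toOpens))),
      ∃ c : CommRingCat.of (symAlg F (Y.basicOpen f)) ⟶ s.pt,
        CommRingCat.ofHom (algebraMap Γ(Y, Y.basicOpen f) (symAlg F (Y.basicOpen f))) ≫ c =
          s.inl ∧ CommRingCat.ofHom (symRes F hle) ≫ c = s.inr := by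
    intro s
    have hc := s.condition
    obtain ⟨c, h1, h2⟩ := sym_desc (Rf := Γ(Y, Y.basicOpen f)) f g s.inl.hom s.inr.hom
      (fun r => (congr($hc r)).symm)
    refine ⟨CommRingCat.ofHom c, ?_, ?_⟩
    · ext x
      exact h1 x
    · apply CommRingCat.hom_ext
      refine symAlg_ringHom_ext (fun r => ?_) (fun v => ?_)
      · have : c (symRes F hle (algebraMap _ _ r)) = s.inr.hom (algebraMap _ _ r) := by
          rw [symRes_algebraMap, h1]
          exact congr($hc r)
        exact this
      · have : c (symRes F hle (symι F _ v)) = s.inr.hom (symι F _ v) := by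
          rw [symRes_ι]
          exact h2 v
        exact this
  choose desc hl hr using ex
  exact ⟨⟨by ext a; exact (symRes_algebraMap F hle a).symm⟩,
    ⟨Limits.PushoutCocone.IsColimit.mk _ desc hl hr fun s m h1 h2 =>
      key _ _ (h1.trans (hl s).symm) (h2.trans (hr s).symm)⟩⟩

theorem IsLocallyFreeOfRank.coequifibered {F : Y.Modules} {r : ℕ} (hF : IsLocallyFreeOfRank F r) :
    (symStructure F).Coequifibered := by
  rintro ⟨V⟩ ⟨U⟩ ⟨f, hf⟩
  obtain rfl : V.basicOpen f = U := Subtype.ext hf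
  exact hF.isPushout V f

/-- The schemes `Spec R(F)(U)`, `U` affine, with their gluing data over `Y`. -/
def symGluingData {F : Y.Modules} {r : ℕ} (hF : IsLocallyFreeOfRank F r) :
    (Scheme.AffineZariskiSite.directedCover Y).RelativeGluingData :=
  Scheme.AffineZariskiSite.relativeGluingData hF.coequifibered

instance {F : Y.Modules} {r : ℕ} (hF : IsLocallyFreeOfRank F r) :
    ((symGluingData hF).functor ⋙ Scheme.forget).IsLocallyDirected :=
  Scheme.Cover.RelativeGluingData.instIsLocallyDirectedI₀CompFunctorForgetOfIsThin ..

/-- The relative affine space `Spec_Y (⨁ Symⁿ F)` of a locally free sheaf `F`. -/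
def relAffineSpace (F : Y.Modules) {r : ℕ} (hF : IsLocallyFreeOfRank F r) : Scheme.{u} :=
  (symGluingData hF).glued

/-- The projection of the relative affine space to `Y`. -/
def relAffineSpace.proj (F : Y.Modules) {r : ℕ} (hF : IsLocallyFreeOfRank F r) :
    relAffineSpace F hF ⟶ Y :=
  (symGluingData hF).toBase

/-- The open subscheme `Spec R(F)(U)` of the relative affine space, for `U` affine. -/
def relAffineSpace.chart (F : Y.Modules) {r : ℕ} (hF : IsLocallyFreeOfRank F r)
    (U : Y.affineOpens) : Spec (.of (symAlg F U.1)) ⟶ relAffineSpace F hF :=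
  (symGluingData hF).cover.f U

theorem relAffineSpace.chart_proj (F : Y.Modules) {r : ℕ} (hF : IsLocallyFreeOfRank F r)
    (U : Y.affineOpens) :
    relAffineSpace.chart F hF U ≫ relAffineSpace.proj F hF =
      Spec.map (CommRingCat.ofHom (algebraMap Γ(Y, U.1) (symAlg F U.1))) ≫ U.2.fromSpec :=
  Limits.colimit.ι_desc _ _

/-! ### The grading of `R(F) = ⨁ Symⁿ F` and homogenization -/

/-- The summand `Symⁿ F(U)` of `R(F)(U)`. -/
def symDeg (F : Y.Modules) (U : Y.Opens) (n : ℕ) : Submodule Γ(Y, U) (symAlg F U) :=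
  LinearMap.range (symι F U) ^ n

/-- The sum of the summands `Symʲ F(U)`, `j < n`. -/
def symLT (F : Y.Modules) (U : Y.Opens) (n : ℕ) : Submodule Γ(Y, U) (symAlg F U) :=
  ⨆ j : Fin n, symDeg F U j

/-- The algebra map `R(F) → R(F)[t]`, `∑ fⱼ ↦ ∑ fⱼ tʲ` for `fⱼ ∈ Symʲ F`. -/
def dilate (F : Y.Modules) (U : Y.Opens) :
    symAlg F U →ₐ[Γ(Y, U)] Polynomial (symAlg F U) :=
  SymmetricAlgebra.lift
    (((Polynomial.monomial 1).restrictScalars Γ(Y, U) :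
      symAlg F U →ₗ[Γ(Y, U)] Polynomial (symAlg F U)) ∘ₗ symι F U)

/-- The homogenization `∑ fⱼ tⁿ⁻ʲ ∈ R(F)[t]` of a polynomial `f = ∑ fⱼ`, `fⱼ ∈ Symʲ F`, of degree
at most `n`. -/
def homogenize (F : Y.Modules) (U : Y.Opens) (n : ℕ) (f : symAlg F U) :
    Polynomial (symAlg F U) :=
  Polynomial.reflect n (dilate F U f)

/-! ### Cover data and cover homomorphisms -/

/-- The ideal `⟨Q⟩` of `R(F)(U)` generated by a submodule. -/
abbrev idealOf {F : Y.Modules} {U : Y.Opens} (Q : Submodule Γ(Y, U) (symAlg F U)) :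
    Ideal (symAlg F U) :=
  Ideal.span (Q : Set (symAlg F U))

/-- A locally free sheaf `F` of finite rank, a graded direct summand `Q` of `R(F)` of finite type
that meets `O ⊕ F` trivially and for which `R(F)/⟨Q⟩` is a finite `O`-module, and a graded
`O`-linear section `σ` of `R(F) → R(F)/⟨Q⟩`, which exhibits `R(F)/⟨Q⟩` as a direct summand of
`R(F)`. As all sheaves involved are quasi-coherent, they and the maps between them are given by
their sections on affine open sets; `R(F)(U) = Sym_{O(U)} F(U)` for `U` affine. -/
structure CoverDatum (Y : Scheme.{u}) where
  F : Y.Modules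
  rank : ℕ
  locallyFree : IsLocallyFreeOfRank F rank
  Q : ∀ U : Y.affineOpens, Submodule Γ(Y, U.1) (symAlg F U.1)
  Q_res : ∀ {U V : Y.affineOpens} (h : V.1 ≤ U.1) (q : symAlg F U.1),
    q ∈ Q U → symRes F h q ∈ Q V
  Q_summand : ∃ e : ∀ U : Y.affineOpens, symAlg F U.1 →ₗ[Γ(Y, U.1)] symAlg F U.1,
    (∀ U x, e U x ∈ Q U) ∧ (∀ U, ∀ x ∈ Q U, e U x = x) ∧
      ∀ (U V : Y.affineOpens) (h : V.1 ≤ U.1) x, e V (symRes F h x) = symRes F h (e U x)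
  Q_graded : ∀ U, Q U = ⨆ n : ℕ, Q U ⊓ symDeg F U.1 n
  Q_finite : ∀ U, Module.Finite Γ(Y, U.1) (Q U)
  Q_inf : ∀ U, Q U ⊓ (symDeg F U.1 0 ⊔ symDeg F U.1 1) = ⊥
  quot_finite : ∀ U, Module.Finite Γ(Y, U.1) (symAlg F U.1 ⧸ idealOf (Q U))
  σ : ∀ U : Y.affineOpens, (symAlg F U.1 ⧸ idealOf (Q U)) →ₗ[Γ(Y, U.1)] symAlg F U.1
  σ_section : ∀ U c, Ideal.Quotient.mk (idealOf (Q U)) (σ U c) = c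
  σ_deg : ∀ (U : Y.affineOpens) (n : ℕ), ∀ x ∈ symDeg F U.1 n, σ U (Ideal.Quotient.mk _ x) ∈ symDeg F U.1 n
  σ_res : ∀ {U V : Y.affineOpens} (h : V.1 ≤ U.1) (x : symAlg F U.1),
    σ V (Ideal.Quotient.mk _ (symRes F h x)) = symRes F h (σ U (Ideal.Quotient.mk _ x))

namespace CoverDatum

variable (D : CoverDatum Y)

/-- The sections of `R(F)/⟨Q⟩` over an affine open set. -/
abbrev quotient (U : Y.affineOpens) : Type u := symAlg D.F U.1 ⧸ idealOf (D.Q U)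

/-- The projection `R(F) → R(F)/⟨Q⟩`. -/
abbrev proj (U : Y.affineOpens) : symAlg D.F U.1 →+* D.quotient U := Ideal.Quotient.mk _

/-- Restriction of sections of `Q`. -/
def resQ {U V : Y.affineOpens} (h : V.1 ≤ U.1) (q : D.Q U) : D.Q V :=
  ⟨symRes D.F h q, D.Q_res h q q.2⟩

/-- Restriction of sections of `R(F)/⟨Q⟩`. -/
def resQuot {U V : Y.affineOpens} (h : V.1 ≤ U.1) : D.quotient U →+* D.quotient V :=
  Ideal.quotientMap _ (symRes D.F h) (Ideal.span_le.2 fun q hq =>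
    Ideal.subset_span (D.Q_res h q hq))

/-- `Hom(Q, R(F)/⟨Q⟩)`. -/
@[ext]
structure QHom where
  app : ∀ U : Y.affineOpens, D.Q U →ₗ[Γ(Y, U.1)] D.quotient U
  res : ∀ (U V : Y.affineOpens) (h : V.1 ≤ U.1) (q : D.Q U),
    app V (D.resQ h q) = D.resQuot h (app U q)

/-- `Hom(Q, F)`. -/
@[ext]
structure QLinHom where
  app : ∀ U : Y.affineOpens, D.Q U →ₗ[Γ(Y, U.1)] Γ(D.F, U.1)
  res : ∀ (U V : Y.affineOpens) (h : V.1 ≤ U.1) (q : D.Q U),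
    app V (D.resQ h q) = secRes D.F h (app U q)

variable {D}

/-- The polynomial `q - Φ(q)`, where `Φ(q)` is written as a polynomial by means of `σ`. -/
def QHom.deform (Φ : D.QHom) (U : Y.affineOpens) (q : D.Q U) : symAlg D.F U.1 :=
  q - D.σ U (Φ.app U q)

/-- The ideal of `R(F)(U)` generated by the polynomials `q - Φ(q)`. -/
def QHom.ideal (Φ : D.QHom) (U : Y.affineOpens) : Ideal (symAlg D.F U.1) :=
  Ideal.span (Set.range (Φ.deform U))

/-- The ideal of `R(F)(U)[t]` generated by the homogenizations of the polynomials `q - Φ(q)`,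
for `q ∈ Q(U)` homogeneous. -/
def QHom.homogIdeal (Φ : D.QHom) (U : Y.affineOpens) : Ideal (Polynomial (symAlg D.F U.1)) :=
  Ideal.span {g | ∃ (n : ℕ) (q : D.Q U), (q : symAlg D.F U.1) ∈ symDeg D.F U.1 n ∧
    g = homogenize D.F U.1 n (Φ.deform U q)}

/-- `Φ` is a cover homomorphism: it lowers degrees, i.e. `q - Φ(q)` has leading form `q` for every
homogeneous `q`, and over every affine open set the ideal of the polynomials `q - Φ(q)` is an
extension of `⟨Q⟩`: with `I` the homogenized ideal, the homogenizing variable `t` is not a zero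
divisor on `R(F)[t]/I`, whose reduction modulo `t` is `R(F)/⟨Q⟩`. -/
structure QHom.IsCoverHom (Φ : D.QHom) : Prop where
  lowers : ∀ (U : Y.affineOpens) (n : ℕ) (q : D.Q U), (q : symAlg D.F U.1) ∈ symDeg D.F U.1 n →
    ∃ x ∈ symLT D.F U.1 n, Φ.app U q = D.proj U x
  extension : ∀ (U : Y.affineOpens) (g : Polynomial (symAlg D.F U.1)),
    Polynomial.X * g ∈ Φ.homogIdeal U → g ∈ Φ.homogIdeal U

/-- `ψ` is the component in `Hom(Q, F)` of `Φ`, for `Φ` with values in `O ⊕ F`. -/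
def QHom.HasLinearPart (Φ : D.QHom) (ψ : D.QLinHom) : Prop :=
  ∀ (U : Y.affineOpens) (q : D.Q U), ∃ a : Γ(Y, U.1),
    Φ.app U q = D.proj U (algebraMap _ _ a + symι D.F U.1 (ψ.app U q))

variable (D)

/-- `Q` consists of quadratic polynomials. -/
def IsQuadratic : Prop := ∀ U, D.Q U ≤ symDeg D.F U.1 2

/-- Locally on `Y`, for a basis `q₁, …, qₘ` of `Q`, the syzygies of `(q₁, …, qₘ)` are generated by
syzygies with entries linear forms. -/
def HasLinearSyzygies : Prop :=
  ∀ y : Y, ∃ U : Y.affineOpens, y ∈ U.1 ∧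
    ∃ (m : ℕ) (q : Module.Basis (Fin m) Γ(Y, U.1) (D.Q U)),
      ∀ l : Fin m → symAlg D.F U.1, ∑ i, l i * (q i : symAlg D.F U.1) = 0 →
        l ∈ Submodule.span (symAlg D.F U.1) {l : Fin m → symAlg D.F U.1 |
          (∀ i, l i ∈ symDeg D.F U.1 1) ∧ ∑ i, l i * (q i : symAlg D.F U.1) = 0}

/-- Isomorphisms of `O`-modules from `R(F)/⟨Q⟩` to `M`. -/
structure ModIso (M : Y.Modules) where
  app : ∀ U : Y.affineOpens, D.quotient U ≃ₗ[Γ(Y, U.1)] Γ(M, U.1)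
  res : ∀ (U V : Y.affineOpens) (h : V.1 ≤ U.1) (c : D.quotient U),
    app V (D.resQuot h c) = secRes M h (app U c)

end CoverDatum

/-! ### Algebra structures -/

/-- A structure of commutative, associative `O`-algebra with unit on a sheaf of `O`-modules, given
on the affine open sets, which form a basis of the topology. -/
@[ext]
structure AlgStr (M : Y.Modules) where
  mul : ∀ U : Y.affineOpens, Γ(M, U.1) →ₗ[Γ(Y, U.1)] Γ(M, U.1) →ₗ[Γ(Y, U.1)] Γ(M, U.1)
  one : ∀ U : Y.affineOpens, Γ(M, U.1)
  mul_comm : ∀ U x y, mul U x y = mul U y x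
  mul_assoc : ∀ U x y z, mul U (mul U x y) z = mul U x (mul U y z)
  one_mul : ∀ U x, mul U (one U) x = x
  res_mul : ∀ (U V : Y.affineOpens) (h : V.1 ≤ U.1) (x y : Γ(M, U.1)),
    secRes M h (mul U x y) = mul V (secRes M h x) (secRes M h y)
  res_one : ∀ (U V : Y.affineOpens) (h : V.1 ≤ U.1), secRes M h (one U) = one V

/-- The `O_Y`-module `φ_* O_X`. -/
abbrev pushO {X : Scheme.{u}} (φ : X ⟶ Y) : Y.Modules :=
  (Scheme.Modules.pushforward φ).obj (SheafOfModules.unit X.ringCatSheaf)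

/-- The multiplication of `O_X`, as an algebra structure on `φ_* O_X`. -/
def AlgStr.canonical {X : Scheme.{u}} (φ : X ⟶ Y) : AlgStr (pushO φ) where
  mul U := LinearMap.mk₂ Γ(Y, U.1)
    (fun x y => HMul.hMul (α := Γ(X, φ ⁻¹ᵁ U.1)) (β := Γ(X, φ ⁻¹ᵁ U.1)) x y)
    (fun x y z => _root_.add_mul (R := Γ(X, φ ⁻¹ᵁ U.1)) x y z)
    (fun a x y => _root_.mul_assoc (G := Γ(X, φ ⁻¹ᵁ U.1)) (φ.app U.1 a) x y)
    (fun x y z => _root_.mul_add (R := Γ(X, φ ⁻¹ᵁ U.1)) x y z)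
    (fun a x y => _root_.mul_left_comm (G := Γ(X, φ ⁻¹ᵁ U.1)) x (φ.app U.1 a) y)
  one U := (1 : Γ(X, φ ⁻¹ᵁ U.1))
  mul_comm U x y := _root_.mul_comm (G := Γ(X, φ ⁻¹ᵁ U.1)) x y
  mul_assoc U x y z := _root_.mul_assoc (G := Γ(X, φ ⁻¹ᵁ U.1)) x y z
  one_mul U x := _root_.one_mul (M := Γ(X, φ ⁻¹ᵁ U.1)) x
  res_mul _ _ h x y :=
    RingHom.map_mul (X.presheaf.map (homOfLE (φ.preimage_mono h)).op).hom x y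
  res_one _ _ h :=
    RingHom.map_one (X.presheaf.map (homOfLE (φ.preimage_mono h)).op).hom

/-- The algebra structure `m` on `M` is the one that the cover homomorphism `Φ` determines by means
of the isomorphism of modules `θ : R(F)/⟨Q⟩ ≃ M`: there is a surjection of algebras `π` from `R(F)`
to `(M, m)` whose kernel is the ideal generated by the polynomials `q - Φ(q)` and such that
`π ∘ σ = θ`. -/
def Presents {M : Y.Modules} (D : CoverDatum Y) (θ : D.ModIso M) (Φ : D.QHom) (m : AlgStr M) :
    Prop :=
  ∀ U : Y.affineOpens, ∃ π : symAlg D.F U.1 →ₗ[Γ(Y, U.1)] Γ(M, U.1),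
    π 1 = m.one U ∧ (∀ x y, π (x * y) = m.mul U (π x) (π y)) ∧
      (∀ x, π x = 0 ↔ x ∈ Φ.ideal U) ∧ ∀ c, π (D.σ U c) = θ.app U c

/-- The image of `F` under `θ` consists of elements of trace zero for the multiplication `m`. -/
def IsTraceFree {M : Y.Modules} (D : CoverDatum Y) (θ : D.ModIso M) (m : AlgStr M) : Prop :=
  ∀ U : Y.affineOpens, Module.Free Γ(Y, U.1) Γ(M, U.1) → ∀ v : Γ(D.F, U.1),
    LinearMap.trace Γ(Y, U.1) Γ(M, U.1) (m.mul U (θ.app U (D.proj U (symι D.F U.1 v)))) = 0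

/-! ### Covering maps and embeddings -/

/-- Covering maps of degree `d`. -/
structure IsCoveringMap {X : Scheme.{u}} (φ : X ⟶ Y) (d : ℕ) : Prop where
  finite : IsFinite φ
  flat : Flat φ
  locallyFree : IsLocallyFreeOfRank (pushO φ) d

/-- Over the affine open set `U`, the morphism `i` from `X` to the relative affine space is given by
the ring homomorphism `π : R(F)(U) → (φ_* O_X)(U)`. -/
def IsComorphism {X : Scheme.{u}} (D : CoverDatum Y) (φ : X ⟶ Y)
    (i : X ⟶ relAffineSpace D.F D.locallyFree) (U : Y.affineOpens)
    (π : symAlg D.F U.1 →+* Γ(X, φ ⁻¹ᵁ U.1)) : Prop :=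
  (φ ⁻¹ᵁ U.1).ι ≫ i = (φ ⁻¹ᵁ U.1).toSpecΓ ≫ Spec.map (CommRingCat.ofHom π) ≫
    relAffineSpace.chart D.F D.locallyFree U

/-- `i` is a closed embedding over `Y` of `X` into the relative affine space, whose image is defined
by the ideal generated by the polynomials `q - Φ(q)`. -/
structure IsEmbeddingOf {X : Scheme.{u}} (D : CoverDatum Y) (Φ : D.QHom) (φ : X ⟶ Y)
    (i : X ⟶ relAffineSpace D.F D.locallyFree) : Prop where
  closed : IsClosedImmersion i
  fac : i ≫ relAffineSpace.proj D.F D.locallyFree = φ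
  comorphism : ∀ U : Y.affineOpens, ∃ π : symAlg D.F U.1 →+* Γ(X, φ ⁻¹ᵁ U.1),
    IsComorphism D φ i U π ∧ RingHom.ker π = Φ.ideal U

end
end AlgCover

namespace AlgCover

variable {Y : Scheme.{u}}

/-! ### Homogeneous components -/

section Components

variable {F : Y.Modules} {U : Y.Opens}

/-! Over an affine open set write R for R(F) and I for the ideal generated by the polynomials q −
σ(Φ(q)). The first assertion rests on the decomposition R = σ(R/⟨Q⟩) ⊕ I. That the two summands span
R is division with remainder: since Φ lowers degrees, the leading form of an element of ⟨Q⟩ is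
congruent modulo I to a polynomial of lower degree (`Lowers.exists_sub_σ_mem`). That they meet in 0
is where the extension condition enters: since t is a nonzerodivisor modulo the homogenized ideal,
whose reduction at t = 0 lies in ⟨Q⟩, leading forms of elements of I lie in ⟨Q⟩
(`IsCoverHom.leading_form_mem`), whereas the leading form of a nonzero σ(c) does not. The remainder
`IsCoverHom.rem` thus identifies R/I with R/⟨Q⟩ as a module, and the product of R/I is carried over
by θ. Any presentation π equals θ ∘ rem, so the algebra structure is unique. Conversely, since σ is
the identity in degrees 0 and 1, θ fixes π on F, hence on R, and Φ(q) = θ⁻¹(π(q)).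

For the existence of a presentation, d is invertible, so the trace splits M = O·1 ⊕ F with F the
sections of trace zero, locally free of rank d − 1. With Q = Sym² F the module R/⟨Q⟩ is O ⊕ F, and Φ
records the products of sections of F. The extension condition is checked in a Rees algebra: R[t] →
A[t], v ↦ vt for v in F, where A is the algebra of sections of M, kills the homogenized ideal J.
Modulo J every polynomial has a representative with coefficients in O ⊕ F, on which the map is
injective. As t is regular in A[t], it is a nonzerodivisor modulo J (`AlgStr.mem_of_X_mul_mem`).

The embedding is glued from the presentations π over affine open sets. It is closed because each π
is surjective, and two closed embeddings with the same ideal differ by an isomorphism of their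
sources.

For quadratic Q with linear syzygies, let ψ be the linear part and aᵢ the constant part of Φ(qᵢ). A
syzygy Σ lᵢqᵢ = 0 with linear lᵢ forces z = Σ lᵢψ(qᵢ) into Q and Σ lᵢaᵢ = −ψ(z)
(`QHom.HasLinearPart.sum_constPart`). So, for two Φ with the same ψ, the differences of the
constants are annihilated by all linear syzygies, hence by all syzygies. The Koszul syzygy of qᵢ and
qⱼ then makes the differences vanish. A basis with a single quadric is excluded: R/⟨q⟩ is not finite
when F has rank at least 2. -/

theorem dilate_ι (v : Γ(F, U)) :
    dilate F U (symι F U v) = Polynomial.monomial 1 (symι F U v) :=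
  SymmetricAlgebra.lift_ι_apply _ v

theorem dilate_algebraMap (a : Γ(Y, U)) :
    dilate F U (algebraMap _ _ a) = Polynomial.C (algebraMap _ _ a) :=
  (dilate F U).commutes a

theorem symDeg_zero : symDeg F U 0 = 1 := pow_zero _

theorem symDeg_one : symDeg F U 1 = LinearMap.range (symι F U) := pow_one _

theorem algebraMap_mem_symDeg_zero (a : Γ(Y, U)) : algebraMap _ (symAlg F U) a ∈ symDeg F U 0 := by
  rw [symDeg_zero]
  exact Submodule.algebraMap_mem a

theorem ι_mem_symDeg_one (v : Γ(F, U)) : symι F U v ∈ symDeg F U 1 := by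
  rw [symDeg_one]
  exact LinearMap.mem_range_self _ v

theorem mem_symDeg_zero {x : symAlg F U} :
    x ∈ symDeg F U 0 ↔ ∃ a : Γ(Y, U), algebraMap _ _ a = x := by
  rw [symDeg_zero, Submodule.mem_one]

theorem mem_symDeg_one {x : symAlg F U} : x ∈ symDeg F U 1 ↔ ∃ v : Γ(F, U), symι F U v = x := by
  rw [symDeg_one]
  rfl

theorem mul_mem_symDeg {m n : ℕ} {x y : symAlg F U} (hx : x ∈ symDeg F U m)
    (hy : y ∈ symDeg F U n) : x * y ∈ symDeg F U (m + n) := by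
  rw [symDeg, pow_add]
  exact Submodule.mul_mem_mul hx hy

theorem dilate_of_mem {n : ℕ} {x : symAlg F U} (hx : x ∈ symDeg F U n) :
    dilate F U x = Polynomial.monomial n x := by
  induction n generalizing x with
  | zero =>
    obtain ⟨a, rfl⟩ := mem_symDeg_zero.1 hx
    rw [dilate_algebraMap, Polynomial.monomial_zero_left]
  | succ n ih =>
    rw [symDeg, pow_succ] at hx
    refine Submodule.mul_induction_on hx (fun y hy z hz => ?_) (fun y z hy hz => ?_)
    · obtain ⟨v, rfl⟩ := hz
      rw [map_mul, ih hy, dilate_ι, Polynomial.monomial_mul_monomial]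
    · rw [map_add, hy, hz, map_add]

variable (F U) in
/-- The homogeneous component of degree `n` of a polynomial. -/
noncomputable def symComp (n : ℕ) : symAlg F U →ₗ[Γ(Y, U)] symAlg F U :=
  ((Polynomial.lcoeff (symAlg F U) n).restrictScalars Γ(Y, U)) ∘ₗ (dilate F U).toLinearMap

theorem coeff_dilate (n : ℕ) (x : symAlg F U) : (dilate F U x).coeff n = symComp F U n x := rfl

theorem symComp_of_mem {n : ℕ} {x : symAlg F U} (hx : x ∈ symDeg F U n) (m : ℕ) :
    symComp F U m x = if n = m then x else 0 := by
  rw [← coeff_dilate, dilate_of_mem hx, Polynomial.coeff_monomial]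

theorem symComp_self {n : ℕ} {x : symAlg F U} (hx : x ∈ symDeg F U n) : symComp F U n x = x := by
  rw [symComp_of_mem hx, if_pos rfl]

theorem symComp_of_ne {n m : ℕ} {x : symAlg F U} (hx : x ∈ symDeg F U n) (h : n ≠ m) :
    symComp F U m x = 0 := by
  rw [symComp_of_mem hx, if_neg h]

theorem symComp_mul (n : ℕ) (x y : symAlg F U) : symComp F U n (x * y) =
    ∑ p ∈ Finset.HasAntidiagonal.antidiagonal n, symComp F U p.1 x * symComp F U p.2 y := by
  simp only [← coeff_dilate, map_mul, Polynomial.coeff_mul]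

theorem symComp_mem (n : ℕ) (x : symAlg F U) : symComp F U n x ∈ symDeg F U n := by
  induction x using SymmetricAlgebra.induction generalizing n with
  | algebraMap a =>
    rw [symComp_of_mem (algebraMap_mem_symDeg_zero a)]
    split_ifs with h
    · exact h ▸ algebraMap_mem_symDeg_zero a
    · exact zero_mem _
  | ι v =>
    rw [symComp_of_mem (ι_mem_symDeg_one v)]
    split_ifs with h
    · exact h ▸ ι_mem_symDeg_one v
    · exact zero_mem _
  | mul x y hx hy =>
    rw [symComp_mul]
    refine Submodule.sum_mem _ fun p hp => ?_
    rw [← Finset.HasAntidiagonal.mem_antidiagonal.1 hp]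
    exact mul_mem_symDeg (hx _) (hy _)
  | add x y hx hy =>
    rw [map_add]
    exact add_mem (hx n) (hy n)

/-- Setting t = 1 adds up the homogeneous components, so a polynomial is the sum of its components
and vanishes if they all do. -/
theorem eval_one_dilate (x : symAlg F U) : (dilate F U x).eval 1 = x := by
  have : (Polynomial.evalRingHom (1 : symAlg F U)).comp (dilate F U).toRingHom = RingHom.id _ := by
    apply symAlg_ringHom_ext
    · intro a
      change (dilate F U (algebraMap _ _ a)).eval 1 = _
      rw [dilate_algebraMap]
      simp
    · intro v
      change (dilate F U (symι F U v)).eval 1 = _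
      rw [dilate_ι]
      simp
  exact congr($this x)

theorem eq_zero_of_symComp {x : symAlg F U} (h : ∀ n, symComp F U n x = 0) : x = 0 := by
  have : dilate F U x = 0 := Polynomial.ext h
  rw [← eval_one_dilate x, this, Polynomial.eval_zero]

theorem ext_symComp {x y : symAlg F U} (h : ∀ n, symComp F U n x = symComp F U n y) : x = y := by
  rw [← sub_eq_zero]
  refine eq_zero_of_symComp fun n => ?_
  rw [map_sub, h, sub_self]

theorem exists_sum_symComp (x : symAlg F U) :
    ∃ N : ℕ, ∀ n ≥ N, x = ∑ i ∈ Finset.range n, symComp F U i x := by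
  refine ⟨(dilate F U x).natDegree + 1, fun n hn => ?_⟩
  conv_lhs => rw [← eval_one_dilate x, Polynomial.eval_eq_sum_range' (Nat.lt_of_succ_le hn)]
  simp [coeff_dilate]

theorem symComp_symComp (m n : ℕ) (x : symAlg F U) :
    symComp F U m (symComp F U n x) = if n = m then symComp F U n x else 0 :=
  symComp_of_mem (symComp_mem n x) m

theorem mem_symLT {n : ℕ} {x : symAlg F U} :
    x ∈ symLT F U n ↔ ∀ m ≥ n, symComp F U m x = 0 := by
  constructor
  · intro hx m hm
    have h : symLT F U n ≤ LinearMap.ker (symComp F U m) := by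
      refine iSup_le fun j y hy => ?_
      exact symComp_of_ne hy (by have := j.2; omega)
    exact h hx
  · intro h
    have hx : x = ∑ i ∈ Finset.range n, symComp F U i x := by
      refine ext_symComp fun m => ?_
      simp only [map_sum, symComp_symComp, Finset.sum_ite_eq', Finset.mem_range]
      split_ifs with hm
      · rfl
      · exact h m (not_lt.1 hm)
    rw [hx]
    refine Submodule.sum_mem _ fun i hi => ?_
    exact Submodule.mem_iSup_of_mem (p := fun j : Fin n => symDeg F U j)
      ⟨i, Finset.mem_range.1 hi⟩ (symComp_mem i x)

theorem exists_mem_symLT (x : symAlg F U) : ∃ n, x ∈ symLT F U n :=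
  ⟨(dilate F U x).natDegree + 1, mem_symLT.2 fun _ hm =>
    Polynomial.coeff_eq_zero_of_natDegree_lt (Nat.lt_of_succ_le hm)⟩

theorem symLT_mono {m n : ℕ} (h : m ≤ n) : symLT F U m ≤ symLT F U n := fun _ hx =>
  mem_symLT.2 fun k hk => mem_symLT.1 hx k (h.trans hk)

theorem mul_mem_symLT {m n : ℕ} {x y : symAlg F U} (hx : x ∈ symDeg F U m)
    (hy : y ∈ symLT F U n) : x * y ∈ symLT F U (m + n) := by
  rw [mem_symLT] at hy ⊢
  intro k hk
  rw [symComp_mul]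
  refine Finset.sum_eq_zero fun p hp => ?_
  have := Finset.HasAntidiagonal.mem_antidiagonal.1 hp
  by_cases h : m = p.1
  · rw [hy _ (by omega), mul_zero]
  · rw [symComp_of_ne hx h, zero_mul]

theorem symDeg_le_symLT {m n : ℕ} (h : m < n) : symDeg F U m ≤ symLT F U n := fun _ hx =>
  mem_symLT.2 fun _ hk => symComp_of_ne hx (by omega)

theorem mem_symLT_succ_of_sub {n : ℕ} {x : symAlg F U} (hx : x ∈ symLT F U (n + 1)) :
    x - symComp F U n x ∈ symLT F U n := by
  rw [mem_symLT] at hx ⊢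
  intro m hm
  rw [map_sub, symComp_symComp]
  split_ifs with h
  · rw [h, sub_self]
  · rw [hx m (by omega), sub_zero]

theorem symComp_zero_mem_of_mem_two {x : symAlg F U} (hx : x ∈ symLT F U 2) :
    x = symComp F U 0 x + symComp F U 1 x := by
  have h1 := mem_symLT_succ_of_sub hx
  have h2 := mem_symLT_succ_of_sub h1
  have h3 : x - symComp F U 1 x - symComp F U 0 (x - symComp F U 1 x) = 0 :=
    eq_zero_of_symComp fun n => mem_symLT.1 h2 n n.zero_le
  rw [map_sub, symComp_symComp, if_neg one_ne_zero, sub_zero] at h3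
  linear_combination h3

theorem natDegree_dilate_le {n : ℕ} {x : symAlg F U} (hx : x ∈ symLT F U (n + 1)) :
    (dilate F U x).natDegree ≤ n :=
  Polynomial.natDegree_le_iff_coeff_eq_zero.2 fun m hm => mem_symLT.1 hx m hm

theorem dilate_symRes {V : Y.Opens} (h : V ≤ U) (x : symAlg F U) :
    dilate F V (symRes F h x) = (dilate F U x).map (symRes F h) := by
  have : (dilate F V).toRingHom.comp (symRes F h) =
      (Polynomial.mapRingHom (symRes F h)).comp (dilate F U).toRingHom := by
    apply symAlg_ringHom_ext
    · intro a
      change dilate F V (symRes F h (algebraMap _ _ a)) =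
        (dilate F U (algebraMap _ _ a)).map (symRes F h)
      rw [symRes_algebraMap, dilate_algebraMap, dilate_algebraMap, Polynomial.map_C,
        symRes_algebraMap]
    · intro a
      change dilate F V (symRes F h (symι F U a)) =
        (dilate F U (symι F U a)).map (symRes F h)
      rw [symRes_ι, dilate_ι, dilate_ι, Polynomial.map_monomial, symRes_ι]
  exact congr($this x)

theorem symComp_symRes {V : Y.Opens} (h : V ≤ U) (n : ℕ) (x : symAlg F U) :
    symComp F V n (symRes F h x) = symRes F h (symComp F U n x) := by
  rw [← coeff_dilate, dilate_symRes, Polynomial.coeff_map, coeff_dilate]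

theorem symRes_mem_symDeg {V : Y.Opens} (h : V ≤ U) {n : ℕ} {x : symAlg F U}
    (hx : x ∈ symDeg F U n) : symRes F h x ∈ symDeg F V n := by
  rw [← symComp_self hx, ← symComp_symRes]
  exact symComp_mem _ _

/-- The square-zero extension O ⊕ F is a commutative algebra containing F, so the universal property
gives an algebra map from R(F) that restricts to the inclusion of F. No freeness is needed. -/
theorem symι_injective : Function.Injective (symι F U) := by
  let _ : Module Γ(Y, U)ᵐᵒᵖ Γ(F, U) := Module.compHom _ ((RingHom.id Γ(Y, U)).fromOpposite mul_comm)
  have : IsCentralScalar Γ(Y, U) Γ(F, U) := ⟨fun _ _ => rfl⟩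
  intro v w h
  have h1 := congr_arg (SymmetricAlgebra.lift (TrivSqZeroExt.inrHom Γ(Y, U) Γ(F, U))) h
  rw [SymmetricAlgebra.lift_ι_apply, SymmetricAlgebra.lift_ι_apply] at h1
  exact TrivSqZeroExt.inr_injective h1

theorem symRes_smul {V : Y.Opens} (h : V ≤ U) (a : Γ(Y, U)) (x : symAlg F U) :
    symRes F h (a • x) = ringRes Y h a • symRes F h x := by
  rw [Algebra.smul_def, map_mul, symRes_algebraMap, ← Algebra.smul_def]

/-- Homogenizing in a degree that is too large by k introduces the factor tᵏ, which the extension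
condition later cancels. -/
theorem reflect_of_natDegree_le {A : Type*} [CommRing A] {p : Polynomial A} {n : ℕ}
    (h : p.natDegree ≤ n) (k : ℕ) :
    Polynomial.reflect (k + n) p = Polynomial.X ^ k * Polynomial.reflect n p := by
  have := Polynomial.reflect_mul (1 : Polynomial A) p (F := k) (G := n) (by simp) h
  rwa [one_mul, Polynomial.reflect_one] at this

end Components

/-- A linear function to a commutative algebra extends to `R(F)`. -/
theorem exists_symLift {F : Y.Modules} {U : Y.Opens} {T : Type*} [CommRing T] [Algebra Γ(Y, U) T]
    (f : Γ(F, U) →ₗ[Γ(Y, U)] T) : ∃ g : symAlg F U →ₐ[Γ(Y, U)] T, ∀ v, g (symι F U v) = f v :=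
  ⟨SymmetricAlgebra.lift f, fun v => SymmetricAlgebra.lift_ι_apply f v⟩

end AlgCover

namespace AlgCover

variable {Y : Scheme.{u}}

/-! ### Cover homomorphisms and direct sum decompositions -/

namespace CoverDatum

variable (D : CoverDatum Y) {U : Y.affineOpens}

theorem symComp_mem_Q {q : symAlg D.F U.1} (hq : q ∈ D.Q U) (n : ℕ) :
    symComp D.F U.1 n q ∈ D.Q U := by
  rw [D.Q_graded U] at hq
  induction hq using Submodule.iSup_induction' with
  | mem i x hx =>
    rw [symComp_of_mem hx.2]
    split_ifs
    · exact hx.1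
    · exact zero_mem _
  | zero => rw [map_zero]; exact zero_mem _
  | add x y _ _ hx hy => rw [map_add]; exact add_mem hx hy

/-- Components of elements of Q lie in Q, and Q meets O ⊕ F trivially; hence Q lives in degrees at
least 2. -/
theorem symComp_Q_eq_zero {q : symAlg D.F U.1} (hq : q ∈ D.Q U) {n : ℕ} (hn : n < 2) :
    symComp D.F U.1 n q = 0 := by
  have h : symComp D.F U.1 n q ∈ D.Q U ⊓ (symDeg D.F U.1 0 ⊔ symDeg D.F U.1 1) := by
    refine ⟨D.symComp_mem_Q hq n, ?_⟩
    have := symComp_mem n q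
    interval_cases n
    · exact Submodule.mem_sup_left this
    · exact Submodule.mem_sup_right this
  rwa [D.Q_inf, Submodule.mem_bot] at h

/-- The component of degree `n` of an element of `Q`. -/
noncomputable def compQ (n : ℕ) (q : D.Q U) : D.Q U := ⟨_, D.symComp_mem_Q q.2 n⟩

theorem exists_sum_compQ (q : D.Q U) : ∃ N, q = ∑ n ∈ Finset.range N, D.compQ n q := by
  obtain ⟨N, hN⟩ := exists_sum_symComp (q : symAlg D.F U.1)
  refine ⟨N, Subtype.ext ?_⟩
  rw [AddSubmonoidClass.coe_finsetSum]
  exact hN N le_rfl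

theorem symComp_idealOf_eq_zero {x : symAlg D.F U.1} (hx : x ∈ idealOf (D.Q U)) {n : ℕ}
    (hn : n < 2) : symComp D.F U.1 n x = 0 := by
  induction hx using Submodule.span_induction generalizing n with
  | mem x h => exact D.symComp_Q_eq_zero h hn
  | zero => rw [map_zero]
  | add x y _ _ hx hy => rw [map_add, hx hn, hy hn, add_zero]
  | smul a x _ hx =>
    rw [smul_eq_mul, symComp_mul]
    refine Finset.sum_eq_zero fun p hp => ?_
    have := Finset.HasAntidiagonal.mem_antidiagonal.1 hp
    rw [hx (by omega), mul_zero]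

theorem proj_eq_proj {x y : symAlg D.F U.1} :
    D.proj U x = D.proj U y ↔ x - y ∈ idealOf (D.Q U) := Ideal.Quotient.mk_eq_mk_iff_sub_mem _ _

theorem exists_proj (c : D.quotient U) : ∃ x, D.proj U x = c := Ideal.Quotient.mk_surjective c

theorem σ_proj_of_mem {n : ℕ} {x : symAlg D.F U.1} (hx : x ∈ symDeg D.F U.1 n) :
    D.σ U (D.proj U x) ∈ symDeg D.F U.1 n := D.σ_deg U n x hx

/-- A graded section commutes with passage to homogeneous components. -/
theorem symComp_σ_proj (n : ℕ) (x : symAlg D.F U.1) :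
    symComp D.F U.1 n (D.σ U (D.proj U x)) = D.σ U (D.proj U (symComp D.F U.1 n x)) := by
  obtain ⟨N, hN⟩ := exists_sum_symComp x
  -- At least n + 1 terms are taken, so that the index n occurs in the sum.
  have hx := hN (max N (n + 1)) (le_max_left _ _)
  have h1 : ∀ i, symComp D.F U.1 n (D.σ U (D.proj U (symComp D.F U.1 i x))) =
      if i = n then D.σ U (D.proj U (symComp D.F U.1 i x)) else 0 := fun i =>
    symComp_of_mem (D.σ_proj_of_mem (symComp_mem i x)) n
  conv_lhs => rw [hx]
  rw [map_sum, map_sum, map_sum]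
  simp only [h1, Finset.sum_ite_eq']
  rw [if_pos (Finset.mem_range.2 (lt_of_lt_of_le n.lt_succ_self (le_max_right _ _)))]

theorem symComp_σ (n : ℕ) (c : D.quotient U) :
    symComp D.F U.1 n (D.σ U c) = D.σ U (D.proj U (symComp D.F U.1 n (D.σ U c))) := by
  have := D.symComp_σ_proj n (D.σ U c)
  rwa [show D.proj U (D.σ U c) = c from D.σ_section U c] at this

theorem σ_proj_sub_mem (x : symAlg D.F U.1) : x - D.σ U (D.proj U x) ∈ idealOf (D.Q U) := by
  rw [← D.proj_eq_proj, show D.proj U (D.σ U (D.proj U x)) = D.proj U x from D.σ_section U _]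

theorem σ_mem_symLT {n : ℕ} {x : symAlg D.F U.1} (hx : x ∈ symLT D.F U.1 n) :
    D.σ U (D.proj U x) ∈ symLT D.F U.1 n := by
  rw [mem_symLT] at hx ⊢
  intro m hm
  rw [symComp_σ_proj, hx m hm, map_zero, map_zero]

/-- The difference of x and σ of its class is a form of degree less than 2 in ⟨Q⟩, where there are
none but 0. So O and F lie in the image of σ, which therefore generates R(F) as a ring. -/
theorem σ_proj_of_lt_two {n : ℕ} (hn : n < 2) {x : symAlg D.F U.1} (hx : x ∈ symDeg D.F U.1 n) :
    D.σ U (D.proj U x) = x := by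
  have h1 := D.symComp_idealOf_eq_zero (D.σ_proj_sub_mem x) hn
  rw [map_sub, symComp_self hx, symComp_self (D.σ_proj_of_mem hx), sub_eq_zero] at h1
  exact h1.symm

theorem σ_proj_algebraMap (a : Γ(Y, U.1)) :
    D.σ U (D.proj U (algebraMap _ _ a)) = algebraMap _ _ a :=
  D.σ_proj_of_lt_two Nat.zero_lt_two (algebraMap_mem_symDeg_zero a)

theorem σ_proj_ι (v : Γ(D.F, U.1)) : D.σ U (D.proj U (symι D.F U.1 v)) = symι D.F U.1 v :=
  D.σ_proj_of_lt_two Nat.one_lt_two (ι_mem_symDeg_one v)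

theorem resQuot_proj {U V : Y.affineOpens} (h : V.1 ≤ U.1) (x : symAlg D.F U.1) :
    D.resQuot h (D.proj U x) = D.proj V (symRes D.F h x) := Ideal.quotientMap_mk

theorem σ_resQuot {U V : Y.affineOpens} (h : V.1 ≤ U.1) (c : D.quotient U) :
    D.σ V (D.resQuot h c) = symRes D.F h (D.σ U c) := by
  obtain ⟨x, rfl⟩ := D.exists_proj c
  rw [resQuot_proj]
  exact D.σ_res h x

variable {D}

namespace QHom

variable (Φ : D.QHom)

theorem deform_sum {ι : Type*} (s : Finset ι) (q : ι → D.Q U) :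
    Φ.deform U (∑ i ∈ s, q i) = ∑ i ∈ s, Φ.deform U (q i) := by
  simp only [deform, map_sum, AddSubmonoidClass.coe_finsetSum, Finset.sum_sub_distrib]

theorem deform_mem (q : D.Q U) : Φ.deform U q ∈ Φ.ideal U := Ideal.subset_span ⟨q, rfl⟩

theorem deform_res {U V : Y.affineOpens} (h : V.1 ≤ U.1) (q : D.Q U) :
    symRes D.F h (Φ.deform U q) = Φ.deform V (D.resQ h q) := by
  rw [deform, deform, map_sub, Φ.res, σ_resQuot]
  rfl

theorem symRes_mem_ideal {U V : Y.affineOpens} (h : V.1 ≤ U.1) {x : symAlg D.F U.1}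
    (hx : x ∈ Φ.ideal U) : symRes D.F h x ∈ Φ.ideal V := by
  have : Φ.ideal U ≤ (Φ.ideal V).comap (symRes D.F h) := by
    refine Ideal.span_le.2 ?_
    rintro _ ⟨q, rfl⟩
    change symRes D.F h (Φ.deform U q) ∈ Φ.ideal V
    rw [deform_res]
    exact Φ.deform_mem _
  exact this hx

variable {Φ}

/-- The degree condition in the definition of a cover homomorphism. -/
def Lowers (Φ : D.QHom) (U : Y.affineOpens) : Prop :=
  ∀ (n : ℕ) (q : D.Q U), (q : symAlg D.F U.1) ∈ symDeg D.F U.1 n →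
    ∃ x ∈ symLT D.F U.1 n, Φ.app U q = D.proj U x

theorem Lowers.σ_mem (hΦ : Φ.Lowers U) {n : ℕ} {q : D.Q U}
    (hq : (q : symAlg D.F U.1) ∈ symDeg D.F U.1 n) : D.σ U (Φ.app U q) ∈ symLT D.F U.1 n := by
  obtain ⟨x, hx, h⟩ := hΦ n q hq
  rw [h]
  exact D.σ_mem_symLT hx

theorem Lowers.deform_mem_symLT (hΦ : Φ.Lowers U) {n : ℕ} {q : D.Q U}
    (hq : (q : symAlg D.F U.1) ∈ symDeg D.F U.1 n) : Φ.deform U q ∈ symLT D.F U.1 (n + 1) :=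
  sub_mem (symDeg_le_symLT n.lt_succ_self hq) (symLT_mono n.le_succ (hΦ.σ_mem hq))

/-- One step of the division: in a form Σ rⱼqⱼ of degree n with qⱼ in Q, replacing each qⱼ by qⱼ −
σ(Φ(qⱼ)) changes only terms of degree less than n. -/
theorem Lowers.exists_symComp_sub_mem (hΦ : Φ.Lowers U) {y : symAlg D.F U.1}
    (hy : y ∈ idealOf (D.Q U)) (n : ℕ) :
    ∃ i ∈ Φ.ideal U, symComp D.F U.1 n y - i ∈ symLT D.F U.1 n := by
  induction hy using Submodule.span_induction generalizing n with
  | mem q hq =>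
    refine ⟨_, Φ.deform_mem (D.compQ n ⟨q, hq⟩), ?_⟩
    have h : symComp D.F U.1 n q - Φ.deform U (D.compQ n ⟨q, hq⟩) =
        D.σ U (Φ.app U (D.compQ n ⟨q, hq⟩)) := sub_sub_cancel _ _
    rw [h]
    exact hΦ.σ_mem (symComp_mem n q)
  | zero => exact ⟨0, zero_mem _, by rw [map_zero, sub_zero]; exact zero_mem _⟩
  | add x y _ _ hx hy =>
    obtain ⟨i, hi, hi'⟩ := hx n
    obtain ⟨j, hj, hj'⟩ := hy n
    refine ⟨i + j, add_mem hi hj, ?_⟩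
    rw [map_add, add_sub_add_comm]
    exact add_mem hi' hj'
  | smul r x _ hx =>
    choose i hi hi' using hx
    -- The component of rx in degree n is the sum of the products of components of r and x with
    -- degrees adding up to n; each component of x gets its own correction.
    refine ⟨∑ p ∈ Finset.HasAntidiagonal.antidiagonal n, symComp D.F U.1 p.1 r * i p.2,
      Ideal.sum_mem _ fun p _ => Ideal.mul_mem_left _ _ (hi _), ?_⟩
    rw [smul_eq_mul, symComp_mul, ← Finset.sum_sub_distrib]
    refine Submodule.sum_mem _ fun p hp => ?_
    rw [← mul_sub, ← Finset.HasAntidiagonal.mem_antidiagonal.1 hp]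
    exact mul_mem_symLT (symComp_mem _ _) (hi' _)

/-- `R(F)` is the sum of the image of `σ` and the ideal of the polynomials `q - Φ(q)`. -/
theorem Lowers.exists_sub_σ_mem (hΦ : Φ.Lowers U) (x : symAlg D.F U.1) :
    ∃ c, x - D.σ U c ∈ Φ.ideal U := by
  obtain ⟨n, hn⟩ := exists_mem_symLT x
  induction n generalizing x with
  | zero =>
    have : x = 0 := eq_zero_of_symComp fun n => mem_symLT.1 hn n n.zero_le
    exact ⟨0, by rw [this, map_zero, sub_zero]; exact zero_mem _⟩
  | succ n ih =>
    -- The difference between x and the normal form of its class modulo ⟨Q⟩ has no larger degree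
    -- than x, and its top component can be lowered modulo the ideal.
    have hy := D.σ_proj_sub_mem x
    set y := x - D.σ U (D.proj U x) with hy_def
    have hy' : y ∈ symLT D.F U.1 (n + 1) := sub_mem hn (D.σ_mem_symLT hn)
    obtain ⟨i, hi, hi'⟩ := hΦ.exists_symComp_sub_mem hy n
    have h : y - i ∈ symLT D.F U.1 n := by
      have := add_mem (mem_symLT_succ_of_sub hy') hi'
      rwa [sub_add_sub_cancel] at this
    obtain ⟨c, hc⟩ := ih (y - i) h
    refine ⟨D.proj U x + c, ?_⟩
    have := add_mem hc hi
    rw [map_add]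
    convert this using 1
    rw [hy_def]
    ring

theorem IsCoverHom.lowers' (hΦ : Φ.IsCoverHom) (U : Y.affineOpens) : Φ.Lowers U := hΦ.lowers U

/-- Only large homogenization degrees are available here: cancellation of leading forms may make the
degree of g smaller than that of the products of generators that express it. -/
theorem Lowers.exists_reflect_mem (hΦ : Φ.Lowers U) {g : symAlg D.F U.1} (hg : g ∈ Φ.ideal U) :
    ∃ M, ∀ n ≥ M, Polynomial.reflect n (dilate D.F U.1 g) ∈ Φ.homogIdeal U := by
  have key : ∀ (M : ℕ) (g : symAlg D.F U.1), (dilate D.F U.1 g).natDegree ≤ M →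
      Polynomial.reflect M (dilate D.F U.1 g) ∈ Φ.homogIdeal U →
      ∀ n ≥ M, Polynomial.reflect n (dilate D.F U.1 g) ∈ Φ.homogIdeal U := by
    intro M g h1 h2 n hn
    obtain ⟨k, rfl⟩ := Nat.exists_eq_add_of_le' hn
    rw [reflect_of_natDegree_le h1]
    exact Ideal.mul_mem_left _ _ h2
  induction hg using Submodule.span_induction with
  | mem g hg =>
    obtain ⟨q, rfl⟩ := hg
    obtain ⟨N, hN⟩ := D.exists_sum_compQ q
    refine ⟨N, fun n hn => ?_⟩
    rw [hN, deform_sum, map_sum]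
    have hsum : ∀ s : Finset ℕ, Polynomial.reflect n
        (∑ i ∈ s, dilate D.F U.1 (Φ.deform U (D.compQ i q))) =
        ∑ i ∈ s, Polynomial.reflect n (dilate D.F U.1 (Φ.deform U (D.compQ i q))) := by
      intro s
      induction s using Finset.induction_on with
      | empty => simp
      | insert a s ha ih => rw [Finset.sum_insert ha, Finset.sum_insert ha,
          Polynomial.reflect_add, ih]
    rw [hsum]
    refine Ideal.sum_mem _ fun i hi => ?_
    have hq : ((D.compQ i q : D.Q U) : symAlg D.F U.1) ∈ symDeg D.F U.1 i := symComp_mem i _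
    refine key i _ (natDegree_dilate_le (hΦ.deform_mem_symLT hq)) ?_ n
      ((Finset.mem_range.1 hi).le.trans hn)
    exact Ideal.subset_span ⟨i, _, hq, rfl⟩
  | zero =>
    refine ⟨0, fun n _ => ?_⟩
    rw [map_zero, Polynomial.reflect_zero]
    exact zero_mem _
  | add x y _ _ hx hy =>
    obtain ⟨M, hM⟩ := hx
    obtain ⟨M', hM'⟩ := hy
    refine ⟨max M M', fun n hn => ?_⟩
    rw [map_add, Polynomial.reflect_add]
    exact add_mem (hM n ((le_max_left _ _).trans hn)) (hM' n ((le_max_right _ _).trans hn))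
  | smul r x _ hx =>
    obtain ⟨M, hM⟩ := hx
    set a := (dilate D.F U.1 r).natDegree
    -- The bound M puts the homogenization of x in the ideal, and the degree bound makes
    -- homogenization multiplicative.
    set b := max M (dilate D.F U.1 x).natDegree
    have hb : (dilate D.F U.1 x).natDegree ≤ b := le_max_right _ _
    refine ⟨a + b, key _ _ ?_ ?_⟩
    · rw [smul_eq_mul, map_mul]
      exact Polynomial.natDegree_mul_le.trans (add_le_add le_rfl hb)
    · rw [smul_eq_mul, map_mul, Polynomial.reflect_mul _ _ le_rfl hb]
      exact Ideal.mul_mem_left _ _ (hM _ (le_max_left _ _))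

theorem IsCoverHom.of_X_pow_mul_mem (hΦ : Φ.IsCoverHom) {g : Polynomial (symAlg D.F U.1)} (k : ℕ)
    (hg : Polynomial.X ^ k * g ∈ Φ.homogIdeal U) : g ∈ Φ.homogIdeal U := by
  induction k with
  | zero => rwa [pow_zero, one_mul] at hg
  | succ k ih =>
    refine ih (hΦ.extension U _ ?_)
    rwa [← mul_assoc, ← pow_succ']

/-- At t = 0 a generator becomes the component of degree n of q − σ(Φ(q)), which is q because Φ
lowers degrees. -/
theorem IsCoverHom.coeff_zero_mem (hΦ : Φ.IsCoverHom) {g : Polynomial (symAlg D.F U.1)}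
    (hg : g ∈ Φ.homogIdeal U) : g.coeff 0 ∈ idealOf (D.Q U) := by
  have : Φ.homogIdeal U ≤ (idealOf (D.Q U)).comap Polynomial.constantCoeff := by
    refine Ideal.span_le.2 ?_
    rintro _ ⟨n, q, hq, rfl⟩
    change Polynomial.coeff (homogenize D.F U.1 n (Φ.deform U q)) 0 ∈ idealOf (D.Q U)
    rw [homogenize, Polynomial.coeff_reflect, Polynomial.revAt_zero, coeff_dilate, deform, map_sub,
      symComp_self hq, mem_symLT.1 ((hΦ.lowers' U).σ_mem hq) n le_rfl, sub_zero]
    exact Ideal.subset_span q.2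
  exact this hg

/-- The leading forms of the elements of the ideal of the polynomials `q - Φ(q)` belong
to `⟨Q⟩`. -/
theorem IsCoverHom.leading_form_mem (hΦ : Φ.IsCoverHom) {g : symAlg D.F U.1}
    (hg : g ∈ Φ.ideal U) {n : ℕ} (hn : g ∈ symLT D.F U.1 (n + 1)) :
    symComp D.F U.1 n g ∈ idealOf (D.Q U) := by
  obtain ⟨M, hM⟩ := (hΦ.lowers' U).exists_reflect_mem hg
  -- The homogenization in degree M + n is tᴹ times the one in degree n. After cancelling tᴹ, the
  -- value at t = 0 is the leading form.
  have h := hM (M + n) (Nat.le_add_right _ _)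
  rw [reflect_of_natDegree_le (natDegree_dilate_le hn)] at h
  have h' := hΦ.coeff_zero_mem (hΦ.of_X_pow_mul_mem M h)
  rwa [Polynomial.coeff_reflect, Polynomial.revAt_zero, coeff_dilate] at h'

/-- The leading form of σ(c) lies in ⟨Q⟩, but it is also σ of its own class, so it is zero; descent
on the degree bound. -/
theorem IsCoverHom.eq_zero_of_σ_mem (hΦ : Φ.IsCoverHom) {c : D.quotient U}
    (hc : D.σ U c ∈ Φ.ideal U) : c = 0 := by
  have h : ∀ n, D.σ U c ∈ symLT D.F U.1 n → D.σ U c = 0 := by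
    intro n
    induction n with
    | zero => exact fun hn => eq_zero_of_symComp fun m => mem_symLT.1 hn m m.zero_le
    | succ n ih =>
      intro hn
      have h1 := hΦ.leading_form_mem hc hn
      have h2 := D.symComp_σ n c
      rw [show D.proj U (symComp D.F U.1 n (D.σ U c)) = 0 from
        Ideal.Quotient.eq_zero_iff_mem.2 h1, map_zero] at h2
      have h3 := mem_symLT_succ_of_sub hn
      rw [h2, sub_zero] at h3
      exact ih h3
  obtain ⟨n, hn⟩ := exists_mem_symLT (D.σ U c)
  rw [← D.σ_section U c, h n hn, map_zero]

end QHom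

end CoverDatum

end AlgCover

namespace AlgCover

variable {Y : Scheme.{u}}

/-! ### The algebra structure determined by a cover homomorphism -/

namespace CoverDatum

variable {D : CoverDatum Y} {Φ : D.QHom}

namespace QHom

/-- The remainder in `R(F)/⟨Q⟩` of a polynomial on division by the polynomials `q - Φ(q)`. -/
noncomputable def IsCoverHom.rem (hΦ : Φ.IsCoverHom) (U : Y.affineOpens) :
    symAlg D.F U.1 →ₗ[Γ(Y, U.1)] D.quotient U :=
  have h (x) : x - D.σ U ((hΦ.lowers' U).exists_sub_σ_mem x).choose ∈ Φ.ideal U :=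
    ((hΦ.lowers' U).exists_sub_σ_mem x).choose_spec
  { toFun x := ((hΦ.lowers' U).exists_sub_σ_mem x).choose
    -- The remainder is chosen arbitrarily; linearity follows from its uniqueness, as the image of σ
    -- meets the ideal only in 0.
    map_add' x y := by
      rw [← sub_eq_zero]
      refine hΦ.eq_zero_of_σ_mem ?_
      have := sub_mem (add_mem (h x) (h y)) (h (x + y))
      convert this using 1
      rw [map_sub, map_add]
      ring
    map_smul' a x := by
      rw [← sub_eq_zero]
      refine hΦ.eq_zero_of_σ_mem ?_
      have := sub_mem (Ideal.mul_mem_left _ (algebraMap _ _ a) (h x)) (h (a • x))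
      convert this using 1
      rw [map_sub, map_smul, RingHom.id_apply, Algebra.smul_def, Algebra.smul_def]
      ring }

variable (hΦ : Φ.IsCoverHom) {U : Y.affineOpens}

theorem IsCoverHom.sub_σ_rem_mem (x : symAlg D.F U.1) : x - D.σ U (hΦ.rem U x) ∈ Φ.ideal U :=
  ((hΦ.lowers' U).exists_sub_σ_mem x).choose_spec

theorem IsCoverHom.rem_eq {x : symAlg D.F U.1} {c : D.quotient U}
    (h : x - D.σ U c ∈ Φ.ideal U) : hΦ.rem U x = c := by
  rw [← sub_eq_zero]
  refine hΦ.eq_zero_of_σ_mem ?_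
  have := sub_mem h (hΦ.sub_σ_rem_mem x)
  rwa [sub_sub_sub_cancel_left, ← map_sub] at this

theorem IsCoverHom.rem_σ (c : D.quotient U) : hΦ.rem U (D.σ U c) = c :=
  hΦ.rem_eq (by rw [sub_self]; exact zero_mem _)

theorem IsCoverHom.rem_eq_zero {x : symAlg D.F U.1} : hΦ.rem U x = 0 ↔ x ∈ Φ.ideal U := by
  constructor
  · intro h
    have := hΦ.sub_σ_rem_mem x
    rwa [h, map_zero, sub_zero] at this
  · intro h
    exact hΦ.rem_eq (by rwa [map_zero, sub_zero])

/-- A factor may be replaced by its normal form because the two differ by an element of the ideal;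
associativity of the product on M comes from this. -/
theorem IsCoverHom.rem_σ_rem_mul (x y : symAlg D.F U.1) :
    hΦ.rem U (D.σ U (hΦ.rem U x) * y) = hΦ.rem U (x * y) := by
  rw [← sub_eq_zero, ← map_sub, hΦ.rem_eq_zero, ← sub_mul, ← neg_sub, neg_mul]
  exact neg_mem (Ideal.mul_mem_right _ _ (hΦ.sub_σ_rem_mem x))

theorem IsCoverHom.rem_mul_σ_rem (x y : symAlg D.F U.1) :
    hΦ.rem U (y * D.σ U (hΦ.rem U x)) = hΦ.rem U (y * x) := by
  rw [mul_comm, rem_σ_rem_mul, mul_comm]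

theorem IsCoverHom.rem_res {V : Y.affineOpens} (h : V.1 ≤ U.1) (x : symAlg D.F U.1) :
    hΦ.rem V (symRes D.F h x) = D.resQuot h (hΦ.rem U x) := by
  apply hΦ.rem_eq
  rw [σ_resQuot, ← map_sub]
  exact Φ.symRes_mem_ideal h (hΦ.sub_σ_rem_mem x)

end QHom

namespace ModIso

variable {M : Y.Modules} (θ : D.ModIso M)

theorem res_symm (U V : Y.affineOpens) (h : V.1 ≤ U.1) (x : Γ(M, U.1)) :
    (θ.app V).symm (secRes M h x) = D.resQuot h ((θ.app U).symm x) := by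
  rw [LinearEquiv.symm_apply_eq, θ.res, LinearEquiv.apply_symm_apply]

/-- The multiplication on `M` that a cover homomorphism determines. -/
noncomputable def algStr (hΦ : Φ.IsCoverHom) : AlgStr M where
  mul U := LinearMap.mk₂ Γ(Y, U.1)
    (fun x y => θ.app U (hΦ.rem U (D.σ U ((θ.app U).symm x) * D.σ U ((θ.app U).symm y))))
    (fun x y z => by simp only [map_add, add_mul])
    (fun a x y => by simp only [map_smul, smul_mul_assoc])
    (fun x y z => by simp only [map_add, mul_add])
    (fun a x y => by simp only [map_smul, mul_smul_comm])
  one U := θ.app U (hΦ.rem U 1)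
  mul_comm U x y := by
    simp only [LinearMap.mk₂_apply]
    rw [mul_comm]
  mul_assoc U x y z := by
    simp only [LinearMap.mk₂_apply, LinearEquiv.symm_apply_apply, hΦ.rem_σ_rem_mul,
      hΦ.rem_mul_σ_rem, mul_assoc]
  one_mul U x := by
    simp only [LinearMap.mk₂_apply, LinearEquiv.symm_apply_apply, hΦ.rem_σ_rem_mul, one_mul,
      hΦ.rem_σ, LinearEquiv.apply_symm_apply]
  res_mul U V h x y := by
    simp only [LinearMap.mk₂_apply]
    rw [← θ.res, ← hΦ.rem_res, map_mul, ← σ_resQuot, ← σ_resQuot, res_symm, res_symm]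
  res_one U V h := by
    rw [← θ.res, ← hΦ.rem_res, map_one]

theorem presents_algStr (hΦ : Φ.IsCoverHom) : Presents D θ Φ (θ.algStr hΦ) := by
  intro U
  refine ⟨(θ.app U).toLinearMap ∘ₗ hΦ.rem U, rfl, fun x y => ?_, fun x => ?_, fun c => ?_⟩
  · change θ.app U (hΦ.rem U (x * y)) = θ.app U (hΦ.rem U (D.σ U ((θ.app U).symm
      (θ.app U (hΦ.rem U x))) * D.σ U ((θ.app U).symm (θ.app U (hΦ.rem U y)))))
    rw [LinearEquiv.symm_apply_apply, LinearEquiv.symm_apply_apply, hΦ.rem_σ_rem_mul,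
      hΦ.rem_mul_σ_rem]
  · rw [← hΦ.rem_eq_zero]
    exact (θ.app U).map_eq_zero_iff
  · exact congr_arg (θ.app U) (hΦ.rem_σ c)

end ModIso

end CoverDatum

/-! ### Uniqueness of the algebra structure and of the cover homomorphism in a presentation -/

section Presents

variable {M : Y.Modules} {D : CoverDatum Y} {θ : D.ModIso M} {Φ Φ' : D.QHom} {m m' : AlgStr M}

/-- Since π kills the ideal and equals θ on the image of σ, it must be θ composed with the
remainder. Surjectivity of θ then fixes the product. -/
theorem eq_algStr_of_presents (hΦ : Φ.IsCoverHom) (h : Presents D θ Φ m) : m = θ.algStr hΦ := by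
  choose π h1 hmul hker hσ using h
  have hπ : ∀ U x, π U x = θ.app U (hΦ.rem U x) := by
    intro U x
    have := (hker U _).2 (hΦ.sub_σ_rem_mem x)
    rwa [map_sub, sub_eq_zero, hσ] at this
  apply AlgStr.ext
  · funext U
    refine LinearMap.ext fun x => LinearMap.ext fun y => ?_
    obtain ⟨c, rfl⟩ := (θ.app U).surjective x
    obtain ⟨e, rfl⟩ := (θ.app U).surjective y
    rw [← hσ, ← hσ, ← hmul, hπ, hσ, hσ]
    change _ = θ.app U (hΦ.rem U (D.σ U ((θ.app U).symm (θ.app U c)) *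
      D.σ U ((θ.app U).symm (θ.app U e))))
    rw [LinearEquiv.symm_apply_apply, LinearEquiv.symm_apply_apply]
  · funext U
    rw [← h1, hπ]
    rfl

theorem existsUnique_presents (θ : D.ModIso M) (hΦ : Φ.IsCoverHom) :
    ∃! m : AlgStr M, Presents D θ Φ m :=
  ⟨θ.algStr hΦ, θ.presents_algStr hΦ, fun _ h => eq_algStr_of_presents hΦ h⟩

theorem AlgStr.hom_ext {F : Y.Modules} {U : Y.affineOpens} {π π' : symAlg F U.1 →ₗ[Γ(Y, U.1)] Γ(M, U.1)}
    (h1 : π 1 = m.one U) (hmul : ∀ x y, π (x * y) = m.mul U (π x) (π y))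
    (h1' : π' 1 = m.one U) (hmul' : ∀ x y, π' (x * y) = m.mul U (π' x) (π' y))
    (hι : ∀ v, π (symι F U.1 v) = π' (symι F U.1 v)) : π = π' := by
  refine LinearMap.ext fun x => ?_
  induction x using SymmetricAlgebra.induction with
  | algebraMap a => rw [Algebra.algebraMap_eq_smul_one, map_smul, map_smul, h1, h1']
  | ι v => exact hι v
  | mul x y hx hy => rw [hmul, hmul', hx, hy]
  | add x y hx hy => rw [map_add, map_add, hx, hy]

/-- Two presentations of the same algebra agree on F, where σ is the identity and both are given by
θ, hence everywhere. Then θ(Φ(q)) = π(q) recovers Φ. -/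
theorem eq_of_presents (h : Presents D θ Φ m) (h' : Presents D θ Φ' m) : Φ = Φ' := by
  apply CoverDatum.QHom.ext
  funext U
  refine LinearMap.ext fun q => (θ.app U).injective ?_
  obtain ⟨π, h1, hmul, hker, hσ⟩ := h U
  obtain ⟨π', h1', hmul', hker', hσ'⟩ := h' U
  have hπ : π = π' := AlgStr.hom_ext h1 hmul h1' hmul' fun v => by
    rw [← D.σ_proj_ι v, hσ, hσ']
  have e := (hker _).2 (Φ.deform_mem q)
  have e' := (hker' _).2 (Φ'.deform_mem q)
  rw [CoverDatum.QHom.deform, map_sub, sub_eq_zero, hσ] at e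
  rw [CoverDatum.QHom.deform, map_sub, sub_eq_zero, hσ'] at e'
  rw [← e, ← e', hπ]

end Presents

end AlgCover

namespace AlgCover

variable {Y : Scheme.{u}}

/-! ### Morphisms to the relative affine space -/

section Glue

variable {X Z : Scheme.{u}} (φ : X ⟶ Y)

theorem pullbackMap_pullbackRestrictIsoRestrict {U V : Y.Opens} (h : U ≤ V)
    (h₁ : φ ≫ 𝟙 Y = 𝟙 X ≫ φ) (h₂ : U.ι ≫ 𝟙 Y = Y.homOfLE h ≫ V.ι) :
    Limits.pullback.map φ U.ι φ V.ι (𝟙 X) (Y.homOfLE h) (𝟙 Y) h₁ h₂ ≫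
      (pullbackRestrictIsoRestrict φ V).hom =
        (pullbackRestrictIsoRestrict φ U).hom ≫ X.homOfLE (φ.preimage_mono h) := by
  rw [← cancel_mono (Scheme.Opens.ι _)]
  simp only [Category.assoc, pullbackRestrictIsoRestrict_hom_ι, Scheme.homOfLE_ι]
  exact (Limits.pullback.lift_fst _ _ _).trans (Category.comp_id _)

/-- The preimages of the affine open sets form a locally directed cover of X, so compatibility under
inclusions suffices for gluing and no overlaps need be considered. -/
theorem exists_glue_preimage (g : ∀ U : Y.affineOpens, (φ ⁻¹ᵁ U.1).toScheme ⟶ Z)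
    (hg : ∀ U V : Y.AffineZariskiSite, ∀ h : V ≤ U,
      X.homOfLE (φ.preimage_mono (Scheme.AffineZariskiSite.toOpens_mono h)) ≫ g U = g V) :
    ∃ i : X ⟶ Z, ∀ U, (φ ⁻¹ᵁ U.1).ι ≫ i = g U := by
  have H : ∀ {U V : Y.AffineZariskiSite} (j : U ⟶ V),
      Scheme.Cover.trans ((Scheme.AffineZariskiSite.directedCover Y).pullback₁ φ) j ≫
        (pullbackRestrictIsoRestrict φ V.1).hom ≫ g V =
          (pullbackRestrictIsoRestrict φ U.1).hom ≫ g U := by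
    intro U V j
    have h1 := pullbackMap_pullbackRestrictIsoRestrict φ
      (Scheme.AffineZariskiSite.toOpens_mono j.le) (by simp) (by simp)
    refine (Category.assoc _ _ _).symm.trans ((congr_arg (· ≫ g V) h1).trans ?_)
    refine (Category.assoc _ _ _).trans (congr_arg _ (hg V U j.le))
  refine ⟨Scheme.OpenCover.glueMorphismsOfLocallyDirected
    ((Scheme.AffineZariskiSite.directedCover Y).pullback₁ φ)
    (fun U => (pullbackRestrictIsoRestrict φ _).hom ≫ g U) H, fun U => ?_⟩
  set i := Scheme.OpenCover.glueMorphismsOfLocallyDirected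
    ((Scheme.AffineZariskiSite.directedCover Y).pullback₁ φ)
    (fun U => (pullbackRestrictIsoRestrict φ _).hom ≫ g U) H
  rw [← cancel_epi (pullbackRestrictIsoRestrict φ U.1).hom, ← Category.assoc]
  refine Eq.trans ?_ (Scheme.OpenCover.map_glueMorphismsOfLocallyDirected
    ((Scheme.AffineZariskiSite.directedCover Y).pullback₁ φ) _ H U)
  exact congr_arg (· ≫ i) (pullbackRestrictIsoRestrict_hom_ι φ U.1)

theorem hom_ext_preimage {i j : X ⟶ Z}
    (h : ∀ U : Y.affineOpens, (φ ⁻¹ᵁ U.1).ι ≫ i = (φ ⁻¹ᵁ U.1).ι ≫ j) : i = j := by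
  have hU : ⨆ U : Y.affineOpens, φ ⁻¹ᵁ U.1 = ⊤ := by
    rw [← Scheme.Hom.preimage_iSup, iSup_affineOpens_eq_top]
    rfl
  exact Scheme.Cover.hom_ext (X.openCoverOfIsOpenCover _ hU) _ _ h

end Glue

namespace relAffineSpace

variable {F : Y.Modules} {r : ℕ} (hF : IsLocallyFreeOfRank F r)

instance (U : Y.affineOpens) : IsOpenImmersion (chart F hF U) :=
  (symGluingData hF).cover.map_prop U

theorem symRes_chart {U V : Y.AffineZariskiSite} (h : V ≤ U) :
    Spec.map (CommRingCat.ofHom (symRes F (Scheme.AffineZariskiSite.toOpens_mono h))) ≫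
      chart F hF U = chart F hF V :=
  Limits.colimit.w (symGluingData hF).functor (homOfLE h)

theorem proj_preimage (U : Y.affineOpens) :
    proj F hF ⁻¹ᵁ U.1 = (chart F hF U).opensRange := by
  have := (symGluingData hF).toBase_preimage_eq_opensRange_ι U
  have h : ((Scheme.AffineZariskiSite.directedCover Y).f U).opensRange = U.1 :=
    Scheme.Opens.opensRange_ι U.1
  rw [h] at this
  exact this

end relAffineSpace

/-! ### Reading closed immersions and their ideals off the ring homomorphisms on charts -/

section Comorphism

variable {X : Scheme.{u}} {D : CoverDatum Y} {φ : X ⟶ Y}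
  {i i' : X ⟶ relAffineSpace D.F D.locallyFree} {U : Y.affineOpens}

theorem preimage_chart (hi : i ≫ relAffineSpace.proj D.F D.locallyFree = φ) (U : Y.affineOpens) :
    i ⁻¹ᵁ (relAffineSpace.chart D.F D.locallyFree U).opensRange = φ ⁻¹ᵁ U.1 := by
  rw [← relAffineSpace.proj_preimage, ← Scheme.Hom.comp_preimage, hi]

/-- An open immersion has a cartesian square over it once the preimage of its range is identified,
and the preimage of the chart over U is that of U under φ. -/
theorem IsComorphism.isPullback (hi : i ≫ relAffineSpace.proj D.F D.locallyFree = φ)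
    {π : symAlg D.F U.1 →+* Γ(X, φ ⁻¹ᵁ U.1)} (h : IsComorphism D φ i U π) :
    IsPullback ((φ ⁻¹ᵁ U.1).toSpecΓ ≫ Spec.map (CommRingCat.ofHom π)) (φ ⁻¹ᵁ U.1).ι
      (relAffineSpace.chart D.F D.locallyFree U) i := by
  refine IsOpenImmersion.isPullback _ _ _ _ ?_ ?_
  · rw [Category.assoc]
    exact h
  · rw [preimage_chart hi, Scheme.Opens.opensRange_ι]

theorem isIso_toSpecΓ (φ : X ⟶ Y) [IsAffineHom φ] (U : Y.affineOpens) :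
    IsIso (φ ⁻¹ᵁ U.1).toSpecΓ := by
  rw [← (U.2.preimage φ).isoSpec_hom]
  infer_instance

/-- Closed immersions are local on the target. Over a chart, i is the isomorphism of an affine
scheme with the spectrum of its sections, followed by the spectrum of a surjection. -/
theorem isClosedImmersion_of_comorphism [IsAffineHom φ]
    (hi : i ≫ relAffineSpace.proj D.F D.locallyFree = φ)
    (h : ∀ U, ∃ π : symAlg D.F U.1 →+* Γ(X, φ ⁻¹ᵁ U.1),
      IsComorphism D φ i U π ∧ Function.Surjective π) : IsClosedImmersion i := by
  refine (IsZariskiLocalAtTarget.iff_of_openCover (P := @IsClosedImmersion)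
    (Y := relAffineSpace D.F D.locallyFree) (symGluingData D.locallyFree).cover).2 ?_
  intro U
  obtain ⟨π, hπ, hs⟩ := h U
  have := isIso_toSpecΓ φ U
  have h1 : IsClosedImmersion (Spec.map (CommRingCat.ofHom π)) :=
    IsClosedImmersion.spec_of_surjective _ hs
  have hp := (hπ.isPullback hi).flip
  change IsClosedImmersion (Limits.pullback.snd i (relAffineSpace.chart D.F D.locallyFree U))
  rw [← hp.isoPullback_inv_snd]
  infer_instance

/-- Ideal sheaves are compared on the charts, where the kernel of i corresponds to the kernel of the
ring homomorphism. -/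
theorem IsComorphism.ker_eq_of {X' : Scheme.{u}} {φ' : X' ⟶ Y} [IsAffineHom φ] [IsAffineHom φ']
    {i' : X' ⟶ relAffineSpace D.F D.locallyFree} [QuasiCompact i] [QuasiCompact i']
    (hi : i ≫ relAffineSpace.proj D.F D.locallyFree = φ)
    (hi' : i' ≫ relAffineSpace.proj D.F D.locallyFree = φ')
    (h : ∀ U, ∃ (π : symAlg D.F U.1 →+* Γ(X, φ ⁻¹ᵁ U.1)) (π' : symAlg D.F U.1 →+* Γ(X', φ' ⁻¹ᵁ U.1)),
      IsComorphism D φ i U π ∧ IsComorphism D φ' i' U π' ∧ RingHom.ker π = RingHom.ker π') :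
    i.ker = i'.ker := by
  have key : ∀ U : Y.affineOpens,
      i.ker.ideal ⟨(relAffineSpace.chart D.F D.locallyFree U) ''ᵁ ⊤,
        (isAffineOpen_top _).image_of_isOpenImmersion _⟩ =
      i'.ker.ideal ⟨(relAffineSpace.chart D.F D.locallyFree U) ''ᵁ ⊤,
        (isAffineOpen_top _).image_of_isOpenImmersion _⟩ := by
    intro U
    obtain ⟨π, π', hπ, hπ', hk⟩ := h U
    have := isIso_toSpecΓ φ U
    have := isIso_toSpecΓ φ' U
    have e := Scheme.ker_ideal_of_isPullback_of_isOpenImmersion _ _ _ _ (hπ.isPullback hi)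
      ⟨⊤, isAffineOpen_top _⟩
    have e' := Scheme.ker_ideal_of_isPullback_of_isOpenImmersion _ _ _ _ (hπ'.isPullback hi')
      ⟨⊤, isAffineOpen_top _⟩
    rw [Scheme.Hom.ker_comp_of_isIso] at e e'
    -- The isomorphism with the spectrum of sections does not affect the kernel, and the kernel of a
    -- morphism of spectra depends only on that of the ring map.
    have hs : (Spec.map (CommRingCat.ofHom π)).ker = (Spec.map (CommRingCat.ofHom π')).ker := by
      have hk' : ∀ {S : CommRingCat.{u}} (ρ : CommRingCat.of (symAlg D.F U.1) ⟶ S) (x),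
          (Spec.map ρ).appTop.hom x = 0 ↔ ρ.hom ((Scheme.ΓSpecIso _).hom.hom x) = 0 := by
        intro S ρ x
        have := congr($(Scheme.ΓSpecIso_naturality ρ) x)
        simp only [CommRingCat.comp_apply] at this
        rw [← this]
        exact (map_eq_zero_iff _ (ConcreteCategory.bijective_of_isIso (Scheme.ΓSpecIso S).hom).1).symm
      rw [Scheme.ker_of_isAffine, Scheme.ker_of_isAffine]
      congr 1
      ext x
      rw [RingHom.mem_ker, RingHom.mem_ker, hk', hk']
      exact SetLike.ext_iff.1 hk _
    rw [← hs, e] at e'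
    exact Ideal.comap_injective_of_surjective _
      (ConcreteCategory.bijective_of_isIso
        ((relAffineSpace.chart D.F D.locallyFree U).appIso ⊤).inv).2 e'
  refine Scheme.IdealSheafData.ext_of_iSup_eq_top _ ?_ key
  simp only [Scheme.Hom.image_top_eq_opensRange, ← relAffineSpace.proj_preimage]
  rw [← Scheme.Hom.preimage_iSup, iSup_affineOpens_eq_top]
  rfl

end Comorphism

end AlgCover

namespace AlgCover

variable {Y : Scheme.{u}}

/-! ### The embedding defined by a presentation, and its dependence on the ideal -/

section Embedding

variable {X : Scheme.{u}} {φ : X ⟶ Y} {D : CoverDatum Y} {Φ : D.QHom}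

theorem exists_ringHom_of_presents {θ : D.ModIso (pushO φ)}
    (h : Presents D θ Φ (AlgStr.canonical φ)) (U : Y.affineOpens) :
    ∃ ρ : symAlg D.F U.1 →+* Γ(X, φ ⁻¹ᵁ U.1),
      (∀ a, ρ (algebraMap _ _ a) = φ.app U.1 a) ∧ RingHom.ker ρ = Φ.ideal U ∧
        ∀ c : D.quotient U, ρ (D.σ U c) = θ.app U c := by
  obtain ⟨π, h1, hmul, hker, hσ⟩ := h U
  let ρ : symAlg D.F U.1 →+* Γ(X, φ ⁻¹ᵁ U.1) :=
    { toFun := π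
      map_one' := h1
      map_mul' := hmul
      map_zero' := π.map_zero
      map_add' := π.map_add }
  refine ⟨ρ, fun a => ?_, Ideal.ext hker, hσ⟩
  have : π (algebraMap _ _ a) = a • π 1 := by
    rw [Algebra.algebraMap_eq_smul_one, map_smul]
  rw [h1] at this
  exact this.trans (mul_one (φ.app U.1 a))

/-- The image of σ contains O and F, which generate R(F). This is also why the condition on σ pins
down the embedding. -/
theorem ringHom_eq_of_comp_σ {U : Y.affineOpens} {T : Type*} [CommRing T]
    {ρ ρ' : symAlg D.F U.1 →+* T} (h : ∀ c : D.quotient U, ρ (D.σ U c) = ρ' (D.σ U c)) :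
    ρ = ρ' := by
  apply symAlg_ringHom_ext
  · intro a
    rw [← D.σ_proj_algebraMap, h]
  · intro v
    rw [← D.σ_proj_ι, h]

/-- The surjections π commute with restriction because they do so on the image of σ, where they are
given by θ; so the morphisms to the charts glue. -/
theorem existsUnique_isEmbeddingOf [IsAffineHom φ] {θ : D.ModIso (pushO φ)}
    (h : Presents D θ Φ (AlgStr.canonical φ)) :
    ∃! i : X ⟶ relAffineSpace D.F D.locallyFree, IsEmbeddingOf D Φ φ i ∧
      ∀ U : Y.affineOpens, ∃ π : symAlg D.F U.1 →+* Γ(X, φ ⁻¹ᵁ U.1),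
        IsComorphism D φ i U π ∧ ∀ c : D.quotient U, π (D.σ U c) = θ.app U c := by
  choose ρ hρ hker hσ using exists_ringHom_of_presents h
  have hres : ∀ (U V : Y.affineOpens) (h : V.1 ≤ U.1),
      (ρ V).comp (symRes D.F h) =
        (X.presheaf.map (homOfLE (φ.preimage_mono h)).op).hom.comp (ρ U) := by
    intro U V h
    refine ringHom_eq_of_comp_σ fun c => ?_
    rw [RingHom.comp_apply, RingHom.comp_apply, ← D.σ_resQuot, hσ, hσ, θ.res]
    rfl
  obtain ⟨i, hi⟩ := exists_glue_preimage φ (fun U => (φ ⁻¹ᵁ U.1).toSpecΓ ≫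
    Spec.map (CommRingCat.ofHom (ρ U)) ≫ relAffineSpace.chart D.F D.locallyFree U) (by
      intro U V hUV
      rw [← Scheme.Opens.toSpecΓ_SpecMap_presheaf_map_assoc, ← Spec.map_comp_assoc]
      have := hres U V (Scheme.AffineZariskiSite.toOpens_mono hUV)
      rw [← relAffineSpace.symRes_chart D.locallyFree hUV, ← Spec.map_comp_assoc]
      congr 3
      exact CommRingCat.hom_ext this.symm)
  have hfac : i ≫ relAffineSpace.proj D.F D.locallyFree = φ := by
    refine hom_ext_preimage φ fun U => ?_
    rw [reassoc_of% hi U, relAffineSpace.chart_proj, ← Spec.map_comp_assoc, ← morphismRestrict_ι,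
      ← U.2.toSpecΓ_fromSpec, ← Scheme.Opens.toSpecΓ_naturality_assoc]
    congr 3
    ext a
    exact hρ U a
  have hsurj : ∀ U, Function.Surjective (ρ U) := by
    intro U x
    obtain ⟨c, hc⟩ := (θ.app U).surjective x
    exact ⟨D.σ U c, (hσ U c).trans hc⟩
  refine ⟨i, ⟨⟨?_, hfac, fun U => ⟨ρ U, hi U, hker U⟩⟩, fun U => ⟨ρ U, hi U, hσ U⟩⟩, ?_⟩
  · exact isClosedImmersion_of_comorphism hfac fun U => ⟨ρ U, hi U, hsurj U⟩
  · rintro j ⟨-, hj⟩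
    refine hom_ext_preimage φ fun U => ?_
    obtain ⟨π, hπ, hπσ⟩ := hj U
    have : π = ρ U := ringHom_eq_of_comp_σ fun c => (hπσ c).trans (hσ U c).symm
    rw [hi U, ← this]
    exact hπ

/-- Closed immersions with the same ideal sheaf factor through each other. -/
theorem exists_iso_of_isEmbeddingOf {X₁ X₂ : Scheme.{u}} {φ₁ : X₁ ⟶ Y} {φ₂ : X₂ ⟶ Y}
    [IsAffineHom φ₁] [IsAffineHom φ₂] {i₁ : X₁ ⟶ relAffineSpace D.F D.locallyFree}
    {i₂ : X₂ ⟶ relAffineSpace D.F D.locallyFree} (h₁ : IsEmbeddingOf D Φ φ₁ i₁)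
    (h₂ : IsEmbeddingOf D Φ φ₂ i₂) : ∃ e : X₁ ≅ X₂, e.hom ≫ i₂ = i₁ := by
  have := h₁.closed
  have := h₂.closed
  have hk : i₂.ker = i₁.ker := by
    refine IsComorphism.ker_eq_of h₂.fac h₁.fac fun U => ?_
    obtain ⟨π, hπ, hk⟩ := h₁.comorphism U
    obtain ⟨π', hπ', hk'⟩ := h₂.comorphism U
    exact ⟨π', π, hπ', hπ, hk'.trans hk.symm⟩
  have := IsClosedImmersion.isIso_lift i₂ i₁ hk
  exact ⟨asIso (IsClosedImmersion.lift i₂ i₁ hk.le), IsClosedImmersion.lift_fac i₂ i₁ hk.le⟩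

end Embedding

end AlgCover

namespace AlgCover

variable {Y : Scheme.{u}}

/-! ### Constant and linear terms -/

section Terms

variable (F : Y.Modules) (U : Y.Opens)

/-- The constant term of a polynomial. -/
noncomputable def symConst : symAlg F U →ₗ[Γ(Y, U)] Γ(Y, U) :=
  (SymmetricAlgebra.algebraMapInv (M := Γ(F, U))).toLinearMap

/-- The linear term of a polynomial. -/
noncomputable def symLin : symAlg F U →ₗ[Γ(Y, U)] Γ(F, U) :=
  (LinearEquiv.ofInjective (symι F U) symι_injective).symm.toLinearMap ∘ₗ
    (symComp F U 1).codRestrict (LinearMap.range (symι F U)) fun x => by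
      rw [← symDeg_one]
      exact symComp_mem 1 x

variable {F U}

theorem ι_symLin (x : symAlg F U) : symι F U (symLin F U x) = symComp F U 1 x := by
  have := LinearEquiv.apply_symm_apply (LinearEquiv.ofInjective (symι F U) symι_injective)
    ((symComp F U 1).codRestrict (LinearMap.range (symι F U)) (fun x => by
      rw [← symDeg_one]
      exact symComp_mem 1 x) x)
  exact congr_arg Subtype.val this

theorem algebraMap_injective : Function.Injective (algebraMap Γ(Y, U) (symAlg F U)) :=
  (SymmetricAlgebra.algebraMap_leftInverse Γ(F, U)).injective

/-- The coefficient of t⁰ after dilation is a ring homomorphism, so comparison on constants and on F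
is enough. -/
theorem algebraMap_symConst (x : symAlg F U) :
    algebraMap _ _ (symConst F U x) = symComp F U 0 x := by
  have : (Algebra.ofId Γ(Y, U) (symAlg F U)).comp
      (SymmetricAlgebra.algebraMapInv (M := Γ(F, U))) =
      (Polynomial.constantCoeff.comp (dilate F U).toRingHom : symAlg F U →+* symAlg F U) := by
    apply symAlg_ringHom_ext
    · intro a
      change algebraMap _ _ (SymmetricAlgebra.algebraMapInv (algebraMap _ (symAlg F U) a)) =
        (dilate F U (algebraMap _ _ a)).coeff 0
      rw [SymmetricAlgebra.algebraMap_leftInverse, dilate_algebraMap, Polynomial.coeff_C_zero]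
    · intro v
      change algebraMap _ _ (SymmetricAlgebra.algebraMapInv (symι F U v)) =
        (dilate F U (symι F U v)).coeff 0
      rw [SymmetricAlgebra.algebraMapInv_ι, dilate_ι, map_zero,
        Polynomial.coeff_monomial_of_ne _ zero_ne_one]
  exact congr($this x)

theorem eq_const_add_lin {x : symAlg F U} (hx : x ∈ symLT F U 2) :
    x = algebraMap _ _ (symConst F U x) + symι F U (symLin F U x) := by
  rw [algebraMap_symConst, ι_symLin]
  exact symComp_zero_mem_of_mem_two hx

@[simp] theorem symConst_algebraMap (a : Γ(Y, U)) : symConst F U (algebraMap _ _ a) = a :=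
  SymmetricAlgebra.algebraMap_leftInverse _ a

@[simp] theorem symConst_ι (v : Γ(F, U)) : symConst F U (symι F U v) = 0 :=
  SymmetricAlgebra.algebraMapInv_ι v

@[simp] theorem symLin_algebraMap (a : Γ(Y, U)) : symLin F U (algebraMap _ _ a) = 0 := by
  apply symι_injective
  rw [ι_symLin, symComp_of_ne (algebraMap_mem_symDeg_zero a) zero_ne_one, map_zero]

@[simp] theorem symLin_ι (v : Γ(F, U)) : symLin F U (symι F U v) = v := by
  apply symι_injective
  rw [ι_symLin, symComp_self (ι_mem_symDeg_one v)]

theorem symLin_symRes {V : Y.Opens} (h : V ≤ U) (x : symAlg F U) :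
    symLin F V (symRes F h x) = secRes F h (symLin F U x) := by
  apply symι_injective
  rw [ι_symLin, symComp_symRes, ← ι_symLin, symRes_ι]

theorem symConst_symRes {V : Y.Opens} (h : V ≤ U) (x : symAlg F U) :
    symConst F V (symRes F h x) = ringRes Y h (symConst F U x) := by
  apply algebraMap_injective (F := F)
  rw [algebraMap_symConst, symComp_symRes, ← algebraMap_symConst, symRes_algebraMap]

end Terms

/-! ### Localization on basic open sets -/

section Localization

/-- Denominators are cleared for constants and for sections of F, and the property passes to sums
and products. -/
theorem IsLocallyFreeOfRank.exists_symRes_eq {F : Y.Modules} {r : ℕ}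
    (hF : IsLocallyFreeOfRank F r) {U V : Y.Opens} (hU : IsAffineOpen U) (h : V ≤ U)
    {f : Γ(Y, U)} (hV : V = Y.basicOpen f) (x : symAlg F V) :
    ∃ (n : ℕ) (y : symAlg F U), symRes F h y = ringRes Y h f ^ n • x := by
  induction x using SymmetricAlgebra.induction with
  | algebraMap a =>
    subst hV
    have hloc : IsLocalization.Away f Γ(Y, Y.basicOpen f) := hU.isLocalization_basicOpen f
    obtain ⟨n, b, hb⟩ := IsLocalization.Away.surj f a
    refine ⟨n, algebraMap _ _ b, ?_⟩
    rw [symRes_algebraMap, Algebra.smul_def, ← map_mul]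
    congr 1
    exact (mul_comm _ _).trans hb |>.symm
  | ι v =>
    obtain ⟨n, t, ht⟩ := ((hF.localizes hU) f V h hV).2 v
    exact ⟨n, symι F U t, by rw [symRes_ι, ht, map_smul]⟩
  | mul x y hx hy =>
    obtain ⟨n, x', hx⟩ := hx
    obtain ⟨m, y', hy⟩ := hy
    exact ⟨n + m, x' * y', by rw [map_mul, hx, hy, pow_add, smul_mul_smul_comm]⟩
  | add x y hx hy =>
    obtain ⟨n, x', hx⟩ := hx
    obtain ⟨m, y', hy⟩ := hy
    refine ⟨n + m, f ^ m • x' + f ^ n • y', ?_⟩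
    rw [map_add, symRes_smul, symRes_smul, hx, hy, smul_add, pow_add, mul_comm, mul_smul, map_pow,
      map_pow, mul_comm, mul_smul]

theorem isUnit_ringRes {U V : Y.Opens} (hU : IsAffineOpen U) (h : V ≤ U) {f : Γ(Y, U)}
    (hV : V = Y.basicOpen f) : IsUnit (ringRes Y h f) := by
  subst hV
  have hloc : IsLocalization.Away f Γ(Y, Y.basicOpen f) := hU.isLocalization_basicOpen f
  exact IsLocalization.Away.algebraMap_isUnit f

/-- A section of Q over D(f) is first extended as a section of R(F), after multiplication by a power
of f, and then projected to Q. The projector commutes with restriction; this is where Q being a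
direct summand is used. -/
theorem CoverDatum.exists_resQ_eq (D : CoverDatum Y) {U V : Y.affineOpens} (h : V.1 ≤ U.1)
    {f : Γ(Y, U.1)} (hV : V.1 = Y.basicOpen f) (q : D.Q V) :
    ∃ (n : ℕ) (q' : D.Q U), D.resQ h q' = ringRes Y h f ^ n • q := by
  obtain ⟨e, he, he', hres⟩ := D.Q_summand
  obtain ⟨n, x, hx⟩ := D.locallyFree.exists_symRes_eq U.2 h hV (q : symAlg D.F V.1)
  refine ⟨n, ⟨e U x, he U x⟩, Subtype.ext ?_⟩
  change symRes D.F h (e U x) = ringRes Y h f ^ n • (q : symAlg D.F V.1)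
  rw [← hres, hx, map_smul, he' V _ q.2]

theorem CoverDatum.QHom.app_eq_of_basicOpen {D : CoverDatum Y} {Φ Φ' : D.QHom}
    {U V : Y.affineOpens} (h : V.1 ≤ U.1) {f : Γ(Y, U.1)} (hV : V.1 = Y.basicOpen f)
    (hU : Φ.app U = Φ'.app U) : Φ.app V = Φ'.app V := by
  refine LinearMap.ext fun q => ?_
  obtain ⟨n, q', hq'⟩ := D.exists_resQ_eq h hV q
  have h1 : ringRes Y h f ^ n • Φ.app V q = ringRes Y h f ^ n • Φ'.app V q := by
    rw [← map_smul, ← map_smul, ← hq', Φ.res, Φ'.res, hU]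
  exact ((isUnit_ringRes U.2 h hV).pow n).smul_left_cancel.1 h1

theorem ringRes_eq_of_locally {W : Y.Opens} {a b : Γ(Y, W)}
    (h : ∀ y ∈ W, ∃ (V : Y.Opens) (hV : V ≤ W), y ∈ V ∧ ringRes Y hV a = ringRes Y hV b) :
    a = b := by
  choose! V hV hy he using h
  refine TopCat.Sheaf.eq_of_locally_eq' Y.sheaf (fun y : W => V y.1) W
    (fun y => homOfLE (hV y.1 y.2)) (fun y hyW => Opens.mem_iSup.2 ⟨⟨y, hyW⟩, hy y hyW⟩) a b
    fun y => he y.1 y.2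

end Localization

end AlgCover

namespace AlgCover

variable {Y : Scheme.{u}}

/-! ### Quadratic cover data -/

namespace CoverDatum

variable {D : CoverDatum Y} {U : Y.affineOpens}

/-- The section σ recovers the polynomial from its class in degrees 0 and 1, so constant and linear
terms are well defined modulo ⟨Q⟩. -/
theorem proj_algebraMap_add_ι_inj {a b : Γ(Y, U.1)} {v w : Γ(D.F, U.1)}
    (h : D.proj U (algebraMap _ _ a + symι D.F U.1 v) =
      D.proj U (algebraMap _ _ b + symι D.F U.1 w)) : a = b ∧ v = w := by
  have h1 := congr_arg (D.σ U) h
  simp only [map_add, D.σ_proj_algebraMap, D.σ_proj_ι] at h1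
  have h2 := congr_arg (symConst D.F U.1) h1
  have h3 := congr_arg (symLin D.F U.1) h1
  simpa using And.intro h2 h3

/-- Elements of ⟨Q⟩ have no terms of degree less than 2, so in degree 2 a product contributes only a
constant times a quadric of Q. -/
theorem symComp_two_mem {x : symAlg D.F U.1} (hx : x ∈ idealOf (D.Q U)) :
    symComp D.F U.1 2 x ∈ D.Q U := by
  induction hx using Submodule.span_induction with
  | mem x h => exact D.symComp_mem_Q h 2
  | zero => rw [map_zero]; exact zero_mem _
  | add x y _ _ hx hy => rw [map_add]; exact add_mem hx hy
  | smul a x hxI hx =>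
    rw [smul_eq_mul, symComp_mul]
    refine Submodule.sum_mem _ fun p hp => ?_
    have := Finset.HasAntidiagonal.mem_antidiagonal.1 hp
    rcases Nat.lt_or_ge p.2 2 with h | h
    · rw [D.symComp_idealOf_eq_zero hxI h, mul_zero]
      exact zero_mem _
    · rw [show p.2 = 2 by omega, show p.1 = 0 by omega]
      obtain ⟨b, hb⟩ := mem_symDeg_zero.1 (symComp_mem 0 a)
      rw [← hb, ← Algebra.smul_def]
      exact Submodule.smul_mem _ _ hx

variable {Φ Φ' : D.QHom} {ψ : D.QLinHom}

theorem QHom.IsCoverHom.σ_mem_symLT_two (hΦ : Φ.IsCoverHom) (hD : D.IsQuadratic) (q : D.Q U) :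
    D.σ U (Φ.app U q) ∈ symLT D.F U.1 2 :=
  (hΦ.lowers' U).σ_mem (hD U q.2)

/-- The component in `Hom(Q, F)` of a homomorphism from `Q` to `R(F)/⟨Q⟩`. -/
noncomputable def QHom.linearPart (Φ : D.QHom) : D.QLinHom where
  app U := symLin D.F U.1 ∘ₗ D.σ U ∘ₗ Φ.app U
  res U V h q := by
    simp only [LinearMap.comp_apply]
    rw [Φ.res, σ_resQuot, symLin_symRes]

theorem QHom.IsCoverHom.hasLinearPart (hΦ : Φ.IsCoverHom) (hD : D.IsQuadratic) :
    Φ.HasLinearPart Φ.linearPart := by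
  intro U q
  refine ⟨symConst D.F U.1 (D.σ U (Φ.app U q)), ?_⟩
  refine (D.σ_section U (Φ.app U q)).symm.trans (congr_arg (D.proj U) ?_)
  exact eq_const_add_lin (hΦ.σ_mem_symLT_two hD q)

theorem QHom.HasLinearPart.unique {ψ' : D.QLinHom} (h : Φ.HasLinearPart ψ)
    (h' : Φ.HasLinearPart ψ') : ψ = ψ' := by
  apply QLinHom.ext
  funext U
  refine LinearMap.ext fun q => ?_
  obtain ⟨a, ha⟩ := h U q
  obtain ⟨b, hb⟩ := h' U q
  exact (proj_algebraMap_add_ι_inj (ha.symm.trans hb)).2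

/-- The component in `Hom(Q, O)` of a homomorphism from `Q` to `R(F)/⟨Q⟩`. -/
noncomputable def QHom.constPart (Φ : D.QHom) (U : Y.affineOpens) : D.Q U →ₗ[Γ(Y, U.1)] Γ(Y, U.1) :=
  symConst D.F U.1 ∘ₗ D.σ U ∘ₗ Φ.app U

theorem QHom.HasLinearPart.σ_app (h : Φ.HasLinearPart ψ) (q : D.Q U) :
    D.σ U (Φ.app U q) = algebraMap _ _ (Φ.constPart U q) + symι D.F U.1 (ψ.app U q) := by
  obtain ⟨a, ha⟩ := h U q
  have h1 : D.σ U (Φ.app U q) = algebraMap _ _ a + symι D.F U.1 (ψ.app U q) := by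
    rw [ha, map_add, map_add, D.σ_proj_algebraMap, D.σ_proj_ι]
  rw [constPart, LinearMap.comp_apply, LinearMap.comp_apply, h1, map_add, symConst_algebraMap,
    symConst_ι, add_zero]

theorem QHom.HasLinearPart.app_eq (h : Φ.HasLinearPart ψ) (q : D.Q U) :
    Φ.app U q = D.proj U (algebraMap _ _ (Φ.constPart U q) + symι D.F U.1 (ψ.app U q)) := by
  rw [← h.σ_app]
  exact (D.σ_section U _).symm

/-- On a linear syzygy, the constant terms of a cover homomorphism are given by its linear
terms. -/
theorem QHom.HasLinearPart.sum_constPart (h : Φ.HasLinearPart ψ) (hΦ : Φ.IsCoverHom)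
    {ι : Type*} {s : Finset ι} {l : ι → symAlg D.F U.1} {q : ι → D.Q U}
    (hl : ∀ i ∈ s, l i ∈ symDeg D.F U.1 1) (hq : ∑ i ∈ s, l i * (q i : symAlg D.F U.1) = 0) :
    ∃ hz : ∑ i ∈ s, l i * symι D.F U.1 (ψ.app U (q i)) ∈ D.Q U,
      ∑ i ∈ s, l i * algebraMap _ _ (Φ.constPart U (q i)) =
        -symι D.F U.1 (ψ.app U ⟨_, hz⟩) := by
  set z := ∑ i ∈ s, l i * symι D.F U.1 (ψ.app U (q i)) with hz_def
  set y := ∑ i ∈ s, l i * algebraMap _ _ (Φ.constPart U (q i)) with hy_def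
  have hz2 : z ∈ symDeg D.F U.1 2 :=
    Submodule.sum_mem _ fun i hi => mul_mem_symDeg (hl i hi) (ι_mem_symDeg_one _)
  have hy1 : y ∈ symDeg D.F U.1 1 :=
    Submodule.sum_mem _ fun i hi => mul_mem_symDeg (hl i hi) (algebraMap_mem_symDeg_zero _)
  have h1 : ∑ i ∈ s, l i * Φ.deform U (q i) = -y - z := by
    rw [hz_def, hy_def]
    simp only [deform, h.σ_app, mul_sub, mul_add, Finset.sum_sub_distrib, Finset.sum_add_distrib,
      hq]
    ring
  have h2 : -y - z ∈ Φ.ideal U := by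
    rw [← h1]
    exact Ideal.sum_mem _ fun i _ => Ideal.mul_mem_left _ _ (Φ.deform_mem _)
  -- The leading form −z lies in ⟨Q⟩, hence in Q by degree, so that Φ can be applied to z.
  have h3 := hΦ.leading_form_mem h2 (n := 2) (sub_mem (neg_mem (symDeg_le_symLT (by norm_num) hy1))
    (symDeg_le_symLT (by norm_num) hz2))
  rw [map_sub, map_neg, symComp_of_ne hy1 (by norm_num), symComp_self hz2, neg_zero, zero_sub] at h3
  have hz : z ∈ D.Q U := by
    have := neg_mem (D.symComp_two_mem h3)
    rwa [map_neg, neg_neg, symComp_self hz2] at this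
  refine ⟨hz, ?_⟩
  -- Adding the generator for z eliminates the quadric. The linear form left over is a leading form
  -- in ⟨Q⟩ of degree 1, hence zero.
  have h4 := add_mem h2 (Φ.deform_mem ⟨z, hz⟩)
  rw [deform, h.σ_app] at h4
  have h5 : -y - z + (z - (algebraMap _ _ (Φ.constPart U ⟨z, hz⟩) +
      symι D.F U.1 (ψ.app U ⟨z, hz⟩))) = -(y + symι D.F U.1 (ψ.app U ⟨z, hz⟩)) -
        algebraMap _ _ (Φ.constPart U ⟨z, hz⟩) := by
    ring
  rw [h5] at h4
  have h6 : y + symι D.F U.1 (ψ.app U ⟨z, hz⟩) ∈ symDeg D.F U.1 1 :=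
    add_mem hy1 (ι_mem_symDeg_one _)
  have h7 := hΦ.leading_form_mem h4 (n := 1) (sub_mem (neg_mem (symDeg_le_symLT (by norm_num) h6))
    (symDeg_le_symLT (by norm_num) (algebraMap_mem_symDeg_zero _)))
  rw [map_sub, map_neg, symComp_self h6, symComp_of_ne (algebraMap_mem_symDeg_zero _) zero_ne_one,
    sub_zero] at h7
  have h8 := D.symComp_idealOf_eq_zero h7 Nat.one_lt_two
  rw [map_neg, symComp_self h6, neg_eq_zero] at h8
  exact eq_neg_of_add_eq_zero_left h8

/-- Over an affine open set where the linear syzygies generate all syzygies, the constant terms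
of cover homomorphisms with the same linear terms differ by a homomorphism that vanishes on
all syzygies. -/
theorem QHom.HasLinearPart.sum_syzygy (h : Φ.HasLinearPart ψ) (h' : Φ'.HasLinearPart ψ)
    (hΦ : Φ.IsCoverHom) (hΦ' : Φ'.IsCoverHom) {m : ℕ} (q : Fin m → D.Q U)
    {l : Fin m → symAlg D.F U.1}
    (hl : l ∈ Submodule.span (symAlg D.F U.1) {l : Fin m → symAlg D.F U.1 |
          (∀ i, l i ∈ symDeg D.F U.1 1) ∧ ∑ i, l i * (q i : symAlg D.F U.1) = 0}) :
    ∑ i, l i * algebraMap _ _ (Φ.constPart U (q i) - Φ'.constPart U (q i)) = 0 := by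
  induction hl using Submodule.span_induction with
  | mem l hl =>
    obtain ⟨hz, e⟩ := h.sum_constPart hΦ (s := Finset.univ) (fun i _ => hl.1 i) hl.2
    obtain ⟨hz', e'⟩ := h'.sum_constPart hΦ' (s := Finset.univ) (fun i _ => hl.1 i) hl.2
    simp only [map_sub, mul_sub, Finset.sum_sub_distrib]
    rw [e, e', sub_self]
  | zero => simp
  | add x y _ _ hx hy =>
    simp only [Pi.add_apply, add_mul, Finset.sum_add_distrib]
    rw [hx, hy, add_zero]
  | smul a x _ hx =>
    simp only [Pi.smul_apply, smul_eq_mul, mul_assoc]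
    rw [← Finset.mul_sum, hx, mul_zero]

/-- With a and b the differences of the constants at qᵢ and qⱼ, the Koszul syzygy gives a·qⱼ = b·qᵢ,
and linear independence gives a = 0. -/
theorem QHom.HasLinearPart.constPart_eq (h : Φ.HasLinearPart ψ) (h' : Φ'.HasLinearPart ψ)
    (hΦ : Φ.IsCoverHom) (hΦ' : Φ'.IsCoverHom) {m : ℕ}
    (q : Module.Basis (Fin m) Γ(Y, U.1) (D.Q U))
    (hq : ∀ l : Fin m → symAlg D.F U.1, ∑ i, l i * (q i : symAlg D.F U.1) = 0 →
        l ∈ Submodule.span (symAlg D.F U.1) {l : Fin m → symAlg D.F U.1 |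
          (∀ i, l i ∈ symDeg D.F U.1 1) ∧ ∑ i, l i * (q i : symAlg D.F U.1) = 0})
    {i j : Fin m} (hij : i ≠ j) : Φ.constPart U (q i) = Φ'.constPart U (q i) := by
  have h1 := h.sum_syzygy h' hΦ hΦ' q (hq (Pi.single i (q j : symAlg D.F U.1) -
    Pi.single j (q i : symAlg D.F U.1)) (by
      simp only [Pi.sub_apply, sub_mul, Finset.sum_sub_distrib, Pi.single_apply, ite_mul, zero_mul,
        Finset.sum_ite_eq', Finset.mem_univ, if_true]
      ring))
  simp only [Pi.sub_apply, sub_mul, Finset.sum_sub_distrib, Pi.single_apply, ite_mul, zero_mul,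
    Finset.sum_ite_eq', Finset.mem_univ, if_true] at h1
  set a := Φ.constPart U (q i) - Φ'.constPart U (q i) with ha
  set b := Φ.constPart U (q j) - Φ'.constPart U (q j)
  have h2 : a • q j - b • q i = 0 := by
    apply Subtype.ext
    rw [mul_comm, ← Algebra.smul_def, mul_comm, ← Algebra.smul_def] at h1
    exact h1
  have h3 := congr_arg (fun x => q.repr x j) h2
  simp only [map_sub, map_smul, Module.Basis.repr_self, map_zero, Finsupp.sub_apply, Finsupp.smul_apply,
    Finsupp.single_eq_same, Finsupp.single_eq_of_ne hij.symm, Finsupp.coe_zero, Pi.zero_apply, smul_eq_mul, mul_one,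
    mul_zero, sub_zero] at h3
  exact sub_eq_zero.1 h3

end CoverDatum

end AlgCover

namespace AlgCover

variable {Y : Scheme.{u}}

/-! ### Principal ideals of quadrics -/

/-- A polynomial in two variables over a field that divides a monic polynomial in each of the
variables is a nonzero constant. -/
theorem exists_eq_C_of_dvd {K : Type*} [Field K] {p : Polynomial (Polynomial K)}
    {a b : Polynomial K} (ha : a.Monic) (hb : b.Monic) (h₁ : p ∣ Polynomial.C a)
    (h₂ : p ∣ b.map Polynomial.C) : ∃ c : K, c ≠ 0 ∧ p = Polynomial.C (Polynomial.C c) := by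
  have hC : Polynomial.C a ≠ 0 := Polynomial.C_ne_zero.2 ha.ne_zero
  have hdeg : p.natDegree = 0 := by
    have := Polynomial.natDegree_le_of_dvd h₁ hC
    rwa [Polynomial.natDegree_C, Nat.le_zero] at this
  obtain ⟨r, rfl⟩ := Polynomial.natDegree_eq_zero.1 hdeg
  have h3 : r ∣ 1 := by
    have := Polynomial.C_dvd_iff_dvd_coeff _ _ |>.1 h₂ b.natDegree
    rwa [Polynomial.coeff_map, hb.coeff_natDegree, map_one] at this
  obtain ⟨c, hc, rfl⟩ := Polynomial.isUnit_iff.1 (isUnit_of_dvd_one h3)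
  exact ⟨c, hc.ne_zero, rfl⟩

/-- If `R(F)/⟨q⟩` is a finite module for a quadric `q`, the fibres of `F` have dimension at
most one. -/
theorem false_of_finite_principal {F : Y.Modules} {U : Y.Opens} {q : symAlg F U}
    (hq : q ∈ symDeg F U 2) (hfin : Module.Finite Γ(Y, U) (symAlg F U ⧸ Ideal.span {q}))
    {K : Type*} [Field K] [Algebra Γ(Y, U) K] (f g : Γ(F, U) →ₗ[Γ(Y, U)] K) (v w : Γ(F, U))
    (hfv : f v = 1) (hfw : f w = 0) (hgv : g v = 0) (hgw : g w = 1) : False := by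
  -- The two functionals define a map from R(F) to the polynomial ring in x and y over K by u ↦
  -- f(u)x + g(u)y; it sends v to x and w to y.
  let χ₀ : Γ(F, U) →ₗ[Γ(Y, U)] Polynomial (Polynomial K) :=
    ((Algebra.linearMap (Polynomial K) (Polynomial (Polynomial K))).restrictScalars Γ(Y, U) ∘ₗ
      (Polynomial.monomial 1 : K →ₗ[K] Polynomial K).restrictScalars Γ(Y, U) ∘ₗ f) +
    ((Polynomial.monomial 1 : Polynomial K →ₗ[Polynomial K] _).restrictScalars Γ(Y, U) ∘ₗ
      (Algebra.linearMap K (Polynomial K)).restrictScalars Γ(Y, U) ∘ₗ g)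
  obtain ⟨χ, hχ⟩ := exists_symLift χ₀
  have hχ₀ : ∀ x, χ₀ x = Polynomial.C (Polynomial.monomial 1 (f x)) +
    Polynomial.monomial 1 (Polynomial.C (g x)) := fun x => rfl
  have hv : χ (symι F U v) = Polynomial.C Polynomial.X := by
    rw [hχ, hχ₀, hfv, hgv, map_zero, map_zero, add_zero, Polynomial.monomial_one_one_eq_X]
  have hw : χ (symι F U w) = Polynomial.X := by
    rw [hχ, hχ₀, hfw, hgw, map_zero, map_zero, zero_add, map_one, Polynomial.monomial_one_one_eq_X]
  -- Finiteness of R(F)/⟨q⟩ makes every element integral, so q divides a monic polynomial in it.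
  have hint : ∀ x : symAlg F U, ∃ p : Polynomial Γ(Y, U), p.Monic ∧
      χ q ∣ p.aeval (χ x) := by
    intro x
    obtain ⟨p, hp, hpx⟩ := Algebra.IsIntegral.isIntegral (R := Γ(Y, U))
      (Ideal.Quotient.mk (Ideal.span {q}) x)
    refine ⟨p, hp, ?_⟩
    have h1 : Ideal.Quotient.mkₐ Γ(Y, U) (Ideal.span {q}) (p.aeval x) = 0 := by
      rw [← Polynomial.aeval_algHom_apply]
      exact hpx
    have h2 : p.aeval x ∈ Ideal.span {q} := Ideal.Quotient.eq_zero_iff_mem.1 h1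
    rw [Polynomial.aeval_algHom_apply]
    exact map_dvd χ (Ideal.mem_span_singleton.1 h2)
  obtain ⟨a, ha, hav⟩ := hint (symι F U v)
  obtain ⟨b, hb, hbw⟩ := hint (symι F U w)
  have ea : a.aeval (χ (symι F U v)) = Polynomial.C (a.map (algebraMap Γ(Y, U) K)) := by
    rw [hv]
    have : Polynomial.C (R := Polynomial K) Polynomial.X =
      algebraMap (Polynomial K) (Polynomial (Polynomial K)) Polynomial.X := rfl
    rw [this, Polynomial.aeval_algebraMap_apply, ← Polynomial.aeval_map_algebraMap K,
      Polynomial.aeval_X_left_apply]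
    rfl
  have eb : b.aeval (χ (symι F U w)) = (b.map (algebraMap Γ(Y, U) K)).map Polynomial.C := by
    rw [hw, ← Polynomial.aeval_map_algebraMap (Polynomial K), Polynomial.aeval_X_left_apply,
      Polynomial.map_map]
    rfl
  rw [ea] at hav
  rw [eb] at hbw
  obtain ⟨c, hc, e⟩ := exists_eq_C_of_dvd (ha.map _) (hb.map _) hav hbw
  -- Evaluation at the origin kills the image of the quadric q, which therefore cannot be a nonzero
  -- constant.
  let ε : Polynomial (Polynomial K) →ₐ[Γ(Y, U)] K :=
    ((Polynomial.aeval (0 : K)).restrictScalars Γ(Y, U)).comp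
      ((Polynomial.aeval (0 : Polynomial K)).restrictScalars Γ(Y, U))
  have hε : ∀ x ∈ symDeg F U 1, ε (χ x) = 0 := by
    intro x hx
    obtain ⟨y, rfl⟩ := mem_symDeg_one.1 hx
    rw [hχ, hχ₀]
    simp [ε]
  have h0 : ε (χ q) = 0 := by
    have hq' : q ∈ symDeg F U 1 * symDeg F U 1 := by
      rw [symDeg, ← pow_add]
      exact hq
    refine Submodule.mul_induction_on hq' (fun x hx y hy => ?_) (fun x y hx hy => ?_)
    · rw [map_mul, map_mul, hε x hx, zero_mul]
    · rw [map_add, map_add, hx, hy, add_zero]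
  rw [e] at h0
  apply hc
  simpa [ε] using h0

/-- At each point of an affine open set, a locally free sheaf of rank at least two has two
sections with linearly independent values. -/
theorem IsLocallyFreeOfRank.exists_dual {F : Y.Modules} {r : ℕ} (hF : IsLocallyFreeOfRank F r)
    (hr : 2 ≤ r) {U : Y.Opens} (hU : IsAffineOpen U) {y : Y} (hy : y ∈ U) :
    ∃ (_ : Algebra Γ(Y, U) (Y.residueField y)) (f g : Γ(F, U) →ₗ[Γ(Y, U)] Y.residueField y)
      (v w : Γ(F, U)), f v = 1 ∧ f w = 0 ∧ g v = 0 ∧ g w = 1 := by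
  obtain ⟨W, hyW, b, hb⟩ := hF y
  obtain ⟨s, hsW, hys⟩ := hU.exists_basicOpen_le ⟨y, hyW⟩ hy
  set V := Y.basicOpen s with hV
  have hVU : V ≤ U := Y.basicOpen_le s
  have : Algebra Γ(Y, V) (Y.residueField y) := (Y.evaluation V y hys).hom.toAlgebra
  let _ : Algebra Γ(Y, U) (Y.residueField y) :=
    ((algebraMap Γ(Y, V) (Y.residueField y)).comp (ringRes Y hVU)).toAlgebra
  have hbij := hb V hsW
  let e : (Fin r → Γ(Y, V)) ≃ₗ[Γ(Y, V)] Γ(F, V) :=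
    LinearEquiv.ofBijective (Fintype.linearCombination Γ(Y, V) fun i => secRes F hsW (b i)) hbij
  have he : ∀ i, e.symm (secRes F hsW (b i)) = Pi.single i 1 := by
    intro i
    rw [LinearEquiv.symm_apply_eq]
    change _ = Fintype.linearCombination Γ(Y, V) _ _
    rw [Fintype.linearCombination_apply_single, one_smul]
  have key : ∀ i, ∃ (u : (Y.residueField y)ˣ) (v : Γ(F, U)), ∀ j,
      algebraMap Γ(Y, V) (Y.residueField y) (e.symm (secRes F hVU v) j) =
        if j = i then (u : Y.residueField y) else 0 := by
    intro i
    -- A power of s makes the local basis section extend to U. The unit u is the value of that power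
    -- at y, later divided out of the functional.
    obtain ⟨n, t, ht⟩ := ((hF.localizes hU) s V hVU hV).2 (secRes F hsW (b i))
    have hu := ((isUnit_ringRes hU hVU hV).pow n).map (algebraMap Γ(Y, V) (Y.residueField y))
    refine ⟨hu.unit, t, fun j => ?_⟩
    rw [ht, map_smul, he, Pi.smul_apply, smul_eq_mul, map_mul, Pi.single_apply]
    split_ifs <;> simp
  have hlin : ∀ (i : Fin r) (c : Y.residueField y), ∃ f : Γ(F, U) →ₗ[Γ(Y, U)] Y.residueField y,
      ∀ x, f x = algebraMap Γ(Y, V) (Y.residueField y) (e.symm (secRes F hVU x) i) * c := by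
    intro i c
    refine ⟨{ toFun := fun x =>
                algebraMap Γ(Y, V) (Y.residueField y) (e.symm (secRes F hVU x) i) * c
              map_add' := fun x x' => ?_
              map_smul' := fun a x => ?_ }, fun x => rfl⟩
    · rw [secRes, map_add, map_add, Pi.add_apply, map_add, add_mul]
    · rw [secRes_smul, map_smul, Pi.smul_apply, smul_eq_mul, map_mul, Algebra.smul_def, mul_assoc]
      rfl
  obtain ⟨u, v, hv⟩ := key ⟨0, by omega⟩
  obtain ⟨u', w, hw⟩ := key ⟨1, by omega⟩
  obtain ⟨f, hf⟩ := hlin ⟨0, by omega⟩ (u⁻¹ : (Y.residueField y)ˣ)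
  obtain ⟨g, hg⟩ := hlin ⟨1, by omega⟩ (u'⁻¹ : (Y.residueField y)ˣ)
  refine ⟨inferInstance, f, g, v, w, ?_, ?_, ?_, ?_⟩
  · rw [hf, hv, if_pos rfl, Units.mul_inv]
  · rw [hf, hw, if_neg (by simp), zero_mul]
  · rw [hg, hv, if_neg (by simp), zero_mul]
  · rw [hg, hw, if_pos rfl, Units.mul_inv]

namespace CoverDatum

variable {D : CoverDatum Y} {Φ Φ' : D.QHom} {ψ : D.QLinHom} {U : Y.affineOpens}

/-- If q generates Q as a module it generates ⟨Q⟩ as an ideal, and a single quadric cannot cut out a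
finite scheme when F has rank at least 2. -/
theorem not_principal (hr : 2 ≤ D.rank) (hD : D.IsQuadratic) {y : Y} (hy : y ∈ U.1) {q : D.Q U}
    (hq : ∀ x : D.Q U, ∃ a : Γ(Y, U.1), x = a • q) : False := by
  obtain ⟨_, f, g, v, w, h1, h2, h3, h4⟩ := D.locallyFree.exists_dual hr U.2 hy
  refine false_of_finite_principal (hD U q.2) ?_ f g v w h1 h2 h3 h4
  have : Ideal.span {(q : symAlg D.F U.1)} = idealOf (D.Q U) := by
    apply le_antisymm
    · exact Ideal.span_mono (Set.singleton_subset_iff.2 q.2)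
    · refine Ideal.span_le.2 fun x hx => ?_
      obtain ⟨a, ha⟩ := hq ⟨x, hx⟩
      have h : x = a • (q : symAlg D.F U.1) := congr_arg Subtype.val ha
      rw [h, Algebra.smul_def]
      exact Ideal.mul_mem_left _ _ (Ideal.mem_span_singleton_self _)
  rw [this]
  exact D.quot_finite U

/-- A cover homomorphism is determined by its linear terms. -/
theorem QHom.HasLinearPart.eq (h : Φ.HasLinearPart ψ) (h' : Φ'.HasLinearPart ψ)
    (hΦ : Φ.IsCoverHom) (hΦ' : Φ'.IsCoverHom) (hr : 2 ≤ D.rank) (hD : D.IsQuadratic)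
    (hsyz : D.HasLinearSyzygies) : Φ = Φ' := by
  have hloc : ∀ y : Y, ∃ U : Y.affineOpens, y ∈ U.1 ∧ Φ.app U = Φ'.app U := by
    intro y
    obtain ⟨U, hy, m, q, hq⟩ := hsyz y
    refine ⟨U, hy, q.ext fun i => ?_⟩
    by_cases hm : ∃ j, i ≠ j
    · obtain ⟨j, hij⟩ := hm
      rw [h.app_eq, h'.app_eq, h.constPart_eq h' hΦ hΦ' q hq hij]
    -- The basis has i as its only index, so Q is generated by one quadric.
    · push Not at hm
      refine (not_principal hr hD hy (q := q i) fun x => ⟨q.repr x i, ?_⟩).elim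
      conv_lhs => rw [← q.sum_repr x]
      exact Finset.sum_eq_single i (fun j _ hj => (hj (hm j).symm).elim)
        (fun hi => (hi (Finset.mem_univ i)).elim)
  apply QHom.ext
  funext W
  refine LinearMap.ext fun q => ?_
  rw [h.app_eq, h'.app_eq]
  -- The linear terms agree, so only constants are compared; they are sections of O_Y and equality
  -- is local.
  congr 3
  refine ringRes_eq_of_locally fun y hyW => ?_
  obtain ⟨U, hyU, hU⟩ := hloc y
  obtain ⟨s, hsW, hys⟩ := U.2.exists_basicOpen_le ⟨y, hyW⟩ hyU
  let V : Y.affineOpens := ⟨Y.basicOpen s, U.2.basicOpen s⟩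
  refine ⟨V.1, hsW, hys, ?_⟩
  have hV : Φ.app V = Φ'.app V := QHom.app_eq_of_basicOpen (Y.basicOpen_le s) rfl hU
  have hc : ∀ Ψ : D.QHom, ringRes Y hsW (Ψ.constPart W q) = Ψ.constPart V (D.resQ hsW q) := by
    intro Ψ
    simp only [constPart, LinearMap.comp_apply]
    rw [Ψ.res, σ_resQuot, symConst_symRes]
  rw [hc, hc, constPart, constPart, hV]

end CoverDatum

end AlgCover

namespace AlgCover

variable {Y : Scheme.{u}}

/-! ### Subsheaves of modules -/

/-- A family of submodules of the sections of `M` that is a subsheaf. -/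
structure SubSheaf (M : Y.Modules) where
  sub : ∀ V : Y.Opens, Submodule Γ(Y, V) Γ(M, V)
  res_mem : ∀ {U V : Y.Opens} (h : V ≤ U) {x : Γ(M, U)}, x ∈ sub U → secRes M h x ∈ sub V
  mem_of_locally : ∀ {U : Y.Opens} {x : Γ(M, U)},
    (∀ y ∈ U, ∃ (V : Y.Opens) (h : V ≤ U), y ∈ V ∧ secRes M h x ∈ sub V) → x ∈ sub U

namespace SubSheaf

variable {M : Y.Modules} (N : SubSheaf M)

/-- The presheaf of abelian groups of a subsheaf. -/
noncomputable def abPresheaf : TopCat.Presheaf Ab.{u} Y where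
  obj V := AddCommGrpCat.of (N.sub V.unop)
  map i := AddCommGrpCat.ofHom
    { toFun := fun x => ⟨secRes M i.unop.le x.1, N.res_mem i.unop.le x.2⟩
      map_zero' := Subtype.ext (map_zero (M.presheaf.map _).hom)
      map_add' := fun x y => Subtype.ext (map_add (M.presheaf.map _).hom x.1 y.1) }
  map_id V := by
    ext x
    change M.presheaf.map (𝟙 _) x.1 = x.1
    rw [M.presheaf.map_id]
    rfl
  map_comp i j := by
    ext x
    exact (secRes_secRes M i.unop.le j.unop.le x.1).symm

/-- Sections are glued in M, and membership in the submodules is local. -/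
theorem abPresheaf_isSheaf : N.abPresheaf.IsSheaf := by
  rw [TopCat.Presheaf.isSheaf_iff_isSheafUniqueGluing]
  intro ι U sf hsf
  have hcomp : TopCat.Presheaf.IsCompatible M.presheaf U fun i => (sf i).1 := fun i j =>
    congr_arg Subtype.val (hsf i j)
  obtain ⟨s, hs, hu⟩ := TopCat.Sheaf.existsUnique_gluing ⟨_, M.isSheaf⟩ U _ hcomp
  refine ⟨⟨s, N.mem_of_locally fun y hy => ?_⟩, fun i => Subtype.ext (hs i), fun t ht =>
    Subtype.ext (hu t.1 fun i => congr_arg Subtype.val (ht i))⟩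
  obtain ⟨i, hi⟩ := Opens.mem_iSup.1 hy
  refine ⟨U i, le_iSup U i, hi, ?_⟩
  have : secRes M (le_iSup U i) s = (sf i).1 := hs i
  rw [this]
  exact (sf i).2

noncomputable instance (V : (Opens Y)ᵒᵖ) :
    Module (Y.ringCatSheaf.obj.obj V) (N.abPresheaf.obj V) :=
  inferInstanceAs (Module Γ(Y, V.unop) (N.sub V.unop))

/-- A subsheaf of a sheaf of modules, as a sheaf of modules. -/
noncomputable def toModules : Y.Modules where
  val := PresheafOfModules.ofPresheaf N.abPresheaf fun _ _ i a x =>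
    Subtype.ext (secRes_smul M i.unop.le a x.1)
  isSheaf := N.abPresheaf_isSheaf

/-- The inclusion of a subsheaf on sections. -/
noncomputable def incl (V : Y.Opens) : Γ(N.toModules, V) →ₗ[Γ(Y, V)] Γ(M, V) := (N.sub V).subtype

theorem incl_injective (V : Y.Opens) : Function.Injective (N.incl V) := Subtype.val_injective

theorem incl_mem {V : Y.Opens} (x : Γ(N.toModules, V)) : N.incl V x ∈ N.sub V := Subtype.prop x

theorem exists_incl {V : Y.Opens} {x : Γ(M, V)} (hx : x ∈ N.sub V) : ∃ z, N.incl V z = x :=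
  ⟨⟨x, hx⟩, rfl⟩

theorem incl_res {U V : Y.Opens} (h : V ≤ U) (x : Γ(N.toModules, U)) :
    N.incl V (secRes N.toModules h x) = secRes M h (N.incl U x) := rfl

end SubSheaf

end AlgCover

namespace AlgCover

variable {Y : Scheme.{u}}

/-! ### Bases and traces -/

section SheafBasis

variable {M : Y.Modules} {d : ℕ}

/-- The sections `b` over `U` form a basis of the sections of `M` over every open subset
of `U`. -/
def IsSheafBasis {M : Y.Modules} {U : Y.Opens} (b : Fin d → Γ(M, U)) : Prop :=
  ∀ (V : Y.Opens) (h : V ≤ U),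
    Function.Bijective fun c : Fin d → Γ(Y, V) => ∑ i, c i • secRes M h (b i)

variable (M d) in
/-- `M` is free of rank `d` over `U`, as a sheaf. -/
def HasSheafBasis (U : Y.Opens) : Prop := ∃ b : Fin d → Γ(M, U), IsSheafBasis b

theorem IsSheafBasis.restrict {U V : Y.Opens} {b : Fin d → Γ(M, U)} (hb : IsSheafBasis b)
    (h : V ≤ U) : IsSheafBasis fun i => secRes M h (b i) := fun W hW => by
  simpa only [secRes_secRes] using hb W (hW.trans h)

theorem HasSheafBasis.restrict {U V : Y.Opens} (hU : HasSheafBasis M d U) (h : V ≤ U) :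
    HasSheafBasis M d V :=
  ⟨_, hU.choose_spec.restrict h⟩

/-- The basis of the sections over an open subset. -/
noncomputable def IsSheafBasis.basis {U V : Y.Opens} {b : Fin d → Γ(M, U)} (hb : IsSheafBasis b)
    (h : V ≤ U) : Module.Basis (Fin d) Γ(Y, V) Γ(M, V) :=
  Module.Basis.ofEquivFun (LinearEquiv.ofBijective
    (Fintype.linearCombination Γ(Y, V) fun i => secRes M h (b i)) (hb V h)).symm

theorem IsSheafBasis.basis_apply {U V : Y.Opens} {b : Fin d → Γ(M, U)} (hb : IsSheafBasis b)
    (h : V ≤ U) (i : Fin d) : hb.basis h i = secRes M h (b i) := by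
  classical
  rw [basis, Module.Basis.coe_ofEquivFun, LinearEquiv.symm_symm]
  change Fintype.linearCombination Γ(Y, V) _ _ = _
  rw [Fintype.linearCombination_apply_single, one_smul]

theorem repr_secRes {U V : Y.Opens} (h : V ≤ U) {ι : Type*} [Fintype ι]
    {b : Module.Basis ι Γ(Y, U) Γ(M, U)} {b' : Module.Basis ι Γ(Y, V) Γ(M, V)}
    (hb : ∀ i, b' i = secRes M h (b i)) (x : Γ(M, U)) (i : ι) :
    b'.repr (secRes M h x) i = ringRes Y h (b.repr x i) := by
  classical
  have h1 : secRes M h x = ∑ j, ringRes Y h (b.repr x j) • b' j := by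
    conv_lhs => rw [← b.sum_repr x]
    rw [secRes, map_sum]
    refine Finset.sum_congr rfl fun j _ => ?_
    rw [hb]
    exact secRes_smul M h _ _
  rw [h1, b'.repr_sum_self]

/-- The trace of multiplication by a section. -/
noncomputable def AlgStr.trace (m : AlgStr M) (U : Y.affineOpens) :
    Γ(M, U.1) →ₗ[Γ(Y, U.1)] Γ(Y, U.1) :=
  LinearMap.trace Γ(Y, U.1) Γ(M, U.1) ∘ₗ m.mul U

theorem AlgStr.trace_eq_sum (m : AlgStr M) {U : Y.affineOpens} {ι : Type*} [Fintype ι]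
    (b : Module.Basis ι Γ(Y, U.1) Γ(M, U.1)) (x : Γ(M, U.1)) :
    m.trace U x = ∑ i, b.repr (m.mul U x (b i)) i := by
  classical
  rw [trace, LinearMap.comp_apply, LinearMap.trace_eq_matrix_trace _ b, Matrix.trace]
  simp only [Matrix.diag_apply, LinearMap.toMatrix_apply]

theorem AlgStr.trace_res (m : AlgStr M) {U V : Y.affineOpens} (h : V.1 ≤ U.1) {ι : Type*}
    [Fintype ι] {b : Module.Basis ι Γ(Y, U.1) Γ(M, U.1)}
    {b' : Module.Basis ι Γ(Y, V.1) Γ(M, V.1)} (hb : ∀ i, b' i = secRes M h (b i)) (x : Γ(M, U.1)) :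
    m.trace V (secRes M h x) = ringRes Y h (m.trace U x) := by
  rw [m.trace_eq_sum b, m.trace_eq_sum b', map_sum]
  refine Finset.sum_congr rfl fun i _ => ?_
  rw [hb, ← m.res_mul U V h, repr_secRes h hb]

/-- A basis is needed over U only: it restricts to V, and the matrix of multiplication restricts
with it. -/
theorem AlgStr.trace_secRes (m : AlgStr M) {U V : Y.affineOpens} (h : V.1 ≤ U.1)
    (hU : HasSheafBasis M d U.1) (x : Γ(M, U.1)) :
    m.trace V (secRes M h x) = ringRes Y h (m.trace U x) := by
  obtain ⟨b, hb⟩ := hU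
  refine m.trace_res h (b := hb.basis le_rfl) (b' := hb.basis h) (fun i => ?_) x
  rw [hb.basis_apply, hb.basis_apply, secRes_secRes]

theorem AlgStr.trace_one (m : AlgStr M) {U : Y.affineOpens} (hU : HasSheafBasis M d U.1) :
    m.trace U (m.one U) = d := by
  obtain ⟨b, hb⟩ := hU
  rw [m.trace_eq_sum (hb.basis le_rfl)]
  simp [m.one_mul]

/-- A point of an open set has an affine neighbourhood where `M` is free. -/
theorem IsLocallyFreeOfRank.exists_affine (hM : IsLocallyFreeOfRank M d) {W : Y.Opens} {y : Y}
    (hy : y ∈ W) : ∃ U : Y.affineOpens, U.1 ≤ W ∧ y ∈ U.1 ∧ HasSheafBasis M d U.1 := by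
  obtain ⟨V, hyV, b, hb⟩ := hM y
  obtain ⟨U, hU, hyU, hUV⟩ := exists_isAffineOpen_mem_and_subset (U := W ⊓ V) ⟨hy, hyV⟩
  have hb' : IsSheafBasis b := hb
  exact ⟨⟨U, hU⟩, hUV.trans inf_le_left, hyU, _, hb'.restrict (hUV.trans inf_le_right)⟩

end SheafBasis

/-! ### Sections of trace zero -/

section Traceless

variable {M : Y.Modules} (m : AlgStr M) (d : ℕ)

/-- The subsheaf of sections of trace zero. -/
noncomputable def AlgStr.traceless : SubSheaf M where
  sub V :=
    -- The test is restricted to affine open sets with a basis: elsewhere `LinearMap.trace` may take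
    -- its default value 0, and compatibility with restriction is available only there.
    { carrier := {x | ∀ (U : Y.affineOpens) (h : U.1 ≤ V), HasSheafBasis M d U.1 →
        m.trace U (secRes M h x) = 0}
      zero_mem' := fun U h _ => by rw [secRes, map_zero, map_zero]
      add_mem' := fun {x y} hx hy U h hU => by
        rw [secRes, map_add, map_add]
        change m.trace U (secRes M h x) + m.trace U (secRes M h y) = 0
        rw [hx U h hU, hy U h hU, add_zero]
      smul_mem' := fun a x hx U h hU => by
        rw [secRes_smul, map_smul, hx U h hU, smul_zero] }
  res_mem h x hx U hU hb := by
    rw [secRes_secRes]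
    exact hx U _ hb
  mem_of_locally {V x} hx U hU hb := by
    refine ringRes_eq_of_locally fun y hy => ?_
    obtain ⟨W, hWV, hyW, hW⟩ := hx y (hU hy)
    obtain ⟨f, hf, hyf⟩ := U.2.exists_basicOpen_le ⟨y, hyW⟩ hy
    refine ⟨Y.basicOpen f, Y.basicOpen_le f, hyf, ?_⟩
    have h1 := hW ⟨_, U.2.basicOpen f⟩ hf (hb.restrict (Y.basicOpen_le f))
    rw [map_zero, ← h1, secRes_secRes]
    have := m.trace_secRes (V := ⟨_, U.2.basicOpen f⟩) (Y.basicOpen_le f) hb (secRes M hU x)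
    rw [secRes_secRes] at this
    exact this.symm

variable {m d}

/-- Over the open subsets of an affine open set where `M` is free, the trace extends to a
linear function that vanishes on the sections of trace zero only. -/
theorem AlgStr.exists_trace {V : Y.affineOpens} (hV : HasSheafBasis M d V.1) {W : Y.Opens}
    (h : W ≤ V.1) : ∃ τ : Γ(M, W) →ₗ[Γ(Y, W)] Γ(Y, W),
      (∀ x, τ (secRes M h x) = ringRes Y h (m.trace V x)) ∧
        ∀ x, x ∈ (m.traceless d).sub W ↔ τ x = 0 := by
  obtain ⟨b, hb⟩ := hV
  have hτ : ∃ τ : Γ(M, W) →ₗ[Γ(Y, W)] Γ(Y, W), ∀ i,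
      τ (secRes M h (b i)) = ringRes Y h (m.trace V (b i)) := by
    refine ⟨(hb.basis h).constr Γ(Y, W) fun i => ringRes Y h (m.trace V (b i)), fun i => ?_⟩
    rw [← hb.basis_apply h, Module.Basis.constr_basis]
  obtain ⟨τ, hτ⟩ := hτ
  -- W need not be affine, so τ is defined by its values on the basis and compared with the trace on
  -- affine open subsets of W.
  have key : ∀ (U : Y.affineOpens) (hU : U.1 ≤ W) (x : Γ(M, W)),
      m.trace U (secRes M hU x) = ringRes Y hU (τ x) := by
    intro U hU x
    conv_lhs => rw [← (hb.basis h).sum_repr x, secRes, map_sum, map_sum]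
    conv_rhs => rw [← (hb.basis h).sum_repr x, map_sum, map_sum]
    refine Finset.sum_congr rfl fun i _ => ?_
    change m.trace U (secRes M hU _) = _
    rw [secRes_smul, map_smul, map_smul, smul_eq_mul, smul_eq_mul, map_mul, hb.basis_apply,
      secRes_secRes, hτ, ringRes_ringRes,
      m.trace_secRes (hU.trans h) ⟨b, hb⟩]
  refine ⟨τ, fun x => ?_, fun x => ⟨fun hx => ?_, fun hx U hU _ => ?_⟩⟩
  · conv_lhs => rw [← (hb.basis le_rfl).sum_repr x, secRes, map_sum, map_sum]
    conv_rhs => rw [← (hb.basis le_rfl).sum_repr x, map_sum, map_sum]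
    refine Finset.sum_congr rfl fun i _ => ?_
    change τ (secRes M h _) = _
    rw [secRes_smul, map_smul, map_smul, smul_eq_mul, smul_eq_mul, map_mul, hb.basis_apply,
      secRes_secRes, hτ, m.trace_secRes le_rfl ⟨b, hb⟩, ringRes_ringRes]
  · refine ringRes_eq_of_locally fun y hy => ?_
    obtain ⟨U, hU, hyU, hUW⟩ := exists_isAffineOpen_mem_and_subset (U := W) hy
    refine ⟨U, hUW, hyU, ?_⟩
    rw [map_zero, ← key ⟨U, hU⟩ hUW]
    exact hx ⟨U, hU⟩ hUW ⟨_, hb.restrict (hUW.trans h)⟩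
  · rw [key U hU, hx, map_zero]

/-- A basis of the kernel of a linear function, from a basis of the module and an element where
the function and a coordinate are invertible. -/
theorem existsUnique_of_ker {R N : Type*} [CommRing R] [AddCommGroup N] [Module R N] {n : ℕ}
    (b : Module.Basis (Fin (n + 1)) R N) (e : N) (τ : N →ₗ[R] R) {t : R} (ht : t * τ e = 1)
    {i : Fin (n + 1)} (hi : IsUnit (b.repr e i)) {x : N} (hx : τ x = 0) :
    ∃! a : Fin n → R,
      ∑ j, a j • (b (i.succAbove j) - (t * τ (b (i.succAbove j))) • e) = x := by
  classical
  obtain ⟨w, hw⟩ := hi.exists_left_inv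
  have hsum : ∀ a : Fin n → R, ∑ j, a j • (b (i.succAbove j) - (t * τ (b (i.succAbove j))) • e) =
      ∑ j, a j • b (i.succAbove j) - (∑ j, a j * (t * τ (b (i.succAbove j)))) • e := by
    intro a
    simp only [smul_sub, Finset.sum_sub_distrib, Finset.sum_smul, smul_smul]
  have hτ : ∀ a : Fin n → R,
      τ (∑ j, a j • (b (i.succAbove j) - (t * τ (b (i.succAbove j))) • e)) = 0 := by
    intro a
    rw [map_sum]
    refine Finset.sum_eq_zero fun j _ => ?_
    rw [map_smul, map_sub, map_smul, smul_eq_mul, smul_eq_mul]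
    linear_combination -a j * τ (b (i.succAbove j)) * ht
  have hrepr : ∀ (a : Fin n → R) (k : Fin n),
      b.repr (∑ j, a j • b (i.succAbove j)) (i.succAbove k) = a k := by
    intro a k
    simp only [map_sum, map_smul, Finsupp.finsetSum_apply, Finsupp.smul_apply,
      Module.Basis.repr_self, Finsupp.single_apply, (Fin.succAbove_right_injective).eq_iff]
    simp
  have hrepr' : ∀ a : Fin n → R, b.repr (∑ j, a j • b (i.succAbove j)) i = 0 := by
    intro a
    simp only [map_sum, map_smul, Finsupp.finsetSum_apply, Finsupp.smul_apply,
      Module.Basis.repr_self]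
    refine Finset.sum_eq_zero fun j _ => ?_
    rw [Finsupp.single_eq_of_ne (Fin.succAbove_ne i j).symm, smul_zero]
  -- Subtracting a multiple of e removes the i-th coordinate of x; the remaining coordinates are the
  -- coefficients.
  refine ⟨fun j => b.repr (x - (b.repr x i * w) • e) (i.succAbove j), ?_, fun a ha => ?_⟩
  · have h1 : ∑ j, b.repr (x - (b.repr x i * w) • e) (i.succAbove j) • b (i.succAbove j) =
        x - (b.repr x i * w) • e := by
      have := b.sum_repr (x - (b.repr x i * w) • e)
      rw [Fin.sum_univ_succAbove _ i] at this
      have h0 : b.repr (x - (b.repr x i * w) • e) i = 0 := by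
        rw [map_sub, map_smul, Finsupp.sub_apply, Finsupp.smul_apply, smul_eq_mul]
        linear_combination -b.repr x i * hw
      rwa [h0, zero_smul, zero_add] at this
    set a := fun j => b.repr (x - (b.repr x i * w) • e) (i.succAbove j)
    -- Applying τ shows that the total coefficient of e is annihilated by τ(e), which is invertible,
    -- so it vanishes.
    have h2 := hτ a
    rw [hsum a, h1, sub_sub, ← add_smul, map_sub, hx, map_smul, zero_sub, neg_eq_zero,
      smul_eq_mul] at h2
    have h3 : b.repr x i * w + ∑ j, a j * (t * τ (b (i.succAbove j))) = 0 := by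
      linear_combination t * h2 - (b.repr x i * w + ∑ j, a j * (t * τ (b (i.succAbove j)))) * ht
    exact (hsum a).trans (by rw [h1, sub_sub, ← add_smul, h3, zero_smul, sub_zero])
  -- The i-th coordinate determines the coefficient of e, and the other coordinates then determine
  -- a.
  · have key : ∀ a : Fin n → R,
        ∑ j, a j • (b (i.succAbove j) - (t * τ (b (i.succAbove j))) • e) = x →
          (∑ j, a j * (t * τ (b (i.succAbove j)))) = -(b.repr x i * w) := by
      intro a ha
      have := congr_arg (fun z => b.repr z i) ha
      simp only [hsum] at this
      rw [map_sub, map_smul, Finsupp.sub_apply, Finsupp.smul_apply, hrepr', smul_eq_mul] at this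
      linear_combination -w * this - (∑ j, a j * (t * τ (b (i.succAbove j)))) * hw
    have h1 := hsum a
    rw [ha, key a ha, neg_smul, sub_neg_eq_add] at h1
    funext k
    rw [← hrepr a k, eq_sub_of_add_eq h1.symm]

theorem AlgStr.sub_smul_one_mem_traceless {V : Y.affineOpens} (hV : HasSheafBasis M d V.1)
    {t : Γ(Y, V.1)} (ht : t * d = 1) (x : Γ(M, V.1)) :
    x - (t * m.trace V x) • m.one V ∈ (m.traceless d).sub V.1 := by
  intro U hU _
  rw [m.trace_secRes hU hV, map_sub, map_smul, m.trace_one hV, smul_eq_mul,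
    show m.trace V x - t * m.trace V x * (d : Γ(Y, V.1)) = 0 by
      linear_combination -m.trace V x * ht, map_zero]

/-- Where some coordinate of the unit section is invertible, that unit section replaces the
corresponding basis vector. Subtracting multiples of it from the others yields a basis of the kernel
of the trace, since the trace of the unit is the invertible number d. -/
theorem AlgStr.traceless_isLocallyFreeOfRank (hM : IsLocallyFreeOfRank M d) (hpos : 0 < d)
    (hd : ∀ U : Y.Opens, IsUnit (d : Γ(Y, U))) :
    IsLocallyFreeOfRank (m.traceless d).toModules (d - 1) := by
  intro y
  obtain ⟨n, rfl⟩ : ∃ n, d = n + 1 := ⟨d - 1, by omega⟩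
  obtain ⟨U, -, hyU, b, hb⟩ := hM.exists_affine (W := ⊤) (Opens.mem_top y)
  have h1 := m.trace_one ⟨b, hb⟩
  -- Otherwise d, the trace of the unit, which is a combination of the coordinates of the unit,
  -- would vanish at y.
  have h2 : ∃ i, y ∈ Y.basicOpen ((hb.basis le_rfl).repr (m.one U) i) := by
    by_contra hcon
    push Not at hcon
    have h3 : Y.evaluation U.1 y hyU ((n + 1 : ℕ) : Γ(Y, U.1)) = 0 := by
      rw [← h1, ← (hb.basis le_rfl).sum_repr (m.one U), map_sum, map_sum]
      refine Finset.sum_eq_zero fun i _ => ?_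
      rw [map_smul, smul_eq_mul, map_mul, Y.evaluation_eq_zero_iff_notMem_basicOpen .. |>.2 (hcon i),
        zero_mul]
    exact ((hd U.1).map (Y.evaluation U.1 y hyU).hom).ne_zero h3
  obtain ⟨i, hi⟩ := h2
  set f := (hb.basis le_rfl).repr (m.one U) i with hf
  let V : Y.affineOpens := ⟨Y.basicOpen f, U.2.basicOpen f⟩
  have hVU : V.1 ≤ U.1 := Y.basicOpen_le f
  have hb' := hb.restrict hVU
  obtain ⟨t, ht⟩ := (hd V.1).exists_left_inv
  set b' := fun j => secRes M hVU (b j) with hb'_def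
  -- These sections are b'ⱼ − (tr(b'ⱼ)/d)·1 for the indices j other than i.
  choose c hc' using fun j => (m.traceless (n + 1)).exists_incl
    (m.sub_smul_one_mem_traceless ⟨_, hb'⟩ ht (b' (i.succAbove j)))
  refine ⟨V.1, hi, fun j => c j, fun W hW => ?_⟩
  obtain ⟨τ, hτ, hτ0⟩ := m.exists_trace ⟨_, hb'⟩ hW
  have hunit : IsUnit ((hb'.basis hW).repr (secRes M hW (m.one V)) i) := by
    have e : (hb'.basis hW).repr (secRes M hW (m.one V)) i = ringRes Y hW (ringRes Y hVU f) := by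
      rw [hf, ← m.res_one U V hVU, secRes_secRes, ringRes_ringRes]
      refine repr_secRes _ (fun j => ?_) _ i
      rw [hb'.basis_apply, hb.basis_apply, secRes_secRes, secRes_secRes]
    rw [e]
    exact (isUnit_ringRes U.2 hVU rfl).map _
  have htW : ringRes Y hW t * τ (secRes M hW (m.one V)) = 1 := by
    rw [hτ, m.trace_one ⟨_, hb'⟩, ← map_mul, ht, map_one]
  have hincl : ∀ a : Fin n → Γ(Y, W), (m.traceless (n + 1)).incl W
      (∑ j, a j • secRes (m.traceless (n + 1)).toModules hW (c j)) =
      ∑ j, a j • ((hb'.basis hW) (i.succAbove j) - (ringRes Y hW t *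
        τ ((hb'.basis hW) (i.succAbove j))) • secRes M hW (m.one V)) := by
    intro a
    rw [map_sum]
    refine Finset.sum_congr rfl fun j _ => ?_
    rw [map_smul, SubSheaf.incl_res, hc']
    congr 1
    rw [secRes, map_sub]
    change secRes M hW _ - secRes M hW _ = _
    rw [secRes_smul, hb'.basis_apply, hτ, map_mul]
  rw [Function.bijective_iff_existsUnique]
  intro x
  obtain ⟨a, ha, hu⟩ := existsUnique_of_ker (hb'.basis hW) (secRes M hW (m.one V)) τ htW hunit
    ((hτ0 _).1 ((m.traceless (n + 1)).incl_mem x))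
  refine ⟨a, SubSheaf.incl_injective _ _ ((hincl a).trans ha), fun a' ha' => hu a' ?_⟩
  exact (hincl a').symm.trans (congr_arg ((m.traceless (n + 1)).incl W) ha')

end Traceless

end AlgCover

namespace AlgCover

variable {Y : Scheme.{u}}

/-! ### The cover datum with `Q = Sym² F` -/

section Quadrics

variable {F : Y.Modules} {U : Y.Opens}

theorem symDeg_le_idealOf {n : ℕ} (hn : 2 ≤ n) {x : symAlg F U} (hx : x ∈ symDeg F U n) :
    x ∈ idealOf (symDeg F U 2) := by
  obtain ⟨k, rfl⟩ := Nat.exists_eq_add_of_le' hn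
  rw [symDeg, pow_add] at hx
  refine Submodule.mul_induction_on hx (fun y _ z hz => ?_) fun y z hy hz => add_mem hy hz
  exact Ideal.mul_mem_left _ _ (Ideal.subset_span hz)

theorem symComp_eq_zero_of_mem_idealOf {x : symAlg F U} (hx : x ∈ idealOf (symDeg F U 2)) {n : ℕ}
    (hn : n < 2) : symComp F U n x = 0 := by
  induction hx using Submodule.span_induction generalizing n with
  | mem x hx => exact symComp_of_ne hx (by omega)
  | zero => exact map_zero _
  | add x y _ _ hx hy => rw [map_add, hx hn, hy hn, add_zero]
  | smul a x _ hx =>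
    rw [smul_eq_mul, symComp_mul]
    refine Finset.sum_eq_zero fun p hp => ?_
    have := Finset.HasAntidiagonal.mem_antidiagonal.1 hp
    rw [hx (by omega), mul_zero]

variable (F U) in
/-- The part of degree at most one of a polynomial. -/
noncomputable def symLow : symAlg F U →ₗ[Γ(Y, U)] symAlg F U := symComp F U 0 + symComp F U 1

theorem symLow_apply (x : symAlg F U) : symLow F U x = symComp F U 0 x + symComp F U 1 x := rfl

theorem symLow_mem (x : symAlg F U) : symLow F U x ∈ symLT F U 2 :=
  add_mem (symDeg_le_symLT two_pos (symComp_mem 0 x))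
    (symDeg_le_symLT one_lt_two (symComp_mem 1 x))

theorem symLow_eq_zero {x : symAlg F U} (hx : x ∈ idealOf (symDeg F U 2)) : symLow F U x = 0 := by
  rw [symLow_apply, symComp_eq_zero_of_mem_idealOf hx two_pos,
    symComp_eq_zero_of_mem_idealOf hx one_lt_two, add_zero]

theorem sub_symLow_mem (x : symAlg F U) : x - symLow F U x ∈ idealOf (symDeg F U 2) := by
  obtain ⟨N, hN⟩ := exists_sum_symComp x
  have h := hN (N + 2) (by omega)
  rw [Finset.sum_range_succ', Finset.sum_range_succ', zero_add] at h
  have h' : x - symLow F U x = ∑ k ∈ Finset.range N, symComp F U (k + 1 + 1) x := by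
    rw [symLow_apply]
    linear_combination h
  rw [h']
  exact sum_mem fun k _ => symDeg_le_idealOf (by omega) (symComp_mem _ x)

/-- Compatibility with restriction makes the section of the quadratic cover datum a map of sheaves.
-/
theorem symLow_symRes {V : Y.Opens} (h : V ≤ U) (x : symAlg F U) :
    symLow F V (symRes F h x) = symRes F h (symLow F U x) := by
  rw [symLow_apply, symLow_apply, symComp_symRes, symComp_symRes, map_add]

variable (F U) in
/-- The section of the projection modulo quadrics by the polynomials of degree at most one. -/
noncomputable def quadSection :
    (symAlg F U ⧸ idealOf (symDeg F U 2)) →ₗ[Γ(Y, U)] symAlg F U :=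
  Submodule.liftQ ((idealOf (symDeg F U 2)).restrictScalars Γ(Y, U)) (symLow F U)
    fun _ hx => symLow_eq_zero hx

theorem quadSection_mk (x : symAlg F U) :
    quadSection F U (Ideal.Quotient.mk _ x) = symLow F U x := rfl

theorem mk_quadSection (c : symAlg F U ⧸ idealOf (symDeg F U 2)) :
    Ideal.Quotient.mk (idealOf (symDeg F U 2)) (quadSection F U c) = c := by
  obtain ⟨x, rfl⟩ := Ideal.Quotient.mk_surjective c
  rw [quadSection_mk, eq_comm, Ideal.Quotient.eq]
  exact sub_symLow_mem x

/-- Modulo quadrics every polynomial has a representative of degree at most one, so O ⊕ F maps onto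
the quotient. -/
theorem finite_quotient_quadrics [Module.Finite Γ(Y, U) Γ(F, U)] :
    Module.Finite Γ(Y, U) (symAlg F U ⧸ idealOf (symDeg F U 2)) := by
  refine Module.Finite.of_surjective
    ((Ideal.Quotient.mkₐ Γ(Y, U) (idealOf (symDeg F U 2))).toLinearMap ∘ₗ
      (Algebra.linearMap Γ(Y, U) (symAlg F U)).coprod (symι F U)) fun c => ?_
  obtain ⟨x, rfl⟩ := Ideal.Quotient.mk_surjective c
  refine ⟨(symConst F U (symLow F U x), symLin F U (symLow F U x)), ?_⟩
  refine Eq.trans ?_ (mk_quadSection (Ideal.Quotient.mk _ x))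
  rw [quadSection_mk, eq_const_add_lin (symLow_mem x)]
  simp

/-- The cover datum of a locally free sheaf `F` with `Q = Sym² F`. -/
noncomputable def quadDatum (F : Y.Modules) {r : ℕ} (hF : IsLocallyFreeOfRank F r)
    (hfin : ∀ U : Y.affineOpens, Module.Finite Γ(Y, U.1) Γ(F, U.1)) : CoverDatum Y where
  F := F
  rank := r
  locallyFree := hF
  Q U := symDeg F U.1 2
  Q_res h _ hq := symRes_mem_symDeg h hq
  Q_summand := ⟨fun U => symComp F U.1 2, fun _ x => symComp_mem 2 x, fun _ _ hx => symComp_self hx,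
    fun _ _ h x => symComp_symRes h 2 x⟩
  Q_graded U := le_antisymm (le_iSup_of_le 2 (le_inf le_rfl le_rfl)) (iSup_le fun _ => inf_le_left)
  Q_finite U := by
    have := hfin U
    refine Module.Finite.iff_fg.2 (Submodule.FG.pow ?_ 2)
    rw [LinearMap.range_eq_map]
    exact (Module.Finite.fg_top).map _
  Q_inf U := by
    refine eq_bot_iff.2 fun x hx => ?_
    obtain ⟨y, hy, z, hz, rfl⟩ := Submodule.mem_sup.1 hx.2
    have h := symComp_self hx.1
    rw [map_add, symComp_of_ne hy (by omega), symComp_of_ne hz (by omega), add_zero] at h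
    exact h.symm
  quot_finite U := by
    have := hfin U
    exact finite_quotient_quadrics
  σ U := quadSection F U.1
  σ_section U c := mk_quadSection c
  σ_deg U n x hx := by
    rw [quadSection_mk, symLow_apply, symComp_of_mem hx, symComp_of_mem hx]
    refine add_mem ?_ ?_
    · split_ifs
      exacts [hx, zero_mem _]
    · split_ifs
      exacts [hx, zero_mem _]
  σ_res h x := symLow_symRes h x

end Quadrics

/-! ### Decomposition into constants and sections of trace zero -/

section Decomposition

variable {M : Y.Modules} {d : ℕ} (m : AlgStr M)

/-- Locally the trace of a·1 is ad, and d is invertible. -/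
theorem AlgStr.eq_zero_of_smul_one_mem (hM : IsLocallyFreeOfRank M d)
    (hd : ∀ U : Y.Opens, IsUnit (d : Γ(Y, U))) {U : Y.affineOpens} {W : Y.Opens} (h : W ≤ U.1)
    {a : Γ(Y, W)} (ha : a • secRes M h (m.one U) ∈ (m.traceless d).sub W) : a = 0 := by
  refine ringRes_eq_of_locally fun y hy => ?_
  obtain ⟨V, hVW, hyV, hV⟩ := hM.exists_affine hy
  refine ⟨V.1, hVW, hyV, ?_⟩
  have h1 := ha V hVW hV
  rw [secRes_smul, secRes_secRes, m.res_one U V, map_smul, m.trace_one hV, smul_eq_mul] at h1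
  rw [map_zero]
  exact (hd V.1).mul_left_eq_zero.1 h1

/-- Locally a is the trace of x divided by d. M need not be free over U, so the local constants are
glued. -/
theorem AlgStr.exists_sub_smul_one_mem (hM : IsLocallyFreeOfRank M d)
    (hd : ∀ U : Y.Opens, IsUnit (d : Γ(Y, U))) (U : Y.affineOpens) (x : Γ(M, U.1)) :
    ∃ a : Γ(Y, U.1), x - a • m.one U ∈ (m.traceless d).sub U.1 := by
  have h1 : ∀ y : U.1, ∃ V : Y.affineOpens, ∃ h : V.1 ≤ U.1, y.1 ∈ V.1 ∧
      ∃ a : Γ(Y, V.1), secRes M h x - a • m.one V ∈ (m.traceless d).sub V.1 := by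
    intro y
    obtain ⟨V, hVU, hyV, hV⟩ := hM.exists_affine y.2
    obtain ⟨t, ht⟩ := (hd V.1).exists_left_inv
    exact ⟨V, hVU, hyV, _, m.sub_smul_one_mem_traceless hV ht _⟩
  choose V hVU hyV a ha using h1
  have hres : ∀ (y : U.1) {W : Y.Opens} (hW : W ≤ (V y).1), secRes M (hW.trans (hVU y)) x -
      ringRes Y hW (a y) • secRes M (hW.trans (hVU y)) (m.one U) ∈ (m.traceless d).sub W := by
    intro y W hW
    have h2 := (m.traceless d).res_mem hW (ha y)
    rw [secRes, map_sub] at h2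
    change secRes M hW _ - secRes M hW _ ∈ _ at h2
    rwa [secRes_smul, ← m.res_one U (V y) (hVU y), secRes_secRes, secRes_secRes] at h2
  have hglue : ∃ b : Γ(Y, U.1), ∀ i, ringRes Y (hVU i) b = a i := by
    obtain ⟨b, hb, -⟩ := TopCat.Sheaf.existsUnique_gluing' Y.sheaf (fun y => (V y).1) U.1
      (fun y => homOfLE (hVU y)) (fun y hy => Opens.mem_iSup.2 ⟨⟨y, hy⟩, hyV ⟨y, hy⟩⟩) a (by
      intro i j
      change ringRes Y inf_le_left (a i) = ringRes Y inf_le_right (a j)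
      rw [← sub_eq_zero]
      -- On an overlap the difference of the two constants, times the unit, has trace zero; so the
      -- constants agree.
      refine m.eq_zero_of_smul_one_mem hM hd (inf_le_left.trans (hVU i)) ?_
      have h3 := sub_mem (hres j (W := (V i).1 ⊓ (V j).1) inf_le_right)
        (hres i (W := (V i).1 ⊓ (V j).1) inf_le_left)
      rwa [sub_sub_sub_cancel_left, ← sub_smul] at h3)
    exact ⟨b, hb⟩
  obtain ⟨b, hb⟩ := hglue
  refine ⟨b, (m.traceless d).mem_of_locally fun y hy => ⟨(V ⟨y, hy⟩).1, hVU _, hyV _, ?_⟩⟩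
  rw [secRes, map_sub]
  change secRes M _ _ - secRes M _ _ ∈ _
  rw [secRes_smul, hb, m.res_one]
  exact ha ⟨y, hy⟩

theorem AlgStr.eq_zero_of_smul_one_add_incl (hM : IsLocallyFreeOfRank M d)
    (hd : ∀ U : Y.Opens, IsUnit (d : Γ(Y, U))) (U : Y.affineOpens) {a : Γ(Y, U.1)}
    {v : Γ((m.traceless d).toModules, U.1)}
    (h : a • m.one U + (m.traceless d).incl U.1 v = 0) : a = 0 ∧ v = 0 := by
  have ha : a = 0 := by
    refine m.eq_zero_of_smul_one_mem hM hd le_rfl (U := U) ?_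
    rw [m.res_one U U, eq_neg_of_add_eq_zero_left h]
    exact neg_mem ((m.traceless d).incl_mem v)
  refine ⟨ha, (m.traceless d).incl_injective U.1 ?_⟩
  rwa [ha, zero_smul, zero_add, ← map_zero ((m.traceless d).incl U.1)] at h

theorem AlgStr.exists_eq_smul_one_add_incl (hM : IsLocallyFreeOfRank M d)
    (hd : ∀ U : Y.Opens, IsUnit (d : Γ(Y, U))) (U : Y.affineOpens) (x : Γ(M, U.1)) :
    ∃ (a : Γ(Y, U.1)) (v : Γ((m.traceless d).toModules, U.1)),
      a • m.one U + (m.traceless d).incl U.1 v = x := by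
  obtain ⟨a, ha⟩ := m.exists_sub_smul_one_mem hM hd U x
  obtain ⟨v, hv⟩ := (m.traceless d).exists_incl ha
  exact ⟨a, v, by rw [hv, add_sub_cancel]⟩

/-- The sections of trace zero are a direct factor of the finite module of sections of M. -/
theorem AlgStr.finite_traceless (hM : IsLocallyFreeOfRank M d)
    (hd : ∀ U : Y.Opens, IsUnit (d : Γ(Y, U))) (U : Y.affineOpens)
    [Module.Finite Γ(Y, U.1) Γ(M, U.1)] :
    Module.Finite Γ(Y, U.1) Γ((m.traceless d).toModules, U.1) := by
  let f := (LinearMap.toSpanSingleton Γ(Y, U.1) Γ(M, U.1) (m.one U)).coprod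
    ((m.traceless d).incl U.1)
  have hf : Function.Bijective f := by
    refine ⟨(injective_iff_map_eq_zero f).2 fun p hp => ?_, fun x => ?_⟩
    · obtain ⟨h1, h2⟩ := m.eq_zero_of_smul_one_add_incl hM hd U (a := p.1) (v := p.2) hp
      exact Prod.ext h1 h2
    · obtain ⟨a, v, h⟩ := m.exists_eq_smul_one_add_incl hM hd U x
      exact ⟨(a, v), h⟩
  let e := LinearEquiv.ofBijective f hf
  refine Module.Finite.of_surjective
    (LinearMap.snd Γ(Y, U.1) Γ(Y, U.1) Γ((m.traceless d).toModules, U.1) ∘ₗ e.symm.toLinearMap)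
    fun v => ⟨e (0, v), ?_⟩
  change (e.symm (e (0, v))).2 = v
  rw [e.symm_apply_apply]

/-- A basis of the sections over an affine open set restricts to a basis over basic open
sets. -/
theorem IsLocallyFreeOfRank.exists_basis_basicOpen (hM : IsLocallyFreeOfRank M d) {U : Y.Opens}
    (hU : IsAffineOpen U) {ι : Type*} (b : Module.Basis ι Γ(Y, U) Γ(M, U)) (f : Γ(Y, U)) :
    ∃ b' : Module.Basis ι Γ(Y, Y.basicOpen f) Γ(M, Y.basicOpen f),
      ∀ i, b' i = secRes M (Y.basicOpen_le f) (b i) := by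
  have hle : Y.basicOpen f ≤ U := Y.basicOpen_le f
  have hloc : IsLocalization.Away f Γ(Y, Y.basicOpen f) := hU.isLocalization_basicOpen f
  let _ : Module Γ(Y, U) Γ(M, Y.basicOpen f) := Module.compHom _ (ringRes Y hle)
  have : IsScalarTower Γ(Y, U) Γ(Y, Y.basicOpen f) Γ(M, Y.basicOpen f) :=
    ⟨fun a b x => by
      rw [Algebra.smul_def, mul_smul]; rfl⟩
  let g : Γ(M, U) →ₗ[Γ(Y, U)] Γ(M, Y.basicOpen f) :=
    { toFun := secRes M hle
      map_add' := fun x y => by simp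
      map_smul' := fun a x => secRes_smul M hle a x }
  have hunit : IsUnit (ringRes Y hle f) := IsLocalization.Away.algebraMap_isUnit f
  have hg : IsLocalizedModule.Away f g := by
    refine IsLocalizedModule.Away.mk_of_addCommGroup ?_ ?_ ?_
    · have h2 : IsUnit (algebraMap Γ(Y, Y.basicOpen f)
          (Module.End Γ(Y, Y.basicOpen f) Γ(M, Y.basicOpen f)) (ringRes Y hle f)) := hunit.map _
      rw [Module.End.isUnit_iff] at h2 ⊢
      exact h2
    · intro x
      obtain ⟨n, t, ht⟩ := ((hM.localizes hU) f _ hle rfl).2 x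
      refine ⟨n, t, ?_⟩
      rw [← map_pow] at ht
      exact ht.symm
    · exact ((hM.localizes hU) f _ hle rfl).1
  exact ⟨b.ofIsLocalizedModule Γ(Y, Y.basicOpen f) (Submonoid.powers f) g,
    fun i => b.ofIsLocalizedModule_apply _ _ g i⟩

/-- Here only the module of sections over U is free, which is not the sheaf condition in the
definition of `traceless`; a basis is therefore localized to small basic open sets, where both
apply. -/
theorem AlgStr.trace_eq_zero_of_mem_traceless (hM : IsLocallyFreeOfRank M d) {U : Y.affineOpens}
    [Module.Free Γ(Y, U.1) Γ(M, U.1)] [Module.Finite Γ(Y, U.1) Γ(M, U.1)] {x : Γ(M, U.1)}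
    (hx : x ∈ (m.traceless d).sub U.1) : m.trace U x = 0 := by
  refine ringRes_eq_of_locally fun y hy => ?_
  obtain ⟨V, hVU, hyV, hV⟩ := hM.exists_affine hy
  obtain ⟨f, hf, hyf⟩ := U.2.exists_basicOpen_le ⟨y, hyV⟩ hy
  refine ⟨Y.basicOpen f, Y.basicOpen_le f, hyf, ?_⟩
  cases subsingleton_or_nontrivial Γ(Y, U.1) with
  | inl h => rw [Subsingleton.elim (m.trace U x) 0]
  | inr h =>
    obtain ⟨b', hb'⟩ := hM.exists_basis_basicOpen U.2 (Module.Free.chooseBasis Γ(Y, U.1) Γ(M, U.1)) f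
    have h1 := m.trace_res (V := ⟨_, U.2.basicOpen f⟩) (Y.basicOpen_le f) hb' x
    rw [map_zero, ← h1]
    exact hx ⟨_, U.2.basicOpen f⟩ (Y.basicOpen_le f) (hV.restrict hf)

end Decomposition

end AlgCover

namespace AlgCover

variable {Y : Scheme.{u}}

/-! ### Homogenizations of the relations of an algebra generated in degree one -/

section Homogenization

variable {F : Y.Modules} {U : Y.Opens} {A : Type*} [CommRing A] [Algebra Γ(Y, U) A]
  (p : symAlg F U →ₐ[Γ(Y, U)] A)

/-- The algebra map from `R(F)[t]` to the Rees algebra of `A`, that sends `v ∈ F` to `p(v) t`. -/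
noncomputable def reesMap : Polynomial (symAlg F U) →+* Polynomial A :=
  Polynomial.eval₂RingHom ((Polynomial.mapRingHom p.toRingHom).comp (dilate F U).toRingHom)
    Polynomial.X

theorem reesMap_X : reesMap p Polynomial.X = Polynomial.X := Polynomial.eval₂_X _ _

theorem reesMap_C (x : symAlg F U) :
    reesMap p (Polynomial.C x) = (dilate F U x).map p.toRingHom := Polynomial.eval₂_C _ _

theorem homogenize_of_mem {i n : ℕ} (hi : i ≤ n) {x : symAlg F U} (hx : x ∈ symDeg F U i) :
    homogenize F U n x = Polynomial.C x * Polynomial.X ^ (n - i) := by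
  rw [homogenize, dilate_of_mem hx, ← Polynomial.C_mul_X_pow_eq_monomial,
    Polynomial.reflect_C_mul_X_pow, Polynomial.revAt_le hi]

/-- A component of degree j acquires tʲ from the map and tⁿ⁻ʲ from homogenization, so all components
end in degree n. In particular homogenized relations of the algebra go to 0. -/
theorem reesMap_homogenize {n : ℕ} {x : symAlg F U} (hx : x ∈ symLT F U (n + 1)) :
    reesMap p (homogenize F U n x) = Polynomial.monomial n (p x) := by
  induction hx using Submodule.iSup_induction' with
  | mem i x hx =>
    have hi : (i : ℕ) ≤ n := Nat.lt_succ_iff.1 i.2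
    rw [homogenize_of_mem hi hx, map_mul,
      map_pow, reesMap_X, reesMap_C, dilate_of_mem hx, Polynomial.map_monomial,
      Polynomial.monomial_mul_X_pow, Nat.add_sub_cancel' hi]
    rfl
  | zero => simp [homogenize]
  | add x y _ _ hx hy =>
    rw [homogenize, map_add, Polynomial.reflect_add, map_add]
    change reesMap p (homogenize F U n x) + reesMap p (homogenize F U n y) = _
    rw [hx, hy, map_add, map_add]

theorem coeff_reesMap (g : Polynomial (symAlg F U)) (n : ℕ) : (reesMap p g).coeff n =
    ∑ k ∈ Finset.HasAntidiagonal.antidiagonal n, p (symComp F U k.1 (g.coeff k.2)) := by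
  induction g using Polynomial.induction_on' with
  | add g h hg hh => simp only [map_add, Polynomial.coeff_add, hg, hh, Finset.sum_add_distrib]
  | monomial j x =>
    rw [← Polynomial.C_mul_X_pow_eq_monomial, map_mul, map_pow, reesMap_X, reesMap_C,
      Polynomial.coeff_mul_X_pow']
    simp only [Polynomial.coeff_C_mul_X_pow]
    split_ifs with h
    · rw [Finset.sum_eq_single_of_mem (n - j, j)
        (Finset.HasAntidiagonal.mem_antidiagonal.2 (by simp; omega)), if_pos rfl,
        Polynomial.coeff_map, coeff_dilate]
      · rfl
      · intro b hb hne
        have := Finset.HasAntidiagonal.mem_antidiagonal.1 hb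
        rw [if_neg, map_zero, map_zero]
        intro h'
        exact hne (Prod.ext (by simp; omega) h')
    · symm
      refine Finset.sum_eq_zero fun b hb => ?_
      have := Finset.HasAntidiagonal.mem_antidiagonal.1 hb
      rw [if_neg (by omega), map_zero, map_zero]

variable {p}

/-- The coefficient of tⁿ⁺¹ in the image is p of the constant term of the coefficient of tⁿ⁺¹ in g
plus the linear term of that of tⁿ. Injectivity of p in degrees at most 1 makes the sum zero, and
its two terms have different degrees. -/
theorem eq_zero_of_reesMap (hp : ∀ x ∈ symLT F U 2, p x = 0 → x = 0)
    {g : Polynomial (symAlg F U)} (hg : ∀ n, g.coeff n ∈ symLT F U 2) (h : reesMap p g = 0) :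
    g = 0 := by
  have hz : ∀ (n i : ℕ), 2 ≤ i → symComp F U i (g.coeff n) = 0 := fun n i hi =>
    mem_symLT.1 (hg n) i hi
  have h0 : ∀ i < 2, ∀ x ∈ symDeg F U i, x ∈ symLT F U 2 := fun i hi x hx =>
    symDeg_le_symLT hi hx
  have key : ∀ n, symComp F U 0 (g.coeff (n + 1)) + symComp F U 1 (g.coeff n) = 0 := by
    intro n
    refine hp _ (add_mem (h0 0 two_pos _ (symComp_mem _ _)) (h0 1 one_lt_two _ (symComp_mem _ _))) ?_
    have h1 := coeff_reesMap p g (n + 1)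
    rw [h, Polynomial.coeff_zero, Finset.sum_eq_add_of_mem (0, n + 1) (1, n) (by simp)
      (by simp; omega) (by simp)] at h1
    · rw [map_add]
      exact h1.symm
    · rintro ⟨i, j⟩ hij ⟨hne, hne'⟩
      have h2 := Finset.HasAntidiagonal.mem_antidiagonal.1 hij
      simp only [ne_eq, Prod.mk.injEq, not_and] at hne hne' h2
      rw [hz _ _ (by simp only; omega), map_zero]
  have key0 : symComp F U 0 (g.coeff 0) = 0 := by
    refine hp _ (h0 0 two_pos _ (symComp_mem _ _)) ?_
    have h1 := coeff_reesMap p g 0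
    rw [h, Polynomial.coeff_zero] at h1
    simpa using h1.symm
  have hc0 : ∀ n, symComp F U 0 (g.coeff n) = 0 := by
    intro n
    cases n with
    | zero => exact key0
    | succ n =>
      have := congr_arg (symComp F U 0) (key n)
      rwa [map_add, symComp_symComp, symComp_symComp, if_pos rfl, if_neg one_ne_zero, add_zero,
        map_zero] at this
  refine Polynomial.ext fun n => eq_zero_of_symComp fun i => ?_
  rcases Nat.lt_or_ge i 2 with hi | hi
  · interval_cases i
    · exact hc0 n
    · rw [← key n, hc0 (n + 1), zero_add]
  · exact hz n i hi

/-- Modulo an ideal that contains homogenized equations with leading forms all quadrics, every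
polynomial is congruent to one of degree at most one. -/
theorem exists_sub_mem_of_quadrics {I : Ideal (Polynomial (symAlg F U))}
    (hI : ∀ q ∈ symDeg F U 2, ∃ x ∈ symLT F U 2, homogenize F U 2 (q - x) ∈ I)
    (g : Polynomial (symAlg F U)) :
    ∃ l : Polynomial (symAlg F U), (∀ n, l.coeff n ∈ symLT F U 2) ∧ g - l ∈ I := by
  let P : Polynomial (symAlg F U) → Prop := fun g =>
    ∃ l : Polynomial (symAlg F U), (∀ n, l.coeff n ∈ symLT F U 2) ∧ g - l ∈ I
  have hadd : ∀ {g h}, P g → P h → P (g + h) := by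
    rintro g h ⟨l, hl, hgl⟩ ⟨k, hk, hhk⟩
    refine ⟨l + k, fun n => by rw [Polynomial.coeff_add]; exact add_mem (hl n) (hk n), ?_⟩
    rw [add_sub_add_comm]
    exact add_mem hgl hhk
  have hlow : ∀ {x}, x ∈ symLT F U 2 → P (Polynomial.C x) := fun {x} hx =>
    ⟨Polynomial.C x, fun n => by rw [Polynomial.coeff_C]; split_ifs; exacts [hx, zero_mem _],
      by rw [sub_self]; exact zero_mem _⟩
  have hX : ∀ {g} (k : ℕ), P g → P (g * Polynomial.X ^ k) := by
    rintro g k ⟨l, hl, hgl⟩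
    refine ⟨l * Polynomial.X ^ k, fun n => ?_, ?_⟩
    · rw [Polynomial.coeff_mul_X_pow']
      split_ifs
      exacts [hl _, zero_mem _]
    · rw [← sub_mul]
      exact I.mul_mem_right _ hgl
  have hcongr : ∀ {g h}, g - h ∈ I → P h → P g := by
    rintro g h hgh ⟨l, hl, hhl⟩
    exact ⟨l, hl, by rw [← sub_add_sub_cancel]; exact add_mem hgh hhl⟩
  have hquad : ∀ {q}, q ∈ symDeg F U 2 → P (Polynomial.C q) := by
    intro q hq
    obtain ⟨x, hx, hqx⟩ := hI q hq
    -- The homogenization of q − x is q − x₀t² − x₁t, so q is congruent to x₀t² + x₁t.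
    refine hcongr (h := Polynomial.C (symComp F U 0 x) * Polynomial.X ^ 2 +
      Polynomial.C (symComp F U 1 x) * Polynomial.X ^ 1) ?_
      (hadd (hX 2 (hlow (symDeg_le_symLT two_pos (symComp_mem 0 x))))
        (hX 1 (hlow (symDeg_le_symLT one_lt_two (symComp_mem 1 x)))))
    convert hqx using 1
    conv_rhs => rw [symComp_zero_mem_of_mem_two hx]
    rw [homogenize, map_sub, map_add, Polynomial.reflect_sub, Polynomial.reflect_add]
    change _ = homogenize F U 2 q - (homogenize F U 2 _ + homogenize F U 2 _)
    rw [homogenize_of_mem le_rfl hq, homogenize_of_mem zero_le_two (symComp_mem 0 x),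
      homogenize_of_mem one_le_two (symComp_mem 1 x), Nat.sub_self, pow_zero, mul_one]
    rfl
  have hdeg : ∀ n, ∀ x ∈ symDeg F U n, P (Polynomial.C x) := by
    intro n
    induction n with
    | zero => exact fun x hx => hlow (symDeg_le_symLT two_pos hx)
    | succ n ih =>
      intro x hx
      rw [symDeg, pow_succ] at hx
      refine Submodule.mul_induction_on hx (fun y hy z hz => ?_) fun y z hy hz => ?_
      · obtain ⟨l, hl, hyl⟩ := ih y hy
        have hz : z ∈ symDeg F U 1 := by rwa [symDeg_one]
        -- The coefficients of l have degree at most one; multiplying them by the linear form z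
        -- gives linear forms and quadrics, and quadrics are already reduced.
        refine hcongr (h := l * Polynomial.C z) ?_ ?_
        · rw [Polynomial.C_mul, ← sub_mul]
          exact I.mul_mem_right _ hyl
        · have hsum : ∀ s : Finset ℕ,
              P (∑ k ∈ s, Polynomial.C (l.coeff k * z) * Polynomial.X ^ k) := by
            intro s
            induction s using Finset.cons_induction with
            | empty => simpa using hlow (zero_mem _)
            | cons k s hk ih =>
              rw [Finset.sum_cons]
              refine hadd (hX k ?_) ih
              rw [symComp_zero_mem_of_mem_two (hl k), add_mul, Polynomial.C_add]
              refine hadd (hlow ?_) (hquad ?_)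
              · exact symDeg_le_symLT one_lt_two
                  (zero_add 1 ▸ mul_mem_symDeg (symComp_mem 0 (l.coeff k)) hz)
              · exact mul_mem_symDeg (symComp_mem 1 (l.coeff k)) hz
          convert hsum l.support using 1
          conv_lhs => rw [l.as_sum_support_C_mul_X_pow, Finset.sum_mul]
          refine Finset.sum_congr rfl fun k _ => ?_
          rw [Polynomial.C_mul]
          ring
      · rw [Polynomial.C_add]
        exact hadd hy hz
  change P g
  induction g using Polynomial.induction_on' with
  | add g h hg hh => exact hadd hg hh
  | monomial k x =>
    rw [← Polynomial.C_mul_X_pow_eq_monomial]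
    refine hX k ?_
    obtain ⟨N, hN⟩ := exists_sum_symComp x
    rw [hN N le_rfl, map_sum]
    exact Finset.sum_induction _ P (fun _ _ => hadd) (by simpa using hlow (zero_mem _))
      fun i _ => hdeg i _ (symComp_mem i x)

end Homogenization

end AlgCover

namespace AlgCover

variable {Y : Scheme.{u}}

/-! ### Every algebra structure is determined by a cover homomorphism -/

section Presentation

variable {M : Y.Modules} (m : AlgStr M)

/-- The sections over an affine open set form an algebra. -/
theorem AlgStr.exists_algebra (U : Y.affineOpens) :
    ∃ (A : Type u) (_ : CommRing A) (_ : Algebra Γ(Y, U.1) A) (e : Γ(M, U.1) ≃ₗ[Γ(Y, U.1)] A),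
      e (m.one U) = 1 ∧ ∀ x y, e (m.mul U x y) = e x * e y := by
  let _ : CommRing Γ(M, U.1) :=
    { (inferInstance : AddCommGroup Γ(M, U.1)) with
      mul := fun x y => m.mul U x y
      one := m.one U
      mul_assoc := m.mul_assoc U
      mul_comm := m.mul_comm U
      one_mul := m.one_mul U
      mul_one := fun x => (m.mul_comm U _ _).trans (m.one_mul U x)
      left_distrib := fun x y z => map_add (m.mul U x) y z
      right_distrib := fun x y z => by
        change m.mul U (x + y) z = m.mul U x z + m.mul U y z
        rw [map_add, LinearMap.add_apply]
      zero_mul := fun x => by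
        change m.mul U 0 x = 0
        rw [map_zero, LinearMap.zero_apply]
      mul_zero := fun x => map_zero (m.mul U x) }
  let _ : Algebra Γ(Y, U.1) Γ(M, U.1) := Algebra.ofModule
    (fun a x y => by
      change m.mul U (a • x) y = a • m.mul U x y
      rw [map_smul, LinearMap.smul_apply])
    (fun a x y => map_smul (m.mul U x) a y)
  exact ⟨Γ(M, U.1), inferInstance, inferInstance, LinearEquiv.refl _ _, rfl, fun _ _ => rfl⟩

theorem AlgStr.exists_lift {F : Y.Modules} (U : Y.affineOpens)
    (f : Γ(F, U.1) →ₗ[Γ(Y, U.1)] Γ(M, U.1)) : ∃ π : symAlg F U.1 →ₗ[Γ(Y, U.1)] Γ(M, U.1),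
      π 1 = m.one U ∧ (∀ x y, π (x * y) = m.mul U (π x) (π y)) ∧ ∀ v, π (symι F U.1 v) = f v := by
  obtain ⟨A, _, _, e, h1, hmul⟩ := m.exists_algebra U
  obtain ⟨g, hg⟩ := exists_symLift (e.toLinearMap ∘ₗ f)
  refine ⟨e.symm.toLinearMap ∘ₗ g.toLinearMap, e.injective ?_, fun x y => e.injective ?_,
    fun v => e.injective ?_⟩
  · simp [h1]
  · simp [hmul]
  · simp [hg]

variable {m}

/-- The condition on extensions for relations `q - x` with `q` a quadric and `x` of degree at
most one, in an algebra that is spanned by `1` and `F`. -/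
theorem AlgStr.mem_of_X_mul_mem {F : Y.Modules} {U : Y.affineOpens}
    {π : symAlg F U.1 →ₗ[Γ(Y, U.1)] Γ(M, U.1)} (h1 : π 1 = m.one U)
    (hmul : ∀ x y, π (x * y) = m.mul U (π x) (π y))
    (hπ : ∀ x ∈ symLT F U.1 2, π x = 0 → x = 0) {I : Ideal (Polynomial (symAlg F U.1))}
    (hI : ∀ q ∈ symDeg F U.1 2, ∃ x ∈ symLT F U.1 2, homogenize F U.1 2 (q - x) ∈ I)
    {S : Set (Polynomial (symAlg F U.1))} (hS : I = Ideal.span S)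
    (hSπ : ∀ s ∈ S, ∃ (n : ℕ) (x : symAlg F U.1), x ∈ symLT F U.1 (n + 1) ∧ π x = 0 ∧
      s = homogenize F U.1 n x) {g : Polynomial (symAlg F U.1)} (hg : Polynomial.X * g ∈ I) :
    g ∈ I := by
  obtain ⟨A, _, _, e, he1, hemul⟩ := m.exists_algebra U
  let p : symAlg F U.1 →ₐ[Γ(Y, U.1)] A := AlgHom.ofLinearMap (e.toLinearMap ∘ₗ π)
    (by simp [h1, he1]) (fun x y => by simp [hmul, hemul])
  have hp : ∀ x, p x = e (π x) := fun _ => rfl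
  have hker : ∀ h ∈ I, reesMap p h = 0 := by
    have : I ≤ RingHom.ker (reesMap p) := by
      rw [hS, Ideal.span_le]
      rintro s hs
      obtain ⟨n, x, hx, hx0, rfl⟩ := hSπ s hs
      change reesMap p _ = 0
      rw [reesMap_homogenize p hx, hp, hx0, map_zero, map_zero]
    exact fun h hh => this hh
  obtain ⟨l, hl, hgl⟩ := exists_sub_mem_of_quadrics hI g
  -- The Rees map fixes t, which is regular in A[t], so it kills g as soon as it kills tg.
  have h2 : reesMap p g = 0 := by
    have := hker _ hg
    rw [map_mul, reesMap_X] at this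
    exact (Polynomial.monic_X).isRegular.left (this.trans (mul_zero _).symm)
  have h3 : reesMap p l = 0 := by
    have := hker _ hgl
    rwa [map_sub, h2, zero_sub, neg_eq_zero] at this
  -- The representative l of g modulo I is killed too, and on representatives of degree at most one
  -- the map is injective.
  have h4 : l = 0 := eq_zero_of_reesMap
    (fun x hx hx0 => hπ x hx (by rwa [hp, map_eq_zero_iff e e.injective] at hx0)) hl h3
  rwa [h4, sub_zero] at hgl

/-- An algebra that decomposes as `O ⊕ F` is presented with `Q = Sym² F`. -/
theorem AlgStr.exists_presents_of_decomposition {D : CoverDatum Y}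
    (hQ : ∀ U, D.Q U = symDeg D.F U.1 2) (hσ : ∀ U c, D.σ U c ∈ symLT D.F U.1 2)
    (f : ∀ U : Y.affineOpens, Γ(D.F, U.1) →ₗ[Γ(Y, U.1)] Γ(M, U.1))
    (hf : ∀ (U V : Y.affineOpens) (h : V.1 ≤ U.1) (v : Γ(D.F, U.1)),
      f V (secRes D.F h v) = secRes M h (f U v))
    (hf₁ : ∀ (U : Y.affineOpens) (a : Γ(Y, U.1)) (v : Γ(D.F, U.1)),
      a • m.one U + f U v = 0 → a = 0 ∧ v = 0)
    (hf₂ : ∀ (U : Y.affineOpens) (x : Γ(M, U.1)), ∃ (a : Γ(Y, U.1)) (v : Γ(D.F, U.1)),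
      a • m.one U + f U v = x) :
    ∃ (θ : D.ModIso M) (Φ : D.QHom), Φ.IsCoverHom ∧ Presents D θ Φ m ∧
      ∀ U v, θ.app U (D.proj U (symι D.F U.1 v)) = f U v := by
  choose π h1 hmul hι using fun U : Y.affineOpens => m.exists_lift U (f U)
  have hlow : ∀ (U : Y.affineOpens) (a : Γ(Y, U.1)) (v : Γ(D.F, U.1)),
      π U (algebraMap _ _ a + symι _ _ v) = a • m.one U + f U v := by
    intro U a v
    rw [map_add, hι, Algebra.algebraMap_eq_smul_one, map_smul, h1]
  have hinj : ∀ (U : Y.affineOpens), ∀ x ∈ symLT D.F U.1 2, π U x = 0 → x = 0 := by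
    intro U x hx h0
    rw [eq_const_add_lin hx, hlow] at h0
    obtain ⟨ha, hv⟩ := hf₁ U _ _ h0
    rw [eq_const_add_lin hx, ha, hv, map_zero, map_zero, add_zero]
  have hres : ∀ (U V : Y.affineOpens) (h : V.1 ≤ U.1) (x : symAlg D.F U.1),
      π V (symRes D.F h x) = secRes M h (π U x) := by
    intro U V h x
    induction x using SymmetricAlgebra.induction with
    | algebraMap a =>
      rw [symRes_algebraMap, Algebra.algebraMap_eq_smul_one, Algebra.algebraMap_eq_smul_one,
        map_smul, map_smul, h1, h1, secRes_smul, m.res_one]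
    | ι v => rw [symRes_ι, hι, hι, hf U V h]
    | mul x y hx hy => rw [map_mul, hmul, hmul, m.res_mul U V, hx, hy]
    | add x y hx hy => rw [map_add, map_add, map_add, hx, hy, secRes, secRes, secRes, map_add]
  have hbij : ∀ U, Function.Bijective (π U ∘ₗ D.σ U) := by
    intro U
    refine ⟨(injective_iff_map_eq_zero _).2 fun c hc => ?_, fun x => ?_⟩
    · rw [← D.σ_section U c, hinj U _ (hσ U c) hc, map_zero]
    · obtain ⟨a, v, rfl⟩ := hf₂ U x
      refine ⟨D.proj U (algebraMap _ _ a + symι _ _ v), ?_⟩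
      rw [map_add (D.proj U), map_add, LinearMap.comp_apply, LinearMap.comp_apply,
        D.σ_proj_algebraMap, D.σ_proj_ι]
      exact (map_add (π U) _ _).symm.trans (hlow U a v)
  -- The requirement π ∘ σ = θ leaves no choice for θ; it is bijective because M is the direct sum
  -- of O·1 and the image of F.
  let θ : D.ModIso M :=
    { app := fun U => LinearEquiv.ofBijective _ (hbij U)
      res := fun U V h c => by
        change π V (D.σ V (D.resQuot h c)) = secRes M h (π U (D.σ U c))
        rw [D.σ_resQuot]
        exact hres U V h _ }
  have hθ : ∀ U c, π U (D.σ U c) = θ.app U c := fun _ _ => rfl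
  -- This is the only choice for which q − σ(Φ(q)) lies in the kernel of π.
  let Φ : D.QHom :=
    { app := fun U => (θ.app U).symm.toLinearMap ∘ₗ π U ∘ₗ (D.Q U).subtype
      res := fun U V h q => by
        refine (θ.app V).injective ?_
        rw [θ.res]
        change θ.app V ((θ.app V).symm (π V (symRes D.F h q))) =
          secRes M h (θ.app U ((θ.app U).symm (π U q)))
        rw [LinearEquiv.apply_symm_apply, LinearEquiv.apply_symm_apply]
        exact hres U V h q }
  have hΦ : ∀ U q, θ.app U (Φ.app U q) = π U q := fun U q => (θ.app U).apply_symm_apply _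
  have hdeform : ∀ U q, π U (Φ.deform U q) = 0 := by
    intro U q
    refine (map_sub (π U) _ _).trans ?_
    rw [hθ, hΦ, sub_self]
  -- The conditions on Φ quantify over all degrees n; the element 0 of Q is homogeneous of every
  -- degree and has to be treated apart.
  have hdeg : ∀ (U : Y.affineOpens) (n : ℕ) (q : D.Q U),
      (q : symAlg D.F U.1) ∈ symDeg D.F U.1 n → n = 2 ∨ q = 0 := by
    intro U n q hq
    by_cases hn : n = 2
    · exact Or.inl hn
    · have hq2 : (q : symAlg D.F U.1) ∈ symDeg D.F U.1 2 := hQ U ▸ q.2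
      exact Or.inr (Subtype.ext (by rw [← symComp_self hq2, symComp_of_ne hq hn]; rfl))
  have hlowers : ∀ U, Φ.Lowers U := by
    intro U n q hq
    rcases hdeg U n q hq with rfl | rfl
    · exact ⟨D.σ U (Φ.app U q), hσ U _, (D.σ_section U _).symm⟩
    · exact ⟨0, zero_mem _, by rw [map_zero, map_zero]⟩
  refine ⟨θ, Φ, ⟨hlowers, fun U g hg => ?_⟩, fun U => ⟨π U, h1 U, hmul U, fun x => ?_, hθ U⟩,
    fun U v => ?_⟩
  · refine m.mem_of_X_mul_mem (h1 U) (hmul U) (hinj U) (fun q hq => ?_) rfl ?_ hg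
    · have hq' : q ∈ D.Q U := (hQ U).symm ▸ hq
      exact ⟨D.σ U (Φ.app U ⟨q, hq'⟩), hσ U _, Ideal.subset_span ⟨2, ⟨q, hq'⟩, hq, rfl⟩⟩
    · rintro _ ⟨n, q, hq, rfl⟩
      exact ⟨n, _, (hlowers U).deform_mem_symLT hq, hdeform U q, rfl⟩
  · have hker : ∀ {x}, x ∈ Φ.ideal U → π U x = 0 := by
      intro x hx
      induction hx using Submodule.span_induction with
      | mem x hx =>
        obtain ⟨q, rfl⟩ := hx
        exact hdeform U q
      | zero => exact map_zero _
      | add x y _ _ hx hy => exact (map_add (π U) _ _).trans (by rw [hx, hy, add_zero])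
      | smul a x _ hx => exact (hmul U a x).trans (by rw [hx, map_zero])
    refine ⟨fun hx => ?_, hker⟩
    -- Division reduces an element of the kernel to one of the form σ(c), of degree at most one,
    -- where π is injective.
    obtain ⟨c, hc⟩ := (hlowers U).exists_sub_σ_mem x
    have h2 := hker hc
    have h3 : π U (D.σ U c) = 0 := by
      rw [← sub_eq_zero.1 ((map_sub (π U) _ _).symm.trans h2), hx]
    rw [hinj U _ (hσ U c) h3, sub_zero] at hc
    exact hc
  · rw [← hθ, D.σ_proj_ι, hι]

theorem AlgStr.exists_presents {d : ℕ} (m : AlgStr M) (hM : IsLocallyFreeOfRank M d) (hpos : 0 < d)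
    (hd : ∀ U : Y.Opens, IsUnit (d : Γ(Y, U)))
    (hfin : ∀ U : Y.affineOpens, Module.Finite Γ(Y, U.1) Γ(M, U.1)) :
    ∃ (D : CoverDatum Y) (θ : D.ModIso M) (Φ : D.QHom), Φ.IsCoverHom ∧ Presents D θ Φ m ∧
      (∀ U, D.Q U = symDeg D.F U.1 2) ∧ IsTraceFree D θ m := by
  let D : CoverDatum Y := quadDatum (m.traceless d).toModules
    (m.traceless_isLocallyFreeOfRank hM hpos hd) fun U => m.finite_traceless hM hd U
  obtain ⟨θ, Φ, hΦ, hm, hθ⟩ := m.exists_presents_of_decomposition (D := D) (fun _ => rfl)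
    (fun U c => by
      obtain ⟨x, rfl⟩ := D.exists_proj c
      exact symLow_mem x)
    (fun U => (m.traceless d).incl U.1) (fun U V h v => (m.traceless d).incl_res h v)
    (fun U _ _ h => m.eq_zero_of_smul_one_add_incl hM hd U h)
    (m.exists_eq_smul_one_add_incl hM hd)
  refine ⟨D, θ, Φ, hΦ, hm, fun _ => rfl, fun U _ v => ?_⟩
  have := hfin U
  rw [hθ]
  exact m.trace_eq_zero_of_mem_traceless hM ((m.traceless d).incl_mem v)

end Presentation

/-- The only use of characteristic 0: d is invertible in k, hence in every ring of sections over Y.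
-/
theorem isUnit_natCast {k : Type u} [Field k] [CharZero k] (f : Y ⟶ Spec (.of k)) {d : ℕ}
    (hd : 0 < d) (U : Y.Opens) : IsUnit (d : Γ(Y, U)) := by
  let g : k →+* Γ(Y, U) := (ringRes Y (le_top : U ≤ ⊤)).comp
    (f.appTop.hom.comp (Scheme.ΓSpecIso (.of k)).inv.hom)
  have h : IsUnit (d : k) := (Nat.cast_ne_zero.2 hd.ne').isUnit
  simpa using h.map g

theorem finite_pushO {X : Scheme.{u}} (φ : X ⟶ Y) [IsFinite φ] (U : Y.affineOpens) :
    Module.Finite Γ(Y, U.1) Γ(pushO φ, U.1) :=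
  IsFinite.finite_app φ U.1 U.2

end AlgCover
theorem theorem2p6 {k : Type u} [Field k] [CharZero k] [IsAlgClosed k] {X Y : Scheme.{u}}
    [IsLocallyNoetherian Y] (structureMap : Y ⟶ Spec (.of k)) (φ : X ⟶ Y) (d : ℕ) (hd : 0 < d)
    (hφ : AlgCover.IsCoveringMap φ d) :
    (∀ (D : AlgCover.CoverDatum Y) (θ : D.ModIso (AlgCover.pushO φ)) (Φ : D.QHom),
      Φ.IsCoverHom → ∃! m : AlgCover.AlgStr (AlgCover.pushO φ), AlgCover.Presents D θ Φ m) ∧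
    (∀ m : AlgCover.AlgStr (AlgCover.pushO φ),
      ∃ (D : AlgCover.CoverDatum Y) (θ : D.ModIso (AlgCover.pushO φ)) (Φ : D.QHom),
        Φ.IsCoverHom ∧ AlgCover.Presents D θ Φ m ∧
          (∀ U, D.Q U = AlgCover.symDeg D.F U.1 2) ∧ AlgCover.IsTraceFree D θ m) ∧
    (∀ (D : AlgCover.CoverDatum Y) (θ : D.ModIso (AlgCover.pushO φ)) (Φ Φ' : D.QHom)
      (m : AlgCover.AlgStr (AlgCover.pushO φ)), Φ.IsCoverHom → Φ'.IsCoverHom →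
        AlgCover.Presents D θ Φ m → AlgCover.Presents D θ Φ' m → Φ = Φ') ∧
    (∀ (D : AlgCover.CoverDatum Y) (θ : D.ModIso (AlgCover.pushO φ)) (Φ : D.QHom),
      Φ.IsCoverHom → AlgCover.Presents D θ Φ (AlgCover.AlgStr.canonical φ) →
        ∃! i : X ⟶ AlgCover.relAffineSpace D.F D.locallyFree,
          AlgCover.IsEmbeddingOf D Φ φ i ∧
            ∀ U : Y.affineOpens, ∃ π : AlgCover.symAlg D.F U.1 →+* Γ(X, φ ⁻¹ᵁ U.1),
              AlgCover.IsComorphism D φ i U π ∧ ∀ c : D.quotient U, π (D.σ U c) = θ.app U c) ∧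
    (∀ D : AlgCover.CoverDatum Y, 2 ≤ D.rank → D.IsQuadratic → D.HasLinearSyzygies →
      (∀ Φ : D.QHom, Φ.IsCoverHom → ∃! ψ : D.QLinHom, Φ.HasLinearPart ψ) ∧
      ∀ (Φ Φ' : D.QHom) (ψ : D.QLinHom), Φ.IsCoverHom → Φ'.IsCoverHom →
        Φ.HasLinearPart ψ → Φ'.HasLinearPart ψ → Φ = Φ' ∧
          ∀ (X₁ X₂ : Scheme.{u}) (φ₁ : X₁ ⟶ Y) (φ₂ : X₂ ⟶ Y)
            (i₁ : X₁ ⟶ AlgCover.relAffineSpace D.F D.locallyFree)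
            (i₂ : X₂ ⟶ AlgCover.relAffineSpace D.F D.locallyFree),
            AlgCover.IsCoveringMap φ₁ d → AlgCover.IsCoveringMap φ₂ d →
            AlgCover.IsEmbeddingOf D Φ φ₁ i₁ → AlgCover.IsEmbeddingOf D Φ' φ₂ i₂ →
              ∃ e : X₁ ≅ X₂, e.hom ≫ i₂ = i₁) := by
  have : IsFinite φ := hφ.finite
  refine ⟨fun D θ Φ hΦ => AlgCover.existsUnique_presents θ hΦ, fun m => ?_,
    fun D θ Φ Φ' m _ _ h h' => AlgCover.eq_of_presents h h',
    fun D θ Φ _ h => AlgCover.existsUnique_isEmbeddingOf h,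
    fun D hr hD hsyz => ⟨fun Φ hΦ => ⟨Φ.linearPart, hΦ.hasLinearPart hD,
      fun ψ hψ => hψ.unique (hΦ.hasLinearPart hD)⟩, fun Φ Φ' ψ hΦ hΦ' h h' => ?_⟩⟩
  · exact m.exists_presents hφ.locallyFree hd (AlgCover.isUnit_natCast structureMap hd)
      (AlgCover.finite_pushO φ)
  -- Once the cover homomorphisms are equal, the two embeddings have the same ideal.
  · obtain rfl := h.eq h' hΦ hΦ' hr hD hsyz
    refine ⟨rfl, fun X₁ X₂ φ₁ φ₂ i₁ i₂ hφ₁ hφ₂ h₁ h₂ => ?_⟩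
    have := hφ₁.finite
    have := hφ₂.finite
    exact AlgCover.exists_iso_of_isEmbeddingOf h₁ h₂
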